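/- **Notation.** Let $F$ be a free group and $\mathbb Z[F]$ its integral group ring. For a normal subgroup $R$ of $F$ let $\mathbf r=\Delta(R)\,\mathbb Z[F]$ be the two-sided ideal of $\mathbb Z[F]$ generated by the elements $r-1$ $(r\in R)$; similarly $\mathbf s,\mathbf t$ are the ideals of normal subgroups $S,T$, and $\mathbf f$ is the ideal of $F$ itself, i.e. the augmentation ideal of $\mathbb Z[F]$. Juxtaposition and $+$ denote products and sums of ideals, and $([S,S]-1)\mathbf s$ is the ideal generated by the elements $(c-1)x$ with $c\in[S,S]$, $x\in\mathbf s$. For a two-sided ideal $\mathfrak a$ put $D(F,\mathfrak a)=F\cap(1+\mathfrak a)=\{g\in F : g-1\in\mathfrak a\}$. Commutators of subgroups are left-normed: $[A,B,C,D]=[[[A,B],C],D]$. **Theorem.** Let $F$ be a free group. (1) Let $R,S,T$ be normal subgroups of $F$ with $R\subseteq S$ and $R\subseteq T$. If $a\in D(F,\ \mathbf{rsst}+\mathbf{tssr})$, then $$a^2\in D\bigl(F,\ \mathbf{rsss}+\mathbf{sssr}+\mathbf{tsss}+\mathbf{ssst}+([S,S]-1)\mathbf s\bigr)\qquad\text{and}\qquad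 a^6\in[S,S,S,RT].$$ (2) Let $R$ be a normal subgroup of $F$. If $a\in D\bigl(F,\ \mathbf{rrrf}+\mathbf{frrr}+([R,R]-1)\mathbf r\bigr)$, then $$a^3\in[R,R,R,F].$$ -/

import Mathlib

/-- The augmentation ideal `Δ(R)` of `ℤ[R]`, as an additive subgroup of `ℤ[F]`: the integer
combinations of the elements `r - 1` with `r ∈ R`. -/
noncomputable def augSpan {F : Type*} [Group F] (R : Subgroup F) : Submodule ℤ (MonoidAlgebra ℤ F) :=
  Submodule.span ℤ {x | ∃ r ∈ R, x = MonoidAlgebra.of ℤ F r - 1}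

/-- The ideal `𝐫 = Δ(R) ℤ[F]` of `ℤ[F]`. It is two-sided when `R` is normal, see
`mul_mem_grpIdeal_left` and `mul_mem_grpIdeal_right`. Products and sums of such ideals are products
and sums of additive subgroups of the ring `ℤ[F]`. -/
noncomputable def grpIdeal {F : Type*} [Group F] (R : Subgroup F) : Submodule ℤ (MonoidAlgebra ℤ F) :=
  augSpan R * ⊤

/-- `D(F, 𝔞) = F ∩ (1 + 𝔞)`. -/
def dimSubgroup (F : Type*) [Group F] (𝔞 : Submodule ℤ (MonoidAlgebra ℤ F)) : Set F :=
  {g | MonoidAlgebra.of ℤ F g - 1 ∈ 𝔞}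

theorem mul_mem_grpIdeal_right {F : Type*} [Group F] (R : Subgroup F)
    {x : MonoidAlgebra ℤ F} (hx : x ∈ grpIdeal R) (y : MonoidAlgebra ℤ F) :
    x * y ∈ grpIdeal R := by
  have h : x * y ∈ augSpan R * ⊤ * ⊤ := Submodule.mul_mem_mul hx Submodule.mem_top
  rw [mul_assoc] at h
  exact (by gcongr; exact le_top : augSpan R * (⊤ * ⊤) ≤ augSpan R * ⊤) h

theorem mul_mem_grpIdeal_left {F : Type*} [Group F] (R : Subgroup F) [R.Normal]
    {x : MonoidAlgebra ℤ F} (hx : x ∈ grpIdeal R) (y : MonoidAlgebra ℤ F) :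
    y * x ∈ grpIdeal R := by
  have key : ∀ (g : F) (r : F), r ∈ R →
      MonoidAlgebra.of ℤ F g * (MonoidAlgebra.of ℤ F r - 1) ∈ grpIdeal R := by
    intro g r hr
    have e : MonoidAlgebra.of ℤ F g * (MonoidAlgebra.of ℤ F r - 1)
        = (MonoidAlgebra.of ℤ F (g * r * g⁻¹) - 1) * MonoidAlgebra.of ℤ F g := by
      rw [mul_sub, sub_mul, ← map_mul, ← map_mul, mul_one, one_mul, inv_mul_cancel_right]
    rw [e]
    exact Submodule.mul_mem_mul
      (Submodule.subset_span ⟨_, Subgroup.Normal.conj_mem inferInstance r hr g, rfl⟩)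
      Submodule.mem_top
  have key2 : ∀ z ∈ augSpan R, ∀ g : F, MonoidAlgebra.of ℤ F g * z ∈ grpIdeal R := by
    intro z hz g
    induction hz using Submodule.span_induction with
    | mem w hw => obtain ⟨r, hr, rfl⟩ := hw; exact key g r hr
    | zero => simp
    | add u v _ _ hu hv => rw [mul_add]; exact add_mem hu hv
    | smul n u _ hu => rw [mul_smul_comm]; exact Submodule.smul_mem _ n hu
  have key3 : ∀ g : F, MonoidAlgebra.of ℤ F g * x ∈ grpIdeal R := by
    intro g
    refine Submodule.mul_induction_on (C := fun x => MonoidAlgebra.of ℤ F g * x ∈ grpIdeal R)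
      hx ?_ ?_
    · intro m hm n _
      rw [← mul_assoc]
      exact mul_mem_grpIdeal_right R (key2 m hm g) n
    · intro u v hu hv
      rw [mul_add]; exact add_mem hu hv
  induction y using MonoidAlgebra.induction_on with
  | of g => exact key3 g
  | add u v hu hv => rw [add_mul]; exact add_mem hu hv
  | smul n u hu => rw [smul_mul_assoc]; exact Submodule.smul_mem _ n hu

open MonoidAlgebra (of)
open scoped commutatorElement

/-! Write U = S ∩ T and γ₃ for the third term of the lower central series. Since ℤ[F] projects onto
ℤ[ST] (`exists_projection`) and R lies in U, the main claim reduces to: if F = ST and a − 1 lies in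
usst + tssu, then a⁶ lies in [γ₃(S), T]. The projection f ↦ f·rep(f)⁻¹ of ℤ[F] to ℤ[S], with coset
representatives in T, shows that a − 1 lies in Δ(S)²Δ(U). By `mem_of_del_mem`, a is then in the
product of [U ∩ [S,S], U ∩ [S,S]] and γ₃(U), hence in γ₃(S) ∩ T. This group is abelian modulo
[γ₃(S), T], so it suffices that 6χ(a) = 0 for every ℚ/ℤ-valued character χ of it that vanishes on
[γ₃(S), T] (`CentralChar`).

Subgroups of F are free, so functionals on ℤ[F] can be prescribed through crossed homomorphisms
(`exists_functional_of_cocycle`). Two kinds yield zero at a − 1. A triadditive function on S × S × U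
invariant under T gives a functional that, after the projection, kills usst + tssu
(`IsTriadditive.functional_kappaR_eq_zero`). A family of pairs (B_τ, C_τ), crossed in τ ∈ T, gives a
functional that kills tsst (`CrossedPair.exists_functional`).

To obtain such data from χ, take an endomorphism q of F with values in T that is the identity modulo
S, and put d(f) = f·q(f)⁻¹ ∈ S. Expressions such as χ[[q x, y], u], χ[w, d τ] and χ[[b, s], d τ]
have the required invariance. The function f ↦ χ[d f, ·] on F is crossed only up to a quadratic
term; `exists_crossed` supplies a crossed homomorphism c with that term corrected. The difference
χ[d τ, w] − c τ w gives a further crossed pair, and on [S,S] the function c is computed by a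
trilinear functional (`crossed_eq`). In `six_smul_eq_zero` a combination of five functionals agrees
with 6χ on the commutators [w, w'] and [[x, y], z] that generate the group containing a.

For the second part S = U = R and T = F. One trilinear functional suffices: it is symmetric in its
first two arguments, so it also vanishes on the term ([R,R] − 1)r, and by the Jacobi identity it
equals −3χ on γ₃(R). The statement about a² is formal, because R ≤ S. -/

/-- The element `g - 1` of the integral group ring. -/
noncomputable def del {G : Type*} [Group G] (g : G) : MonoidAlgebra ℤ G := of ℤ G g - 1

/-- The linear extension of a function on a group to its integral group ring. -/
noncomputable def gext {G M : Type*} [Group G] [AddCommGroup M] (f : G → M) :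
    MonoidAlgebra ℤ G →ₗ[ℤ] M :=
  Finsupp.linearCombination ℤ f ∘ₗ (MonoidAlgebra.coeffLinearEquiv ℤ).toLinearMap

/-- `f` restricts to a homomorphism from the subgroup `H` to an additive group. -/
def HomOn {G A : Type*} [Group G] [AddCommGroup A] (H : Subgroup G) (f : G → A) : Prop :=
  ∀ x ∈ H, ∀ y ∈ H, f (x * y) = f x + f y

/-! ### Identities for g − 1 in the group ring -/

section

variable {G M : Type*} [Group G] [AddCommGroup M]

@[simp]
theorem gext_of (f : G → M) (g : G) : gext f (of ℤ G g) = f g := by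
  simp [gext, MonoidAlgebra.of]

@[simp]
theorem gext_one (f : G → M) : gext f 1 = f 1 := by
  rw [← map_one (of ℤ G), gext_of]

theorem gext_del (f : G → M) (g : G) : gext f (del g) = f g - f 1 := by
  rw [del, map_sub, gext_of, gext_one]

theorem hom_ext_of {φ ψ : MonoidAlgebra ℤ G →ₗ[ℤ] M} (h : ∀ g, φ (of ℤ G g) = ψ (of ℤ G g)) :
    φ = ψ := by
  refine LinearMap.ext fun x ↦ ?_
  induction x using MonoidAlgebra.induction_on with
  | of g => exact h g
  | add u v hu hv => rw [map_add, map_add, hu, hv]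
  | smul n u hu => rw [map_smul, map_smul, hu]

@[simp]
theorem del_one : del (1 : G) = 0 := by rw [del, map_one, sub_self]

theorem of_eq_del_add_one (g : G) : of ℤ G g = del g + 1 := by rw [del]; abel

theorem del_mul (g h : G) : del (g * h) = del g * del h + del g + del h := by
  simp only [del, map_mul]; noncomm_ring

theorem del_mul_of (g h : G) : del g * of ℤ G h = del (g * h) - del h := by
  simp only [del, map_mul]; noncomm_ring

theorem of_mul_del (g h : G) : of ℤ G g * del h = del (g * h) - del g := by
  simp only [del, map_mul]; noncomm_ring

/-- From xyx⁻¹y⁻¹ − 1 = (xy − yx)x⁻¹y⁻¹: a functional that does not see the trailing group element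
turns group commutators into antisymmetrizations. -/
theorem del_commutator (x y : G) :
    del ⁅x, y⁆ = (del x * del y - del y * del x) * of ℤ G (x⁻¹ * y⁻¹) := by
  have h : of ℤ G (x * y * (x⁻¹ * y⁻¹)) = of ℤ G x * of ℤ G y * of ℤ G (x⁻¹ * y⁻¹) := by
    rw [map_mul, map_mul]
  have h2 : (1 : MonoidAlgebra ℤ G) = of ℤ G y * of ℤ G x * of ℤ G (x⁻¹ * y⁻¹) := by
    rw [← map_mul, ← map_mul, ← map_one (of ℤ G)]; congr 1; group
  have h3 : del ⁅x, y⁆ = of ℤ G (x * y * (x⁻¹ * y⁻¹)) - 1 := by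
    rw [del, commutatorElement_def]; congr 2; group
  rw [h3, h]; nth_rw 1 [h2]; simp only [del]; noncomm_ring

theorem del_mem_augSpan {H : Subgroup G} {h : G} (hh : h ∈ H) : del h ∈ augSpan H :=
  Submodule.subset_span ⟨h, hh, rfl⟩

end

/-! ### Homomorphisms defined on a subgroup -/

namespace HomOn

variable {G A : Type*} [Group G] [AddCommGroup A] {H : Subgroup G} {f f' : G → A}

theorem one (hf : HomOn H f) : f 1 = 0 := by
  have := hf 1 H.one_mem 1 H.one_mem
  simpa using this

theorem inv (hf : HomOn H f) {x : G} (hx : x ∈ H) : f x⁻¹ = -f x := by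
  have := hf x hx x⁻¹ (H.inv_mem hx)
  rw [mul_inv_cancel, hf.one] at this
  exact (neg_eq_of_add_eq_zero_right this.symm).symm

theorem mono {H' : Subgroup G} (hf : HomOn H f) (h : H' ≤ H) : HomOn H' f :=
  fun x hx y hy ↦ hf x (h hx) y (h hy)

theorem conj (hf : HomOn H f) {x y : G} (hx : x ∈ H) (hy : y ∈ H) : f (x * y * x⁻¹) = f y := by
  rw [hf _ (H.mul_mem hx hy) _ (H.inv_mem hx), hf x hx y hy, hf.inv hx]; abel

theorem conj' (hf : HomOn H f) {x y : G} (hx : x ∈ H) (hy : y ∈ H) : f (x⁻¹ * y * x) = f y := by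
  simpa using hf.conj (H.inv_mem hx) hy

theorem commutator (hf : HomOn H f) {x y : G} (hx : x ∈ H) (hy : y ∈ H) : f ⁅x, y⁆ = 0 := by
  rw [commutatorElement_def, hf _ (H.mul_mem (H.mul_mem hx hy) (H.inv_mem hx)) _ (H.inv_mem hy),
    hf.conj hx hy, hf.inv hy]; abel

theorem add (hf : HomOn H f) (hf' : HomOn H f') : HomOn H (fun x ↦ f x + f' x) :=
  fun x hx y hy ↦ by simp only [hf x hx y hy, hf' x hx y hy]; abel

theorem sub (hf : HomOn H f) (hf' : HomOn H f') : HomOn H (fun x ↦ f x - f' x) :=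
  fun x hx y hy ↦ by simp only [hf x hx y hy, hf' x hx y hy]; abel

theorem neg (hf : HomOn H f) : HomOn H (fun x ↦ -f x) :=
  fun x hx y hy ↦ by simp only [hf x hx y hy]; abel

theorem zsmul (hf : HomOn H f) (n : ℤ) : HomOn H (fun x ↦ n • f x) :=
  fun x hx y hy ↦ by simp only [hf x hx y hy, smul_add]

theorem zpow (hf : HomOn H f) {x : G} (hx : x ∈ H) (n : ℤ) : f (x ^ n) = n • f x := by
  have key : ∀ k : ℕ, f (x ^ k) = k • f x := by
    intro k
    induction k with
    | zero => simpa using hf.one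
    | succ k ih => rw [pow_succ, hf _ (H.pow_mem hx k) _ hx, ih, succ_nsmul]
  cases n with
  | ofNat n => simpa using key n
  | negSucc n =>
    rw [zpow_negSucc, hf.inv (H.pow_mem hx _), key, negSucc_zsmul]

theorem pow (hf : HomOn H f) {x : G} (hx : x ∈ H) (n : ℕ) : f (x ^ n) = n • f x := by
  simpa using hf.zpow hx n

/-- Two homomorphisms on the subgroup generated by a set agree if they agree on the set. -/
theorem eq_of_closure {s : Set G} (hf : HomOn (Subgroup.closure s) f)
    (hf' : HomOn (Subgroup.closure s) f') (h : ∀ x ∈ s, f x = f' x) {x : G}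
    (hx : x ∈ Subgroup.closure s) : f x = f' x := by
  induction hx using Subgroup.closure_induction with
  | mem x hx => exact h x hx
  | one => rw [hf.one, hf'.one]
  | mul x y hx hy h1 h2 => rw [hf x hx y hy, hf' x hx y hy, h1, h2]
  | inv x hx h1 => rw [hf.inv hx, hf'.inv hx, h1]

theorem eq_of_commutator {H₁ H₂ : Subgroup G} (hf : HomOn ⁅H₁, H₂⁆ f)
    (hf' : HomOn ⁅H₁, H₂⁆ f') (h : ∀ x ∈ H₁, ∀ y ∈ H₂, f ⁅x, y⁆ = f' ⁅x, y⁆) {x : G}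
    (hx : x ∈ ⁅H₁, H₂⁆) : f x = f' x := by
  rw [Subgroup.commutator_def] at hf hf' hx
  refine hf.eq_of_closure hf' ?_ hx
  rintro _ ⟨x, hx, y, hy, rfl⟩
  exact h x hx y hy

theorem eq_of_sup {H₁ H₂ : Subgroup G} (hf : HomOn (H₁ ⊔ H₂) f)
    (hf' : HomOn (H₁ ⊔ H₂) f') (h₁ : ∀ x ∈ H₁, f x = f' x) (h₂ : ∀ x ∈ H₂, f x = f' x) {x : G}
    (hx : x ∈ H₁ ⊔ H₂) : f x = f' x := by
  rw [Subgroup.sup_eq_closure] at hf hf' hx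
  exact hf.eq_of_closure hf' (fun x hx ↦ hx.elim (h₁ x) (h₂ x)) hx

theorem zero : HomOn H (fun _ ↦ (0 : A)) := fun _ _ _ _ ↦ by simp

end HomOn

/-! ### Crossed homomorphisms on free groups -/

section Free

variable {F : Type*} [Group F] [IsFreeGroup F]

theorem closure_range_of : Subgroup.closure (Set.range (IsFreeGroup.of (G := F))) = ⊤ := by
  set H := Subgroup.closure (Set.range (IsFreeGroup.of (G := F)))
  let θ : F →* H := IsFreeGroup.lift fun i ↦
    (⟨IsFreeGroup.of i, Subgroup.subset_closure ⟨i, rfl⟩⟩ : H)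
  have h : H.subtype.comp θ = MonoidHom.id F := by
    refine IsFreeGroup.ext_hom fun i ↦ ?_
    simp [θ, IsFreeGroup.lift_of]
  rw [eq_top_iff]
  intro x _
  have := DFunLike.congr_fun h x
  simp only [MonoidHom.comp_apply, Subgroup.subtype_apply, MonoidHom.id_apply] at this
  rw [← this]
  exact (θ x).2

theorem free_induction {p : F → Prop} (h1 : p 1) (hof : ∀ i, p (IsFreeGroup.of i))
    (hmul : ∀ x y, p x → p y → p (x * y)) (hinv : ∀ x, p x → p x⁻¹) (x : F) : p x := by
  have hx : x ∈ Subgroup.closure (Set.range (IsFreeGroup.of (G := F))) := by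
    rw [closure_range_of]; trivial
  induction hx using Subgroup.closure_induction with
  | mem x hx => obtain ⟨i, rfl⟩ := hx; exact hof i
  | one => exact h1
  | mul x y _ _ hx hy => exact hmul x y hx hy
  | inv x _ hx => exact hinv x hx

/-- On a free group crossed homomorphisms with prescribed values on the basis exist. -/
theorem exists_crossedHom {M : Type*} [AddCommGroup M] (act : F →* AddMonoid.End M)
    (m : IsFreeGroup.Generators F → M) :
    ∃ c : F → M, (∀ i, c (IsFreeGroup.of i) = m i) ∧ ∀ f g, c (f * g) = c f + act f (c g) := by
  have hinv : ∀ f m, act f⁻¹ (act f m) = m := fun f m ↦ by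
    have h : act f⁻¹ * act f = 1 := by rw [← map_mul, inv_mul_cancel, map_one]
    exact DFunLike.congr_fun h m
  let φ : F →* MulAut (Multiplicative M) :=
    { toFun := fun f ↦
        { toFun := fun x ↦ Multiplicative.ofAdd (act f x.toAdd)
          invFun := fun x ↦ Multiplicative.ofAdd (act f⁻¹ x.toAdd)
          left_inv := fun x ↦ by simp [hinv]
          right_inv := fun x ↦ by simpa using congrArg Multiplicative.ofAdd (hinv f⁻¹ x.toAdd)
          map_mul' := fun x y ↦ by simp }
      map_one' := by ext; simp
      map_mul' := fun f g ↦ by ext; simp }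
  -- A crossed homomorphism is a section of M ⋊ F → F, which freeness provides from its values on
  -- the basis.
  let θ : F →* Multiplicative M ⋊[φ] F :=
    IsFreeGroup.lift fun i ↦ ⟨Multiplicative.ofAdd (m i), IsFreeGroup.of i⟩
  have hr : SemidirectProduct.rightHom.comp θ = MonoidHom.id F := by
    refine IsFreeGroup.ext_hom fun i ↦ ?_
    simp [θ, IsFreeGroup.lift_of]
  have hr' : ∀ f, (θ f).right = f := fun f ↦ DFunLike.congr_fun hr f
  refine ⟨fun f ↦ Multiplicative.toAdd (θ f).left, fun i ↦ ?_, fun f g ↦ ?_⟩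
  · simp [θ, IsFreeGroup.lift_of]
  · change Multiplicative.toAdd (θ (f * g)).left = _
    rw [map_mul, SemidirectProduct.mul_left, hr']
    rfl

theorem crossedHom_one {G M : Type*} [Group G] [AddCommGroup M] {act : G →* AddMonoid.End M}
    {c : G → M} (hc : ∀ f g, c (f * g) = c f + act f (c g)) : c 1 = 0 := by
  have := hc 1 1
  simpa using this

theorem crossedHom_inv {G M : Type*} [Group G] [AddCommGroup M] {act : G →* AddMonoid.End M}
    {c : G → M} (hc : ∀ f g, c (f * g) = c f + act f (c g)) (f : G) :
    c f⁻¹ = -act f⁻¹ (c f) := by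
  have := hc f⁻¹ f
  rw [inv_mul_cancel, crossedHom_one hc] at this
  exact eq_neg_of_add_eq_zero_left this.symm

/-- A crossed homomorphism whose values on the basis lie in a stable subgroup takes values there. -/
theorem crossedHom_mem {M : Type*} [AddCommGroup M] {act : F →* AddMonoid.End M}
    {c : F → M} (hc : ∀ f g, c (f * g) = c f + act f (c g)) (M₀ : AddSubgroup M)
    (hM : ∀ f, ∀ m ∈ M₀, act f m ∈ M₀) (h : ∀ i, c (IsFreeGroup.of i) ∈ M₀) (f : F) :
    c f ∈ M₀ := by
  induction f using free_induction with
  | h1 => rw [crossedHom_one hc]; exact M₀.zero_mem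
  | hof i => exact h i
  | hmul x y hx hy => rw [hc]; exact M₀.add_mem hx (hM _ _ hy)
  | hinv x hx => rw [crossedHom_inv hc]; exact M₀.neg_mem (hM _ _ hx)

end Free

/-- Let `H` be a free subgroup of `G` and `X` an additive subgroup of `ℤ[G]` stable under right
multiplication by `H`. Functionals `c h` that satisfy the cocycle identity on `X` come from one
functional `Φ` on `ℤ[G]` with `Φ (z * (h - 1)) = c h z` for `z ∈ X`. -/
theorem exists_functional_of_cocycle {G A : Type*} [Group G] [AddCommGroup A] (H : Subgroup G)
    [IsFreeGroup H] (X : Submodule ℤ (MonoidAlgebra ℤ G))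
    (hX : ∀ z ∈ X, ∀ h ∈ H, z * of ℤ G h ∈ X) (c : G → MonoidAlgebra ℤ G →ₗ[ℤ] A)
    (hc : ∀ h' ∈ H, ∀ h ∈ H, ∀ z ∈ X, c (h' * h) z = c h (z * of ℤ G h') + c h' z) :
    ∃ Φ : MonoidAlgebra ℤ G →ₗ[ℤ] A, ∀ h ∈ H, ∀ z ∈ X, Φ (z * del h) = c h z := by
  -- `H` acts on functionals by right translation, and `c` is crossed only on `X`. The crossed
  -- homomorphism `k` with the values of `c` on a basis of `H` is crossed on all of ℤ[G] and agrees
  -- with `c` on `X`.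
  let act : H →* AddMonoid.End (MonoidAlgebra ℤ G →ₗ[ℤ] A) :=
    { toFun := fun h ↦
        { toFun := fun φ ↦ φ ∘ₗ LinearMap.mulRight ℤ (of ℤ G (h : G))
          map_zero' := by ext; simp
          map_add' := fun φ ψ ↦ by ext; simp }
      map_one' := by
        refine AddMonoidHom.ext fun φ ↦ LinearMap.ext fun z ↦ ?_
        change φ (z * of ℤ G ((1 : H) : G)) = φ z
        rw [Subgroup.coe_one, map_one, mul_one]
      map_mul' := fun h h' ↦ by
        refine AddMonoidHom.ext fun φ ↦ LinearMap.ext fun z ↦ ?_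
        change φ (z * of ℤ G ((h * h' : H) : G)) = φ (z * of ℤ G (h : G) * of ℤ G (h' : G))
        rw [Subgroup.coe_mul, map_mul (of ℤ G), mul_assoc] }
  have hact : ∀ h φ z, act h φ z = φ (z * of ℤ G (h : G)) := fun _ _ _ ↦ rfl
  obtain ⟨k, hk, hkm⟩ := exists_crossedHom act fun i ↦ c (IsFreeGroup.of i : H)
  have hkm' : ∀ f g z, k (f * g) z = k f z + k g (z * of ℤ G (f : G)) := by
    intro f g z; rw [hkm, LinearMap.add_apply, hact]
  have hkc : ∀ h : H, ∀ z ∈ X, k h z = c h z := by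
    intro h
    induction h using free_induction with
    | h1 =>
      intro z hz
      have := hc 1 H.one_mem 1 H.one_mem z hz
      simp only [mul_one, map_one] at this
      rw [crossedHom_one hkm, LinearMap.zero_apply, Subgroup.coe_one]
      exact (left_eq_add.mp this).symm
    | hof i => intro z _; rw [hk]
    | hmul x y hx hy =>
      intro z hz
      rw [hkm', hx z hz, hy _ (hX z hz x x.2), Subgroup.coe_mul, hc x x.2 y y.2 z hz, add_comm]
    | hinv x hx =>
      intro z hz
      have h1 := hkm' x⁻¹ x z
      have h2 := hc (x⁻¹ : G) (H.inv_mem x.2) x x.2 z hz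
      have h3 := hc 1 H.one_mem 1 H.one_mem z hz
      simp only [mul_one, map_one] at h3
      rw [inv_mul_cancel, crossedHom_one hkm, LinearMap.zero_apply,
        hx _ (hX z hz _ (x⁻¹).2)] at h1
      rw [inv_mul_cancel] at h2
      have h4 : c 1 z = 0 := by simpa using h3
      rw [h4] at h2
      rw [Subgroup.coe_inv] at h1 ⊢
      rw [eq_neg_of_add_eq_zero_left h1.symm, eq_neg_of_add_eq_zero_right h2.symm]
  let rep : G → G := fun f ↦ (QuotientGroup.mk f : G ⧸ H).out
  have hrep : ∀ f, (rep f)⁻¹ * f ∈ H := by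
    intro f
    rw [← QuotientGroup.eq]
    exact QuotientGroup.out_eq' _
  have hrep2 : ∀ f, ∀ h ∈ H, rep (f * h) = rep f := by
    intro f h hh
    simp only [rep]
    rw [QuotientGroup.mk_mul_of_mem f hh]
  -- On each left coset of `H`, `k` is integrated starting from the representative.
  let Φ : MonoidAlgebra ℤ G →ₗ[ℤ] A := gext fun f ↦ k ⟨(rep f)⁻¹ * f, hrep f⟩ (of ℤ G (rep f))
  have key : ∀ (h : H) f, Φ (of ℤ G (f * h)) - Φ (of ℤ G f) = k h (of ℤ G f) := by
    intro h f
    simp only [Φ, gext_of]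
    have e : (⟨(rep (f * h))⁻¹ * (f * h), hrep _⟩ : H) = ⟨(rep f)⁻¹ * f, hrep f⟩ * h := by
      ext; simp only [Subgroup.coe_mul]; rw [hrep2 f h h.2, mul_assoc]
    rw [e, hkm', hrep2 f h h.2, ← map_mul, mul_inv_cancel_left]
    abel
  refine ⟨Φ, fun h hh z hz ↦ ?_⟩
  rw [← hkc ⟨h, hh⟩ z hz]
  have : Φ ∘ₗ LinearMap.mulRight ℤ (del h) = k ⟨h, hh⟩ := by
    refine hom_ext_of fun f ↦ ?_
    rw [LinearMap.comp_apply, LinearMap.mulRight_apply, ← key ⟨h, hh⟩ f, del, mul_sub, mul_one,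
      map_sub Φ, ← map_mul]
  rw [← this]; rfl

/-! ### Extension and separation of characters -/

section Extension

/-- `A` is injective, and `j` embeds M / ker j into N, so the map that `g` induces on the quotient
extends. -/
theorem exists_comp_eq_of_ker_le {M N A : Type*} [AddCommGroup M] [AddCommGroup N]
    [AddCommGroup A] (hA : Module.Baer ℤ A) (j : M →ₗ[ℤ] N) (g : M →ₗ[ℤ] A)
    (h : LinearMap.ker j ≤ LinearMap.ker g) : ∃ k : N →ₗ[ℤ] A, ∀ x, k (j x) = g x := by
  obtain ⟨k, hk⟩ := hA.extension_property ((LinearMap.ker j).liftQ j le_rfl)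
    (LinearMap.ker_eq_bot.mp (Submodule.ker_liftQ_eq_bot _ _ _ le_rfl))
    ((LinearMap.ker j).liftQ g h)
  exact ⟨k, fun x ↦ by simpa using LinearMap.congr_fun hk (Submodule.Quotient.mk x)⟩

variable {G A : Type*} [Group G] [AddCommGroup A]

theorem HomOn.eq_zero_of_mem_commutator {H : Subgroup G} {f : G → A} (hf : HomOn H f) {x : G}
    (hx : x ∈ ⁅H, H⁆) : f x = 0 :=
  (hf.mono (Subgroup.commutator_le_self H)).eq_of_commutator HomOn.zero
    (fun _ hx _ hy ↦ hf.commutator hx hy) hx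

/-- The class of an element of `H` in the abelianization of `H`, written additively. -/
def abMk (H : Subgroup G) (x : H) : Additive (Abelianization H) :=
  Additive.ofMul (Abelianization.of x)

theorem abMk_mul (H : Subgroup G) (x y : H) : abMk H (x * y) = abMk H x + abMk H y := by
  simp [abMk]

theorem abMk_surjective (H : Subgroup G) : Function.Surjective (abMk H) := fun x ↦ by
  obtain ⟨y, hy⟩ := QuotientGroup.mk_surjective x.toMul
  exact ⟨y, congrArg Additive.ofMul hy⟩

theorem abMk_eq_zero {H : Subgroup G} {x : H} : abMk H x = 0 ↔ (x : G) ∈ ⁅H, H⁆ := by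
  rw [← Subgroup.map_subtype_commutator, Subgroup.mem_map]
  have : abMk H x = 0 ↔ x ∈ commutator H := by
    rw [← Abelianization.ker_of, MonoidHom.mem_ker]; rfl
  rw [this]
  constructor
  · exact fun h ↦ ⟨x, h, rfl⟩
  · rintro ⟨y, hy, e⟩
    rwa [← Subtype.ext e]

/-- A homomorphism on a subgroup to an abelian group factors through the abelianization. -/
theorem HomOn.exists_linearMap {H : Subgroup G} {f : G → A} (hf : HomOn H f) :
    ∃ g : Additive (Abelianization H) →ₗ[ℤ] A, ∀ x : H, g (abMk H x) = f x := by
  let θ : H →* Multiplicative A :=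
    MonoidHom.mk' (fun x ↦ Multiplicative.ofAdd (f x)) fun x y ↦ by simp [hf x x.2 y y.2]
  exact ⟨(MonoidHom.toAdditiveLeft (Abelianization.lift θ)).toIntLinearMap, fun x ↦ rfl⟩

theorem homOn_of_linearMap {H : Subgroup G} (g : Additive (Abelianization H) →ₗ[ℤ] A) :
    ∃ f : G → A, HomOn H f ∧ ∀ x : H, f x = g (abMk H x) := by
  classical
  refine ⟨fun x ↦ if hx : x ∈ H then g (abMk H ⟨x, hx⟩) else 0, fun x hx y hy ↦ ?_, fun x ↦ ?_⟩
  · simp only [hx, hy, H.mul_mem hx hy, dif_pos]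
    rw [← map_add, ← abMk_mul]; rfl
  · simp

/-- Homomorphisms into a divisible group extend from a subgroup `L` of `H` to `H` if they vanish
on `L ⊓ ⁅H, H⁆`. -/
theorem HomOn.exists_extension (hA : Module.Baer ℤ A) {L H : Subgroup G} (hLH : L ≤ H) {f : G → A}
    (hf : HomOn L f) (h0 : ∀ x ∈ L, x ∈ ⁅H, H⁆ → f x = 0) :
    ∃ f' : G → A, HomOn H f' ∧ ∀ x ∈ L, f' x = f x := by
  obtain ⟨g, hg⟩ := hf.exists_linearMap
  let j : Additive (Abelianization L) →ₗ[ℤ] Additive (Abelianization H) :=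
    (MonoidHom.toAdditive (Abelianization.map (Subgroup.inclusion hLH))).toIntLinearMap
  have hj : ∀ x : L, j (abMk L x) = abMk H (Subgroup.inclusion hLH x) := fun x ↦ rfl
  obtain ⟨k, hk⟩ := exists_comp_eq_of_ker_le hA j g (fun x hx ↦ by
    obtain ⟨x, rfl⟩ := abMk_surjective L x
    rw [LinearMap.mem_ker, hj, abMk_eq_zero] at hx
    rw [LinearMap.mem_ker, hg]
    exact h0 x x.2 hx)
  obtain ⟨f', hf', h'⟩ := homOn_of_linearMap k
  refine ⟨f', hf', fun x hx ↦ ?_⟩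
  rw [h' ⟨x, hLH hx⟩, ← hg ⟨x, hx⟩, ← hk, hj]; rfl

/-- Characters separate the elements of `L` outside a subgroup that contains `⁅L, L⁆`. -/
theorem exists_character_ne_zero {L M : Subgroup G} (hML : M ≤ L) (hLM : ⁅L, L⁆ ≤ M) {a : G}
    (ha : a ∈ L) (haM : a ∉ M) :
    ∃ f : G → AddCircle (1 : ℚ), HomOn L f ∧ (∀ x ∈ M, f x = 0) ∧ f a ≠ 0 := by
  let j : Additive (Abelianization M) →ₗ[ℤ] Additive (Abelianization L) :=
    (MonoidHom.toAdditive (Abelianization.map (Subgroup.inclusion hML))).toIntLinearMap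
  have hj : ∀ x : M, j (abMk M x) = abMk L (Subgroup.inclusion hML x) := fun x ↦ rfl
  have hne : (LinearMap.range j).mkQ (abMk L ⟨a, ha⟩) ≠ 0 := by
    intro h
    rw [Submodule.mkQ_apply, Submodule.Quotient.mk_eq_zero] at h
    obtain ⟨x, hx⟩ := h
    obtain ⟨x, rfl⟩ := abMk_surjective M x
    have h1 : abMk L (⟨a, ha⟩ * (Subgroup.inclusion hML x)⁻¹) = 0 := by
      have := abMk_mul L (⟨a, ha⟩ * (Subgroup.inclusion hML x)⁻¹) (Subgroup.inclusion hML x)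
      rw [inv_mul_cancel_right, ← hj, hx] at this
      exact right_eq_add.mp this
    rw [abMk_eq_zero] at h1
    refine haM ?_
    have := M.mul_mem (hLM h1) x.2
    simpa using this
  obtain ⟨χ, hχ⟩ := CharacterModule.exists_character_apply_ne_zero_of_ne_zero hne
  let χ' : (Additive (Abelianization L) ⧸ LinearMap.range j) →+ AddCircle (1 : ℚ) := χ
  obtain ⟨f, hf, h⟩ := homOn_of_linearMap (χ'.toIntLinearMap ∘ₗ (LinearMap.range j).mkQ)
  refine ⟨f, hf, fun x hx ↦ ?_, ?_⟩
  · have e : (LinearMap.range j).mkQ (abMk L ⟨x, hML hx⟩) = 0 := by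
      rw [Submodule.mkQ_apply, Submodule.Quotient.mk_eq_zero]
      exact ⟨abMk M ⟨x, hx⟩, hj _⟩
    rw [h ⟨x, hML hx⟩, LinearMap.comp_apply, e, map_zero]
  · rw [h ⟨a, ha⟩]; exact hχ

end Extension

/-! ### Functionals from biadditive and triadditive functions -/

section Functionals

variable {G A : Type*} [Group G] [AddCommGroup A] {S U : Subgroup G}

theorem augSpan_eqOn {M : Type*} [AddCommGroup M] {φ ψ : MonoidAlgebra ℤ G →ₗ[ℤ] M}
    (h : ∀ s ∈ S, φ (del s) = ψ (del s)) {z : MonoidAlgebra ℤ G} (hz : z ∈ augSpan S) :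
    φ z = ψ z := by
  refine LinearMap.eqOn_span (s := {x | ∃ r ∈ S, x = of ℤ G r - 1}) ?_ hz
  rintro _ ⟨s, hs, rfl⟩
  exact h s hs

theorem augSpan_mul_eqOn {M : Type*} [AddCommGroup M] {φ ψ : MonoidAlgebra ℤ G →ₗ[ℤ] M}
    {Y : Submodule ℤ (MonoidAlgebra ℤ G)}
    (h : ∀ s ∈ S, ∀ y ∈ Y, φ (del s * y) = ψ (del s * y)) {z : MonoidAlgebra ℤ G}
    (hz : z ∈ augSpan S * Y) : φ z = ψ z := by
  induction hz using Submodule.mul_induction_on' with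
  | mem_mul_mem m hm n hn =>
    exact augSpan_eqOn (φ := φ ∘ₗ LinearMap.mulRight ℤ n) (ψ := ψ ∘ₗ LinearMap.mulRight ℤ n)
      (fun s hs ↦ h s hs n hn) hm
  | add x _ y _ hx hy => rw [map_add, map_add, hx, hy]

theorem augSpan_augSpan_eqOn {M : Type*} [AddCommGroup M] {φ ψ : MonoidAlgebra ℤ G →ₗ[ℤ] M}
    {S' : Subgroup G} (h : ∀ s ∈ S, ∀ s' ∈ S', φ (del s * del s') = ψ (del s * del s'))
    {z : MonoidAlgebra ℤ G} (hz : z ∈ augSpan S * augSpan S') : φ z = ψ z :=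
  augSpan_mul_eqOn (fun s hs _ hy ↦
    augSpan_eqOn (φ := φ ∘ₗ LinearMap.mulLeft ℤ (del s)) (ψ := ψ ∘ₗ LinearMap.mulLeft ℤ (del s))
      (fun s' hs' ↦ h s hs s' hs') hy) hz

theorem augSpan_mul_of_mem (hUS : U ≤ S) {z : MonoidAlgebra ℤ G} (hz : z ∈ augSpan S) {u : G}
    (hu : u ∈ U) : z * of ℤ G u ∈ augSpan S := by
  induction hz using Submodule.span_induction with
  | mem x hx =>
    obtain ⟨s, hs, rfl⟩ := hx
    change del s * _ ∈ _
    rw [del_mul_of]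
    exact sub_mem (del_mem_augSpan (S.mul_mem hs (hUS hu))) (del_mem_augSpan (hUS hu))
  | zero => simp
  | add x y _ _ hx hy => rw [add_mul]; exact add_mem hx hy
  | smul n x _ hx => rw [smul_mul_assoc]; exact Submodule.smul_mem _ n hx

theorem mul_augSpan_mul_of_mem (hUS : U ≤ S) {Y : Submodule ℤ (MonoidAlgebra ℤ G)}
    {z : MonoidAlgebra ℤ G} (hz : z ∈ Y * augSpan S) {u : G}
    (hu : u ∈ U) : z * of ℤ G u ∈ Y * augSpan S := by
  induction hz using Submodule.mul_induction_on' with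
  | mem_mul_mem m hm n hn =>
    rw [mul_assoc]
    exact Submodule.mul_mem_mul hm (augSpan_mul_of_mem hUS hn hu)
  | add x _ y _ hx hy => rw [add_mul]; exact add_mem hx hy

/-- A biadditive function on `S × U` extends to a functional on the group ring. -/
theorem exists_bilinear_functional [IsFreeGroup U] (hUS : U ≤ S) (t : G → G → A)
    (h1 : ∀ u ∈ U, HomOn S (t · u)) (h2 : ∀ s ∈ S, HomOn U (t s)) :
    ∃ Φ : MonoidAlgebra ℤ G →ₗ[ℤ] A, ∀ s ∈ S, ∀ u ∈ U, Φ (del s * del u) = t s u := by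
  -- The value prescribed on z(u − 1) is the linear extension of s ↦ t s u; additivity in both
  -- variables gives the cocycle identity over `U`.
  obtain ⟨Φ, hΦ⟩ := exists_functional_of_cocycle U (augSpan S)
    (fun z hz u hu ↦ augSpan_mul_of_mem hUS hz hu) (fun u ↦ gext (t · u)) (by
      intro u' hu' u hu z hz
      refine augSpan_eqOn (φ := gext (t · (u' * u)))
        (ψ := gext (t · u) ∘ₗ LinearMap.mulRight ℤ (of ℤ G u') + gext (t · u'))
        (fun s hs ↦ ?_) hz
      rw [LinearMap.add_apply, LinearMap.comp_apply, LinearMap.mulRight_apply, del_mul_of, map_sub]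
      simp only [gext_del, (h1 u hu).one, (h1 u' hu').one, (h1 _ (U.mul_mem hu' hu)).one,
        h2 s hs u' hu' u hu, h1 u hu s hs u' (hUS hu')]
      abel)
  refine ⟨Φ, fun s hs u hu ↦ ?_⟩
  rw [hΦ u hu _ (del_mem_augSpan hs), gext_del, (h1 u hu).one, sub_zero]

/-- A triadditive function on `S × S × U` extends to a functional on the group ring. -/
theorem exists_trilinear_functional [IsFreeGroup S] [IsFreeGroup U] (hUS : U ≤ S)
    (t : G → G → G → A) (h1 : ∀ y ∈ S, ∀ u ∈ U, HomOn S (t · y u))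
    (h2 : ∀ x ∈ S, ∀ u ∈ U, HomOn S (t x · u)) (h3 : ∀ x ∈ S, ∀ y ∈ S, HomOn U (t x y)) :
    ∃ Φ : MonoidAlgebra ℤ G →ₗ[ℤ] A,
      ∀ x ∈ S, ∀ y ∈ S, ∀ u ∈ U, Φ (del x * del y * del u) = t x y u := by
  -- One degree up: for fixed u ∈ U the prescribed functional on Δ(S)² comes from the bilinear case.
  -- The value 0 outside `U` is a dummy.
  have h : ∀ u, ∃ Ω : MonoidAlgebra ℤ G →ₗ[ℤ] A,
      u ∈ U → ∀ x ∈ S, ∀ y ∈ S, Ω (del x * del y) = t x y u := by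
    intro u
    by_cases hu : u ∈ U
    · obtain ⟨Ω, hΩ⟩ := exists_bilinear_functional (le_refl S) (fun x y ↦ t x y u)
        (fun y hy ↦ h1 y hy u hu) (fun x hx ↦ h2 x hx u hu)
      exact ⟨Ω, fun _ ↦ hΩ⟩
    · exact ⟨0, fun h ↦ absurd h hu⟩
  choose Ω hΩ using h
  obtain ⟨Φ, hΦ⟩ := exists_functional_of_cocycle U (augSpan S * augSpan S)
    (fun z hz u hu ↦ mul_augSpan_mul_of_mem hUS hz hu) Ω (by
      intro u' hu' u hu z hz
      refine augSpan_augSpan_eqOn (φ := Ω (u' * u))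
        (ψ := Ω u ∘ₗ LinearMap.mulRight ℤ (of ℤ G u') + Ω u')
        (fun x hx y hy ↦ ?_) hz
      rw [LinearMap.add_apply, LinearMap.comp_apply, LinearMap.mulRight_apply, mul_assoc,
        del_mul_of, mul_sub, map_sub, hΩ _ (U.mul_mem hu' hu) x hx y hy, hΩ u' hu' x hx y hy,
        hΩ u hu x hx _ (S.mul_mem hy (hUS hu')), hΩ u hu x hx _ (hUS hu'),
        h3 x hx y hy u' hu' u hu,
        show t x (y * u') u = t x y u + t x u' u from h2 x hx u hu y hy u' (hUS hu')]
      abel)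
  refine ⟨Φ, fun x hx y hy u hu ↦ ?_⟩
  rw [hΦ u hu _ (Submodule.mul_mem_mul (del_mem_augSpan hx) (del_mem_augSpan hy)),
    hΩ u hu x hx y hy]

section Bilinear

variable {Φ : MonoidAlgebra ℤ G →ₗ[ℤ] A} {t : G → G → A}

theorem bilinear_functional_mul_of (h2 : ∀ s ∈ U, HomOn U (t s))
    (hΦ : ∀ s ∈ U, ∀ u ∈ U, Φ (del s * del u) = t s u) {x y h : G} (hx : x ∈ U) (hy : y ∈ U)
    (hh : h ∈ U) : Φ (del x * del y * of ℤ G h) = t x y := by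
  rw [mul_assoc, del_mul_of, mul_sub, map_sub, hΦ x hx _ (U.mul_mem hy hh), hΦ x hx h hh,
    h2 x hx y hy h hh, add_sub_cancel_right]

theorem bilinear_functional_commutator (h2 : ∀ s ∈ U, HomOn U (t s))
    (hΦ : ∀ s ∈ U, ∀ u ∈ U, Φ (del s * del u) = t s u) {x y : G} (hx : x ∈ U) (hy : y ∈ U) :
    Φ (del ⁅x, y⁆) = t x y - t y x := by
  have hh := U.mul_mem (U.inv_mem hx) (U.inv_mem hy)
  rw [del_commutator, sub_mul, map_sub, bilinear_functional_mul_of h2 hΦ hx hy hh,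
    bilinear_functional_mul_of h2 hΦ hy hx hh]

/-- The obstruction to additivity of x ↦ Φ(x − 1) is t x y, which is zero when x is a product of
commutators. -/
theorem bilinear_functional_homOn (h1 : ∀ u ∈ U, HomOn U (t · u))
    (hΦ : ∀ s ∈ U, ∀ u ∈ U, Φ (del s * del u) = t s u) : HomOn ⁅U, U⁆ (fun x ↦ Φ (del x)) := by
  intro x hx y hy
  have hU := Subgroup.commutator_le_self U
  simp only [del_mul, map_add, hΦ x (hU hx) y (hU hy), (h1 y (hU hy)).eq_zero_of_mem_commutator hx,
    zero_add]

end Bilinear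

/-- Biadditive functions with prescribed values on the basis of a free group exist. -/
theorem exists_biadditive {F F' : Type*} [Group F] [IsFreeGroup F] [Group F']
    (m : IsFreeGroup.Generators F → F' → A) (hm : ∀ i x y, m i (x * y) = m i x + m i y) :
    ∃ t : F → F' → A, (∀ i x, t (IsFreeGroup.of i) x = m i x) ∧
      (∀ x x' y, t (x * x') y = t x y + t x' y) ∧ ∀ x y y', t x (y * y') = t x y + t x y' := by
  let θ : F →* (F' →* Multiplicative A) := IsFreeGroup.lift fun i ↦
    MonoidHom.mk' (fun x ↦ Multiplicative.ofAdd (m i x)) fun x y ↦ by simp [hm]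
  refine ⟨fun x y ↦ (θ x y).toAdd, fun i x ↦ ?_, fun x x' y ↦ ?_, fun x y y' ↦ ?_⟩
  · simp [θ, IsFreeGroup.lift_of]
  · simp
  · simp

theorem biadditive_ext {F : Type*} [Group F] [IsFreeGroup F] {t t' : F → F → A}
    (h1 : ∀ y, HomOn ⊤ (t · y)) (h2 : ∀ x, HomOn ⊤ (t x))
    (h1' : ∀ y, HomOn ⊤ (t' · y)) (h2' : ∀ x, HomOn ⊤ (t' x))
    (h : ∀ i j, t (IsFreeGroup.of i) (IsFreeGroup.of j) =
      t' (IsFreeGroup.of i) (IsFreeGroup.of j)) (x y : F) : t x y = t' x y := by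
  have key : ∀ i y, t (IsFreeGroup.of i) y = t' (IsFreeGroup.of i) y := by
    intro i y
    have h2i := h2 (IsFreeGroup.of i)
    have h2i' := h2' (IsFreeGroup.of i)
    rw [← closure_range_of] at h2i h2i'
    refine h2i.eq_of_closure h2i' ?_ (by rw [closure_range_of]; trivial)
    rintro _ ⟨j, rfl⟩; exact h i j
  have h1y := h1 y
  have h1y' := h1' y
  rw [← closure_range_of] at h1y h1y'
  refine h1y.eq_of_closure h1y' ?_ (by rw [closure_range_of]; trivial)
  rintro _ ⟨j, rfl⟩; exact key j y

/-- An alternating biadditive function on a free group is the antisymmetrization of a biadditive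
function. -/
theorem exists_triangular {F : Type*} [Group F] [IsFreeGroup F] (D : F → F → A)
    (h1 : ∀ y, HomOn ⊤ (D · y)) (h2 : ∀ x, HomOn ⊤ (D x)) (h0 : ∀ x, D x x = 0) :
    ∃ t : F → F → A, (∀ y, HomOn ⊤ (t · y)) ∧ (∀ x, HomOn ⊤ (t x)) ∧
      ∀ x y, t x y - t y x = D x y := by
  classical
  -- With the basis linearly ordered, `t` keeps the entries of `D` above the diagonal.
  obtain ⟨_, -⟩ := exists_wellFoundedLT (IsFreeGroup.Generators F)
  let m : IsFreeGroup.Generators F → F → A := fun i x ↦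
    ((IsFreeGroup.lift fun j ↦ Multiplicative.ofAdd
      (if i < j then D (IsFreeGroup.of i) (IsFreeGroup.of j) else 0)) x).toAdd
  obtain ⟨t, ht, ht1, ht2⟩ := exists_biadditive m (fun i x y ↦ by simp [m])
  have t1 : ∀ y, HomOn ⊤ (t · y) := fun y x _ x' _ ↦ ht1 x x' y
  have t2 : ∀ x, HomOn ⊤ (t x) := fun x y _ y' _ ↦ ht2 x y y'
  have anti : ∀ x y, D y x = -D x y := by
    intro x y
    have := h0 (x * y)
    rw [show D (x * y) (x * y) = D x (x * y) + D y (x * y) from h1 _ x trivial y trivial, h2 _ x trivial y trivial, h2 _ x trivial y trivial, h0, h0] at this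
    simp only [zero_add, add_zero] at this
    exact (neg_eq_of_add_eq_zero_right this).symm
  refine ⟨t, t1, t2, biadditive_ext (fun y ↦ (t1 y).sub (t2 y)) (fun x ↦ (t2 x).sub (t1 x)) h1 h2
    fun i j ↦ ?_⟩
  have e : ∀ i j, t (IsFreeGroup.of i) (IsFreeGroup.of j) =
      if i < j then D (IsFreeGroup.of i) (IsFreeGroup.of j) else 0 := fun i j ↦ by
    rw [ht]; simp [m, IsFreeGroup.lift_of]
  rw [e, e]
  rcases lt_trichotomy i j with hij | rfl | hij
  · rw [if_pos hij, if_neg hij.asymm, sub_zero]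
  · simp [h0]
  · rw [if_pos hij, if_neg hij.asymm, zero_sub, ← anti]

/-- The restriction of a homomorphism-like statement to a free subgroup: alternating biadditive
functions on a free subgroup `U` are antisymmetrizations. -/
theorem exists_triangular_on [IsFreeGroup U] (D : G → G → A)
    (h1 : ∀ y ∈ U, HomOn U (D · y)) (h2 : ∀ x ∈ U, HomOn U (D x)) (h0 : ∀ x ∈ U, D x x = 0) :
    ∃ t : G → G → A, (∀ y ∈ U, HomOn U (t · y)) ∧ (∀ x ∈ U, HomOn U (t x)) ∧
      ∀ x ∈ U, ∀ y ∈ U, t x y - t y x = D x y := by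
  classical
  obtain ⟨t, t1, t2, ht⟩ := exists_triangular (F := U) (fun x y ↦ D x y)
    (fun y x _ x' _ ↦ h1 y y.2 x x.2 x' x'.2) (fun x y _ y' _ ↦ h2 x x.2 y y.2 y' y'.2)
    (fun x ↦ h0 x x.2)
  refine ⟨fun x y ↦ if hx : x ∈ U then if hy : y ∈ U then t ⟨x, hx⟩ ⟨y, hy⟩ else 0 else 0,
    fun y hy x hx x' hx' ↦ ?_, fun x hx y hy y' hy' ↦ ?_, fun x hx y hy ↦ ?_⟩
  · simp only [hx, hx', U.mul_mem hx hx', hy, dif_pos]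
    exact t1 ⟨y, hy⟩ ⟨x, hx⟩ trivial ⟨x', hx'⟩ trivial
  · simp only [hy, hy', U.mul_mem hy hy', hx, dif_pos]
    exact t2 ⟨x, hx⟩ ⟨y, hy⟩ trivial ⟨y', hy'⟩ trivial
  · simp only [hx, hy, dif_pos]
    exact ht ⟨x, hx⟩ ⟨y, hy⟩

/-- For a free subgroup `U` an alternating biadditive function `D` on `U` gives a homomorphism on
`⁅U, U⁆` that maps `⁅x, y⁆` to `D x y`. -/
theorem exists_hom_commutator [IsFreeGroup U] (D : G → G → A)
    (h1 : ∀ y ∈ U, HomOn U (D · y)) (h2 : ∀ x ∈ U, HomOn U (D x)) (h0 : ∀ x ∈ U, D x x = 0) :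
    ∃ φ : G → A, HomOn ⁅U, U⁆ φ ∧ ∀ x ∈ U, ∀ y ∈ U, φ ⁅x, y⁆ = D x y := by
  obtain ⟨t, t1, t2, ht⟩ := exists_triangular_on D h1 h2 h0
  obtain ⟨Φ, hΦ⟩ := exists_bilinear_functional (le_refl U) t t1 t2
  exact ⟨fun x ↦ Φ (del x), bilinear_functional_homOn t1 hΦ, fun x hx y hy ↦
    (bilinear_functional_commutator t2 hΦ hx hy).trans (ht x hx y hy)⟩

end Functionals

/-! ### Products of ideals and augmentation subgroups -/

section Ideals

variable {F : Type*} [Group F]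

theorem of_conj_mul (f : F) (x y : MonoidAlgebra ℤ F) :
    of ℤ F f * (x * y) * of ℤ F f⁻¹ =
      of ℤ F f * x * of ℤ F f⁻¹ * (of ℤ F f * y * of ℤ F f⁻¹) := by
  have h : of ℤ F f⁻¹ * of ℤ F f = 1 := by rw [← map_mul, inv_mul_cancel, map_one]
  calc of ℤ F f * (x * y) * of ℤ F f⁻¹
      = of ℤ F f * x * (1 * y) * of ℤ F f⁻¹ := by rw [one_mul]; simp only [mul_assoc]
    _ = _ := by rw [← h]; simp only [mul_assoc]

theorem conj_del (f h : F) : of ℤ F f * del h * of ℤ F f⁻¹ = del (f * h * f⁻¹) := by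
  rw [of_mul_del, sub_mul, del_mul_of, del_mul_of, mul_inv_cancel, del_one]; abel

/-- An additive subgroup of `ℤ[F]` is stable under conjugation by elements of `F`. -/
def ConjStable (W : Submodule ℤ (MonoidAlgebra ℤ F)) : Prop :=
  ∀ f, ∀ z ∈ W, of ℤ F f * z * of ℤ F f⁻¹ ∈ W

theorem ConjStable.augSpan (H : Subgroup F) [hH : H.Normal] : ConjStable (augSpan H) := by
  intro f z hz
  induction hz using Submodule.span_induction with
  | mem x hx =>
    obtain ⟨s, hs, rfl⟩ := hx
    change of ℤ F f * del s * _ ∈ _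
    rw [conj_del]
    exact del_mem_augSpan (hH.conj_mem s hs f)
  | zero => simp
  | add x y _ _ hx hy => rw [mul_add, add_mul]; exact add_mem hx hy
  | smul n x _ hx =>
    rw [mul_smul_comm, smul_mul_assoc]; exact Submodule.smul_mem _ n hx

theorem ConjStable.mul {W W' : Submodule ℤ (MonoidAlgebra ℤ F)} (h : ConjStable W)
    (h' : ConjStable W') : ConjStable (W * W') := by
  intro f z hz
  induction hz using Submodule.mul_induction_on' with
  | mem_mul_mem m hm n hn =>
    rw [of_conj_mul]; exact Submodule.mul_mem_mul (h f m hm) (h' f n hn)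
  | add x _ y _ hx hy => rw [mul_add, add_mul]; exact add_mem hx hy

theorem of_mul_eq_conj_mul (f : F) (z : MonoidAlgebra ℤ F) :
    of ℤ F f * z = of ℤ F f * z * of ℤ F f⁻¹ * of ℤ F f := by
  rw [mul_assoc (of ℤ F f * z), ← map_mul, inv_mul_cancel, map_one, mul_one]

theorem mul_of_eq_mul_conj (f : F) (z : MonoidAlgebra ℤ F) :
    z * of ℤ F f = of ℤ F f * (of ℤ F f⁻¹ * z * of ℤ F f⁻¹⁻¹) := by
  rw [inv_inv, ← mul_assoc, ← mul_assoc, ← map_mul, mul_inv_cancel, map_one, one_mul]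

theorem top_mul_le_iff {W X : Submodule ℤ (MonoidAlgebra ℤ F)} :
    ⊤ * W ≤ X ↔ ∀ f, ∀ z ∈ W, of ℤ F f * z ∈ X := by
  rw [Submodule.mul_le]
  refine ⟨fun h f z hz ↦ h _ trivial z hz, fun h x hx z hz ↦ ?_⟩
  clear hx
  induction x using MonoidAlgebra.induction_on with
  | of g => exact h g z hz
  | add u v hu hv => rw [add_mul]; exact add_mem hu hv
  | smul n u hu => rw [smul_mul_assoc]; exact Submodule.smul_mem _ n hu

theorem mul_top_le_iff {W X : Submodule ℤ (MonoidAlgebra ℤ F)} :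
    W * ⊤ ≤ X ↔ ∀ f, ∀ z ∈ W, z * of ℤ F f ∈ X := by
  rw [Submodule.mul_le]
  refine ⟨fun h f z hz ↦ h z hz _ trivial, fun h z hz x hx ↦ ?_⟩
  clear hx
  induction x using MonoidAlgebra.induction_on with
  | of g => exact h g z hz
  | add u v hu hv => rw [mul_add]; exact add_mem hu hv
  | smul n u hu => rw [mul_smul_comm]; exact Submodule.smul_mem _ n hu

/-- Since fz = (fzf⁻¹)f, a conjugation-stable subgroup can be moved across ℤ[F]. -/
theorem ConjStable.mul_top {W : Submodule ℤ (MonoidAlgebra ℤ F)} (h : ConjStable W) :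
    W * ⊤ = ⊤ * W := by
  refine le_antisymm (mul_top_le_iff.mpr fun f z hz ↦ ?_) (top_mul_le_iff.mpr fun f z hz ↦ ?_)
  · rw [mul_of_eq_mul_conj]
    exact Submodule.mul_mem_mul trivial (h _ z hz)
  · rw [of_mul_eq_conj_mul]
    exact Submodule.mul_mem_mul (h _ z hz) trivial

theorem top_mul_top_eq :
    (⊤ * ⊤ : Submodule ℤ (MonoidAlgebra ℤ F)) = ⊤ :=
  le_antisymm le_top fun x hx ↦ by
    simpa using Submodule.mul_mem_mul hx (show (1 : MonoidAlgebra ℤ F) ∈ ⊤ from trivial)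

/-- All factors ℤ[F] merge into one behind Δ(A), so that the product begins with Δ(A) and ends with
Δ(D); the projections and cocycles act on these two ends. -/
theorem grpIdeal_prod_eq (A B C D : Subgroup F) [B.Normal] [C.Normal] [D.Normal] :
    grpIdeal A * grpIdeal B * grpIdeal C * grpIdeal D =
      augSpan A * (⊤ * (augSpan B * augSpan C)) * augSpan D := by
  have hB := (ConjStable.augSpan B).mul_top
  have hC := (ConjStable.augSpan C).mul_top
  have hD := (ConjStable.augSpan D).mul_top
  have hT := top_mul_top_eq (F := F)
  simp only [grpIdeal]
  calc augSpan A * ⊤ * (augSpan B * ⊤) * (augSpan C * ⊤) * (augSpan D * ⊤)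
      = augSpan A * ⊤ * (⊤ * augSpan B) * (⊤ * augSpan C) * (⊤ * augSpan D) := by
        rw [hB, hC, hD]
    _ = augSpan A * (⊤ * ⊤) * (augSpan B * ⊤) * (augSpan C * ⊤) * augSpan D := by
        simp only [mul_assoc]
    _ = augSpan A * ⊤ * (⊤ * augSpan B) * (⊤ * augSpan C) * augSpan D := by
        rw [hT, hB, hC]
    _ = augSpan A * (⊤ * ⊤) * (augSpan B * ⊤) * augSpan C * augSpan D := by
        simp only [mul_assoc]
    _ = augSpan A * (⊤ * ⊤) * augSpan B * augSpan C * augSpan D := by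
        rw [hT, hB]; simp only [← mul_assoc]; rw [mul_assoc (augSpan A) ⊤ ⊤, hT]
    _ = _ := by rw [hT]; simp only [mul_assoc]

theorem augSpan_mono {A B : Subgroup F} (h : A ≤ B) : augSpan A ≤ augSpan B :=
  Submodule.span_mono fun _ ⟨r, hr, e⟩ ↦ ⟨r, h hr, e⟩

theorem grpIdeal_mono {A B : Subgroup F} (h : A ≤ B) : grpIdeal A ≤ grpIdeal B :=
  mul_le_mul' (augSpan_mono h) le_rfl

theorem of_mul_mem_augSpan {S : Subgroup F} {s : F} (hs : s ∈ S) {z : MonoidAlgebra ℤ F}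
    (hz : z ∈ augSpan S) : of ℤ F s * z ∈ augSpan S := by
  induction hz using Submodule.span_induction with
  | mem x hx =>
    obtain ⟨r, hr, rfl⟩ := hx
    change _ * del r ∈ _
    rw [of_mul_del]
    exact sub_mem (del_mem_augSpan (S.mul_mem hs hr)) (del_mem_augSpan hs)
  | zero => simp
  | add x y _ _ hx hy => rw [mul_add]; exact add_mem hx hy
  | smul n x _ hx => rw [mul_smul_comm]; exact Submodule.smul_mem _ n hx

theorem of_mul_mem_augSpan_mul {S : Subgroup F} {s : F} (hs : s ∈ S)
    {Y : Submodule ℤ (MonoidAlgebra ℤ F)} {z : MonoidAlgebra ℤ F}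
    (hz : z ∈ augSpan S * Y) : of ℤ F s * z ∈ augSpan S * Y := by
  induction hz using Submodule.mul_induction_on' with
  | mem_mul_mem m hm n hn =>
    rw [← mul_assoc]; exact Submodule.mul_mem_mul (of_mul_mem_augSpan hs hm) hn
  | add x _ y _ hx hy => rw [mul_add]; exact add_mem hx hy

theorem del_commutator_mem {H : Subgroup F} {c : F} (hc : c ∈ ⁅H, H⁆) :
    del c ∈ augSpan H * augSpan H := by
  rw [Subgroup.commutator_def] at hc
  have key : ∀ z ∈ augSpan H * augSpan H, ∀ c ∈ H, z * of ℤ F c ∈ augSpan H * augSpan H :=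
    fun z hz c hc ↦ mul_augSpan_mul_of_mem le_rfl hz hc
  have hH : ∀ c ∈ Subgroup.closure {g | ∃ g₁ ∈ H, ∃ g₂ ∈ H, ⁅g₁, g₂⁆ = g}, c ∈ H := by
    intro c hc; rw [← Subgroup.commutator_def] at hc; exact Subgroup.commutator_le_self H hc
  induction hc using Subgroup.closure_induction with
  | mem x hx =>
    obtain ⟨x, hx, y, hy, rfl⟩ := hx
    rw [del_commutator]
    exact key _ (sub_mem (Submodule.mul_mem_mul (del_mem_augSpan hx) (del_mem_augSpan hy))
      (Submodule.mul_mem_mul (del_mem_augSpan hy) (del_mem_augSpan hx))) _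
      (H.mul_mem (H.inv_mem hx) (H.inv_mem hy))
  | one => simp
  | mul x y hx hy h1 h2 =>
    have : del (x * y) = del x * of ℤ F y + del y := by rw [del_mul_of]; abel
    rw [this]; exact add_mem (key _ h1 _ (hH _ hy)) h2
  | inv x hx h1 =>
    have : del x⁻¹ = -(del x * of ℤ F x⁻¹) := by rw [del_mul_of, mul_inv_cancel, del_one]; abel
    rw [this]; exact neg_mem (key _ h1 _ (H.inv_mem (hH _ hx)))

/-- `a` lies in `R` if `a - 1` lies in the ideal generated by the augmentation ideal of `R`. -/
theorem mem_of_del_mem_grpIdeal {R : Subgroup F} [hR : R.Normal] {a : F}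
    (ha : del a ∈ grpIdeal R) : a ∈ R := by
  -- The linearization of F → F/R kills the ideal of `R`.
  let Φ : MonoidAlgebra ℤ F →ₗ[ℤ] (F ⧸ R →₀ ℤ) :=
    gext fun f ↦ Finsupp.single (QuotientGroup.mk f : F ⧸ R) 1
  have h : ∀ z ∈ grpIdeal R, Φ z = 0 := by
    change grpIdeal R ≤ LinearMap.ker Φ
    refine mul_top_le_iff.mpr fun f z hz ↦ ?_
    rw [LinearMap.mem_ker]
    refine augSpan_eqOn (φ := Φ ∘ₗ LinearMap.mulRight ℤ (of ℤ F f)) (ψ := 0) (fun s hs ↦ ?_) hz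
    rw [LinearMap.comp_apply, LinearMap.mulRight_apply, del_mul_of, map_sub]
    simp only [Φ, gext_del, LinearMap.zero_apply]
    have : (QuotientGroup.mk (s * f) : F ⧸ R) = QuotientGroup.mk f := by
      rw [QuotientGroup.mk_mul, (QuotientGroup.eq_one_iff s).mpr hs, one_mul]
    rw [this]; abel
  have := h _ ha
  simp only [Φ, gext_del, sub_eq_zero] at this
  have h2 := Finsupp.single_left_injective (one_ne_zero) this
  rwa [QuotientGroup.mk_one, QuotientGroup.eq_one_iff] at h2

end Ideals

/-! ### The projection of ℤ[F] to ℤ[S] along representatives in T -/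

section Kappa

variable {F : Type*} [Group F] {S T : Subgroup F}

/-- Representatives in `T` of the cosets of the normal subgroup `S`. -/
structure IsRep (S T : Subgroup F) (rep : F → F) : Prop where
  mem (f : F) : rep f ∈ T
  inv_mul_mem (f : F) : (rep f)⁻¹ * f ∈ S
  mul_inv_mem (f : F) : f * (rep f)⁻¹ ∈ S
  left (f : F) {s : F} (hs : s ∈ S) : rep (s * f) = rep f
  right (f : F) {s : F} (hs : s ∈ S) : rep (f * s) = rep f
  one {s : F} (hs : s ∈ S) : rep s = 1

theorem exists_isRep [hS : S.Normal] (h : S ⊔ T = ⊤) : ∃ rep, IsRep S T rep := by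
  classical
  have h1 : ∀ q : F ⧸ S, ∃ t ∈ T, (QuotientGroup.mk t : F ⧸ S) = q := by
    intro q
    obtain ⟨f, rfl⟩ := QuotientGroup.mk_surjective q
    have hf : f ∈ S ⊔ T := h ▸ Subgroup.mem_top f
    obtain ⟨s, hs, t, ht, rfl⟩ := Subgroup.mem_sup_of_normal_left.mp hf
    refine ⟨t, ht, ?_⟩
    rw [QuotientGroup.mk_mul, (QuotientGroup.eq_one_iff s).mpr hs, one_mul]
  choose r hr hr' using h1
  -- The coset `S` gets the representative 1, so that the projection fixes ℤ[S].
  let rep : F → F := fun f ↦ if f ∈ S then 1 else r (QuotientGroup.mk f)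
  have hmk : ∀ f, (QuotientGroup.mk (rep f) : F ⧸ S) = QuotientGroup.mk f := by
    intro f
    by_cases hf : f ∈ S
    · simp only [rep, if_pos hf]; rw [QuotientGroup.mk_one, (QuotientGroup.eq_one_iff f).mpr hf]
    · simp only [rep, if_neg hf]; exact hr' _
  have hinv : ∀ f, (rep f)⁻¹ * f ∈ S := fun f ↦ QuotientGroup.eq.mp (hmk f)
  refine ⟨rep, fun f ↦ ?_, hinv, fun f ↦ ?_, fun f s hs ↦ ?_, fun f s hs ↦ ?_, fun hs ↦ if_pos hs⟩
  · by_cases hf : f ∈ S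
    · simp only [rep, if_pos hf, T.one_mem]
    · simp only [rep, if_neg hf, hr]
  · exact hS.mem_comm (hinv f)
  · simp only [rep, S.mul_mem_cancel_left hs]
    rw [QuotientGroup.mk_mul, (QuotientGroup.eq_one_iff s).mpr hs, one_mul]
  · simp only [rep, S.mul_mem_cancel_right hs]
    rw [QuotientGroup.mk_mul, (QuotientGroup.eq_one_iff s).mpr hs, mul_one]

/-- The projection `f ↦ f (rep f)⁻¹` of `ℤ[F]` to `ℤ[S]`. -/
noncomputable def kappaR (rep : F → F) : MonoidAlgebra ℤ F →ₗ[ℤ] MonoidAlgebra ℤ F :=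
  gext fun f ↦ of ℤ F (f * (rep f)⁻¹)

variable {rep : F → F}

theorem kappaR_of (f : F) : kappaR rep (of ℤ F f) = of ℤ F (f * (rep f)⁻¹) := gext_of _ _

theorem IsRep.kappaR_del (h : IsRep S T rep) {s : F} (hs : s ∈ S) :
    kappaR rep (del s) = del s := by
  rw [kappaR, gext_del, h.one hs, h.one S.one_mem, inv_one, mul_one, mul_one, map_one, del]

theorem IsRep.kappaR_mul_of (h : IsRep S T rep) {z : MonoidAlgebra ℤ F}
    (hz : z ∈ augSpan S) (f : F) : kappaR rep (z * of ℤ F f) = z * of ℤ F (f * (rep f)⁻¹) := by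
  refine augSpan_eqOn (φ := kappaR rep ∘ₗ LinearMap.mulRight ℤ (of ℤ F f))
    (ψ := LinearMap.mulRight ℤ (of ℤ F (f * (rep f)⁻¹))) (fun s hs ↦ ?_) hz
  rw [LinearMap.comp_apply, LinearMap.mulRight_apply, LinearMap.mulRight_apply, del, sub_mul,
    sub_mul, one_mul, one_mul, map_sub, ← map_mul, kappaR_of, kappaR_of, h.left f hs, ← map_mul,
    mul_assoc]

theorem augSpan_mul_augSpan_le {S S' : Subgroup F} (h : S' ≤ S) :
    augSpan S * augSpan S' ≤ augSpan S := by
  rw [Submodule.mul_le]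
  intro z hz y hy
  induction hy using Submodule.span_induction with
  | mem x hx =>
    obtain ⟨s, hs, rfl⟩ := hx
    rw [mul_sub, mul_one]
    exact sub_mem (augSpan_mul_of_mem h hz hs) hz
  | zero => simp
  | add x y _ _ hx hy => rw [mul_add]; exact add_mem hx hy
  | smul n x _ hx => rw [mul_smul_comm]; exact Submodule.smul_mem _ n hx

/-- On Δ(S)·f the projection multiplies by rep(f)⁻¹ on the right. Passing from f to fτ or τf with τ
∈ T therefore creates transition elements in S ∩ T. They turn the factor Δ(T) of the first summand
into Δ(S ∩ T); in the second summand they leave, in addition, the difference between an element and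
its conjugate by τ. -/
theorem IsRep.kappaR_mem [hS : S.Normal] [hT : T.Normal] (h : IsRep S T rep)
    {W : Submodule ℤ (MonoidAlgebra ℤ F)}
    (hW : augSpan S * augSpan S * augSpan S * augSpan (S ⊓ T) ≤ W)
    (hW' : ∀ τ ∈ T, ∀ z ∈ augSpan S * augSpan S * augSpan (S ⊓ T),
      of ℤ F τ * z * of ℤ F τ⁻¹ - z ∈ W) {x : MonoidAlgebra ℤ F}
    (hx : x ∈ grpIdeal (S ⊓ T) * grpIdeal S * grpIdeal S * grpIdeal T
      + grpIdeal T * grpIdeal S * grpIdeal S * grpIdeal (S ⊓ T)) : kappaR rep x ∈ W := by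
  have hUS : S ⊓ T ≤ S := inf_le_left
  have cU : ConjStable (augSpan (S ⊓ T)) := ConjStable.augSpan _
  have cS : ConjStable (augSpan S) := ConjStable.augSpan _
  have cT : ConjStable (augSpan T) := ConjStable.augSpan _
  have hle : ∀ Y : Submodule ℤ (MonoidAlgebra ℤ F), Y * augSpan (S ⊓ T) ≤ Y * augSpan S :=
    fun Y ↦ mul_le_mul' le_rfl (augSpan_mono hUS)
  have sS : augSpan S * augSpan S ≤ augSpan S := augSpan_mul_augSpan_le le_rfl
  suffices hsup : grpIdeal (S ⊓ T) * grpIdeal S * grpIdeal S * grpIdeal T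
      + grpIdeal T * grpIdeal S * grpIdeal S * grpIdeal (S ⊓ T) ≤ W.comap (kappaR rep) from hsup hx
  refine sup_le ?_ ?_
  · rw [grpIdeal_prod_eq, ← mul_assoc, cU.mul_top, mul_assoc ⊤, mul_assoc ⊤, top_mul_le_iff]
    intro f y hy
    refine (Submodule.mul_le.mpr fun z hz n hn ↦ ?_ : augSpan (S ⊓ T) * (augSpan S * augSpan S) *
      augSpan T ≤ (W.comap (kappaR rep)).comap (LinearMap.mulLeft ℤ (of ℤ F f))) hy
    rw [Submodule.mem_comap, Submodule.mem_comap, LinearMap.mulLeft_apply]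
    set z' := of ℤ F f * z * of ℤ F f⁻¹ with hz'
    have hz'U : z' ∈ augSpan (S ⊓ T) * (augSpan S * augSpan S) := (cU.mul (cS.mul cS)) f z hz
    have hz'3 : z' ∈ augSpan S * augSpan S * augSpan S := by
      rw [mul_assoc]; exact mul_le_mul' (augSpan_mono hUS) le_rfl hz'U
    have hz'S : z' ∈ augSpan S := sS (mul_le_mul' sS le_rfl hz'3)
    induction hn using Submodule.span_induction with
    | mem n hn =>
      obtain ⟨τ, hτ, rfl⟩ := hn
      have e : of ℤ F f * (z * (of ℤ F τ - 1)) = z' * of ℤ F (f * τ) - z' * of ℤ F f := by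
        rw [hz', map_mul, ← mul_assoc, ← mul_assoc, ← of_mul_eq_conj_mul, mul_sub, mul_one]
      rw [e, map_sub, h.kappaR_mul_of hz'S, h.kappaR_mul_of hz'S]
      -- The transition element rep f · τ · rep(fτ)⁻¹ appears as the new last factor.
      have e2 : z' * of ℤ F (f * τ * (rep (f * τ))⁻¹) - z' * of ℤ F (f * (rep f)⁻¹) =
          z' * of ℤ F (f * (rep f)⁻¹) * del (rep f * τ * (rep (f * τ))⁻¹) := by
        rw [mul_assoc z' _ (del _), of_mul_del, del, del, mul_sub, mul_sub, mul_sub]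
        have : f * (rep f)⁻¹ * (rep f * τ * (rep (f * τ))⁻¹) = f * τ * (rep (f * τ))⁻¹ := by group
        rw [this]; abel
      rw [e2]
      refine hW (Submodule.mul_mem_mul (mul_augSpan_mul_of_mem le_rfl hz'3 (h.mul_inv_mem f))
        (del_mem_augSpan ⟨?_, T.mul_mem (T.mul_mem (h.mem f) hτ) (T.inv_mem (h.mem _))⟩))
      have : rep f * τ * (rep (f * τ))⁻¹ =
          (f * (rep f)⁻¹)⁻¹ * (f * τ * (rep (f * τ))⁻¹) := by group
      rw [this]
      exact S.mul_mem (S.inv_mem (h.mul_inv_mem f)) (h.mul_inv_mem _)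
    | zero => simp
    | add x y _ _ hx hy => rw [mul_add, mul_add, map_add]; exact add_mem hx hy
    | smul n x _ hx =>
      rw [mul_smul_comm, mul_smul_comm, map_smul]; exact Submodule.smul_mem _ n hx
  · rw [grpIdeal_prod_eq, ← (cS.mul cS).mul_top, mul_assoc, mul_assoc (augSpan S * augSpan S) ⊤,
      ← cU.mul_top, ← mul_assoc (augSpan S * augSpan S), ← mul_assoc, mul_top_le_iff]
    intro f y hy
    refine (Submodule.mul_le.mpr fun n hn z hz ↦ ?_ : augSpan T * (augSpan S * augSpan S *
      augSpan (S ⊓ T)) ≤ (W.comap (kappaR rep)).comap (LinearMap.mulRight ℤ (of ℤ F f))) hy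
    rw [Submodule.mem_comap, Submodule.mem_comap, LinearMap.mulRight_apply]
    have stab : ∀ z ∈ augSpan S * augSpan S * augSpan (S ⊓ T), ∀ s ∈ S,
        z * of ℤ F s ∈ augSpan S * augSpan S * augSpan (S ⊓ T) := by
      intro z hz s hs
      rw [mul_of_eq_mul_conj, mul_assoc]
      refine of_mul_mem_augSpan_mul hs ?_
      rw [← mul_assoc]
      exact (cS.mul cS).mul cU _ z hz
    have toS : ∀ z ∈ augSpan S * augSpan S * augSpan (S ⊓ T), z ∈ augSpan S :=
      fun z hz ↦ sS (mul_le_mul' sS le_rfl (hle _ hz))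
    induction hn using Submodule.span_induction with
    | mem n hn =>
      obtain ⟨τ, hτ, rfl⟩ := hn
      set v := f * (rep f)⁻¹ with hv
      -- The image of (τ − 1)zf is τyτ⁻¹·u − y with y = zv. It splits into τyτ⁻¹(u − 1) and τyτ⁻¹ −
      -- y, covered by `hW` and `hW'`.
      set u := τ * rep f * (rep (τ * f))⁻¹ with hu
      have huU : u ∈ S ⊓ T := by
        refine ⟨?_, T.mul_mem (T.mul_mem hτ (h.mem f)) (T.inv_mem (h.mem _))⟩
        have : u = (τ * v * τ⁻¹)⁻¹ * (τ * f * (rep (τ * f))⁻¹) := by rw [hu, hv]; group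
        rw [this]
        exact S.mul_mem (S.inv_mem (hS.conj_mem _ (h.mul_inv_mem f) τ)) (h.mul_inv_mem _)
      set y := z * of ℤ F v with hy'
      have hyU := stab z hz v (h.mul_inv_mem f)
      have hyc : of ℤ F τ * y * of ℤ F τ⁻¹ ∈ augSpan S * augSpan S * augSpan (S ⊓ T) :=
        (cS.mul cS).mul cU τ y hyU
      have hzc : of ℤ F τ * z * of ℤ F τ⁻¹ ∈ augSpan S * augSpan S * augSpan (S ⊓ T) :=
        (cS.mul cS).mul cU τ z hz
      have e1 : (of ℤ F τ - 1) * z * of ℤ F f =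
          of ℤ F τ * z * of ℤ F τ⁻¹ * of ℤ F (τ * f) - z * of ℤ F f := by
        rw [sub_mul, one_mul, sub_mul]; nth_rw 1 [of_mul_eq_conj_mul]; rw [mul_assoc _ (of ℤ F τ),
          ← map_mul]
      have e2 : of ℤ F τ * z * of ℤ F τ⁻¹ * of ℤ F (τ * f * (rep (τ * f))⁻¹) =
          of ℤ F τ * y * of ℤ F τ⁻¹ * of ℤ F u := by
        rw [hy', hu, hv]; simp only [mul_assoc, ← map_mul]; congr 3; group
      have e3 : of ℤ F τ * y * of ℤ F τ⁻¹ * of ℤ F u - y =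
          of ℤ F τ * y * of ℤ F τ⁻¹ * del u + (of ℤ F τ * y * of ℤ F τ⁻¹ - y) := by
        rw [del, mul_sub, mul_one]; abel
      rw [e1, map_sub, h.kappaR_mul_of (toS _ hzc), h.kappaR_mul_of (toS _ hz), e2, e3]
      refine add_mem (hW ?_) (hW' τ hτ y hyU)
      exact Submodule.mul_mem_mul (hle _ hyc) (del_mem_augSpan huU)
    | zero => simp
    | add x y _ _ hx hy => rw [add_mul, add_mul, map_add]; exact add_mem hx hy
    | smul n x _ hx =>
      rw [smul_mul_assoc, smul_mul_assoc, map_smul]; exact Submodule.smul_mem _ n hx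

end Kappa

/-! ### Finiteness and freeness of abelianizations -/

section AugSpanFG

variable {G : Type*} [Group G]

/-- Only finitely many elements of `U` occur in `z`. This reduces `mem_of_del_mem` to finitely
generated subgroups. -/
theorem exists_fg_of_mem_mul_augSpan {U : Subgroup G} {Y : Submodule ℤ (MonoidAlgebra ℤ G)}
    {z : MonoidAlgebra ℤ G} (hz : z ∈ Y * augSpan U) :
    ∃ U₀ : Subgroup G, U₀.FG ∧ U₀ ≤ U ∧ z ∈ Y * augSpan U₀ := by
  induction hz using Submodule.mul_induction_on' with
  | mem_mul_mem m hm n hn =>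
    suffices h : ∃ U₀ : Subgroup G, U₀.FG ∧ U₀ ≤ U ∧ n ∈ augSpan U₀ by
      obtain ⟨U₀, h1, h2, h3⟩ := h
      exact ⟨U₀, h1, h2, Submodule.mul_mem_mul hm h3⟩
    induction hn using Submodule.span_induction with
    | mem n hn =>
      obtain ⟨u, hu, rfl⟩ := hn
      refine ⟨Subgroup.closure {u}, ⟨{u}, by simp⟩, ?_, ?_⟩
      · rw [Subgroup.closure_le]; simpa using hu
      · exact del_mem_augSpan (Subgroup.subset_closure rfl)
    | zero => exact ⟨⊥, ⟨∅, by simp⟩, bot_le, zero_mem _⟩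
    | add x y _ _ hx hy =>
      obtain ⟨U₁, h1, h2, h3⟩ := hx
      obtain ⟨U₂, h1', h2', h3'⟩ := hy
      exact ⟨U₁ ⊔ U₂, h1.sup h1', sup_le h2 h2', add_mem (augSpan_mono le_sup_left h3)
        (augSpan_mono le_sup_right h3')⟩
    | smul n x _ hx =>
      obtain ⟨U₁, h1, h2, h3⟩ := hx
      exact ⟨U₁, h1, h2, Submodule.smul_mem _ n h3⟩
  | add x _ y _ hx hy =>
    obtain ⟨U₁, h1, h2, h3⟩ := hx
    obtain ⟨U₂, h1', h2', h3'⟩ := hy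
    exact ⟨U₁ ⊔ U₂, h1.sup h1', sup_le h2 h2',
      add_mem (mul_le_mul' le_rfl (augSpan_mono le_sup_left) h3)
        (mul_le_mul' le_rfl (augSpan_mono le_sup_right) h3')⟩

end AugSpanFG

section Abelianization

instance {F : Type*} [Group F] [IsFreeGroup F] : Module.Free ℤ (Additive (Abelianization F)) := by
  let e : FreeAbelianGroup (IsFreeGroup.Generators F) ≃+ Additive (Abelianization F) :=
    MulEquiv.toAdditive (MulEquiv.abelianizationCongr (IsFreeGroup.toFreeGroup F).symm)
  exact Module.Free.of_equiv
    ((FreeAbelianGroup.equivFinsupp _).symm.trans e).toIntLinearEquiv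

instance {G : Type*} [Group G] [Group.FG G] : Module.Finite ℤ (Additive (Abelianization G)) := by
  rw [Module.Finite.iff_addGroup_fg, ← GroupFG.iff_add_fg]
  exact Group.fg_of_surjective (QuotientGroup.mk'_surjective _)

end Abelianization

/-! ### The group elements in 1 + Δ(S)²Δ(U) -/

section Structure

/-- In an ordered basis, the part of the Gram matrix above the diagonal has `B` as its
antisymmetrization. -/
theorem exists_bilin_triangular {N A : Type*} [AddCommGroup N] [Module.Free ℤ N] [AddCommGroup A]
    (B : N →ₗ[ℤ] N →ₗ[ℤ] A) (h0 : ∀ x, B x x = 0) :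
    ∃ T : N →ₗ[ℤ] N →ₗ[ℤ] A, ∀ x y, T x y - T y x = B x y := by
  classical
  obtain ⟨_, -⟩ := exists_wellFoundedLT (Module.Free.ChooseBasisIndex ℤ N)
  let b := Module.Free.chooseBasis ℤ N
  let T : N →ₗ[ℤ] N →ₗ[ℤ] A :=
    b.constr ℤ fun i ↦ b.constr ℤ fun j ↦ if i < j then B (b i) (b j) else 0
  have hT : ∀ i j, T (b i) (b j) = if i < j then B (b i) (b j) else 0 := by
    intro i j; simp [T, Module.Basis.constr_basis]
  have anti : ∀ x y, B y x = -B x y := by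
    intro x y
    have := h0 (x + y)
    simp only [map_add, LinearMap.add_apply, h0, zero_add, add_zero] at this
    exact (neg_eq_of_add_eq_zero_right ((add_comm _ _).trans this)).symm
  refine ⟨T, fun x y ↦ ?_⟩
  have : T - T.flip = B := by
    refine b.ext fun i ↦ b.ext fun j ↦ ?_
    rw [LinearMap.sub_apply, LinearMap.sub_apply, LinearMap.flip_apply, hT, hT]
    rcases lt_trichotomy i j with hij | rfl | hij
    · rw [if_pos hij, if_neg hij.asymm, sub_zero]
    · simp [h0]
    · rw [if_pos hij, if_neg hij.asymm, zero_sub, ← anti]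
  rw [← this]; rfl

/-- The image of `j` is free, so `M` splits as the image of a projection v plus ker j. Because `B`
vanishes on ker j × ker j, B(x, y) = B(vx, y − vy) + B(x − vx, vy) + B(vx, vy). The first two terms
antisymmetrize B(vx, y − vy); the last is handled by a triangular form. Both depend on x only
through j x. -/
theorem exists_bilin_descent {M V A : Type*} [AddCommGroup M] [AddCommGroup V] [AddCommGroup A]
    [Module.Finite ℤ M] [Module.Free ℤ V] (j : M →ₗ[ℤ] V) (B : M →ₗ[ℤ] M →ₗ[ℤ] A)
    (h0 : ∀ x, B x x = 0) (hB : ∀ x y, j x = 0 → j y = 0 → B x y = 0) :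
    ∃ t : LinearMap.range j →ₗ[ℤ] M →ₗ[ℤ] A,
      ∀ x y, t (j.rangeRestrict x) y - t (j.rangeRestrict y) x = B x y := by
  have : Module.Free ℤ (LinearMap.range j) := Module.free_of_finite_type_torsion_free'
  obtain ⟨σ, hσ⟩ := Module.projective_lifting_property j.rangeRestrict LinearMap.id
    j.surjective_rangeRestrict
  have hσ' : ∀ x, j (σ (j.rangeRestrict x)) = j x := fun x ↦
    congrArg Subtype.val (LinearMap.congr_fun hσ (j.rangeRestrict x))
  let v : M →ₗ[ℤ] M := σ ∘ₗ j.rangeRestrict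
  obtain ⟨T, hT⟩ := exists_bilin_triangular ((B.compl₂ σ) ∘ₗ σ) (fun x ↦ h0 (σ x))
  have anti : ∀ x y, B y x = -B x y := by
    intro x y
    have := h0 (x + y)
    simp only [map_add, LinearMap.add_apply, h0, zero_add, add_zero] at this
    exact (neg_eq_of_add_eq_zero_right ((add_comm _ _).trans this)).symm
  refine ⟨(B.compl₂ (LinearMap.id - v)) ∘ₗ σ + T.compl₂ j.rangeRestrict, fun x y ↦ ?_⟩
  have h1 := hT (j.rangeRestrict x) (j.rangeRestrict y)
  have h2 := hB (x - v x) (y - v y) (by rw [map_sub, sub_eq_zero]; exact (hσ' x).symm)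
    (by rw [map_sub, sub_eq_zero]; exact (hσ' y).symm)
  have h3 := anti (v y) (x - v x)
  simp only [LinearMap.add_apply, LinearMap.comp_apply, LinearMap.compl₂_apply,
    LinearMap.sub_apply, LinearMap.id_apply, map_sub] at h1 h2 h3 ⊢
  have e : ∀ x, σ (j.rangeRestrict x) = v x := fun x ↦ rfl
  simp only [e] at h1 h2 h3 ⊢
  grind only

variable {G A : Type*} [Group G] [AddCommGroup A] {S U : Subgroup G}

theorem exists_bilin_of_biadditive (β : G → G → A)
    (h1 : ∀ y ∈ U, HomOn U (β · y)) (h2 : ∀ x ∈ U, HomOn U (β x)) :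
    ∃ B : Additive (Abelianization U) →ₗ[ℤ] Additive (Abelianization U) →ₗ[ℤ] A,
      ∀ x y : U, B (abMk U x) (abMk U y) = β x y := by
  have h : ∀ x, ∃ g : Additive (Abelianization U) →ₗ[ℤ] A,
      x ∈ U → ∀ y : U, g (abMk U y) = β x y := by
    intro x
    by_cases hx : x ∈ U
    · obtain ⟨g, hg⟩ := (h2 x hx).exists_linearMap
      exact ⟨g, fun _ ↦ hg⟩
    · exact ⟨0, fun h ↦ absurd h hx⟩
  choose g hg using h
  have hgU : HomOn U g := by
    intro x hx x' hx'
    refine LinearMap.ext fun y ↦ ?_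
    obtain ⟨y, rfl⟩ := abMk_surjective U y
    rw [hg _ (U.mul_mem hx hx'), LinearMap.add_apply, hg x hx, hg x' hx']
    exact h1 y y.2 x hx x' hx'
  obtain ⟨B, hB⟩ := hgU.exists_linearMap
  exact ⟨B, fun x y ↦ by rw [hB, hg x x.2]⟩

/-- Commutators are biadditive modulo triple commutators. -/
theorem HomOn.commutator_left {f : G → A} (hf : HomOn ⁅U, U⁆ f)
    (h0 : ∀ x ∈ ⁅⁅U, U⁆, U⁆, f x = 0) {y : G} (hy : y ∈ U) : HomOn U fun x ↦ f ⁅x, y⁆ := by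
  intro x hx x' hx'
  have hc := Subgroup.commutator_mem_commutator hx' hy
  have hc' := Subgroup.commutator_mem_commutator hx hy
  have e : ⁅x * x', y⁆ = ⁅⁅x', y⁆, x⁆⁻¹ * ⁅x', y⁆ * ⁅x, y⁆ := by
    simp only [commutatorElement_def]; group
  have hm := Subgroup.commutator_mem_commutator hc hx
  have hle : ⁅⁅U, U⁆, U⁆ ≤ ⁅U, U⁆ := Subgroup.commutator_mono (Subgroup.commutator_le_self U) le_rfl
  simp only [e]
  rw [hf _ (mul_mem (inv_mem (hle hm)) hc) _ hc', hf _ (inv_mem (hle hm)) _ hc,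
    hf.inv (hle hm), h0 _ hm]
  abel

/-- If `a - 1` lies in `Δ(S) Δ(U)` then `a` lies in `⁅U, U⁆`. -/
theorem mem_commutator_of_del_mem [IsFreeGroup U] {a : G} (haU : a ∈ U)
    (ha : del a ∈ augSpan S * augSpan U) : a ∈ ⁅U, U⁆ := by
  by_contra h
  obtain ⟨ψ, hψ, -, hψa⟩ :=
    exists_character_ne_zero (Subgroup.commutator_le_self U) le_rfl haU h
  -- Here Φ(z(u − 1)) = ε(z)ψ(u) with ε the augmentation, so Φ kills Δ(S)Δ(U).
  obtain ⟨Φ, hΦ⟩ := exists_functional_of_cocycle U ⊤ (fun z _ u _ ↦ trivial)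
    (fun u ↦ gext fun _ ↦ ψ u) (by
      intro u' hu' u hu z _
      have : gext (fun _ : G ↦ ψ (u' * u)) = gext (fun _ ↦ ψ u) ∘ₗ
          LinearMap.mulRight ℤ (of ℤ G u') + gext fun _ ↦ ψ u' := by
        refine hom_ext_of fun g ↦ ?_
        rw [LinearMap.add_apply, LinearMap.comp_apply, LinearMap.mulRight_apply, ← map_mul,
          gext_of, gext_of, gext_of, hψ u' hu' u hu, add_comm]
      exact LinearMap.congr_fun this z)
  have h1 : Φ (del a) = ψ a := by
    rw [← one_mul (del a), hΦ a haU 1 trivial, gext_one]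
  have h2 : Φ (del a) = 0 := by
    refine augSpan_augSpan_eqOn (φ := Φ) (ψ := 0) (fun s _ u hu ↦ ?_) ha
    rw [hΦ u hu _ trivial, gext_del, sub_self, LinearMap.zero_apply]
  exact hψa (h1.symm.trans h2)

/-- Otherwise a character ψ of [U,U] kills the right side but not a. Then ψ[x, y] is bilinear on the
abelianization of U and vanishes on the kernel of its map to that of S, so it antisymmetrizes a form
whose first argument passes through S. Extended to S × U, this form gives a functional that kills
Δ(S)²Δ(U) and equals ψ on [U,U]. -/
theorem mem_of_del_mem_fg [IsFreeGroup S] [IsFreeGroup U] (hUS : U ≤ S) (hfg : U.FG) {a : G}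
    (haU : a ∈ ⁅U, U⁆) (ha : del a ∈ augSpan S * augSpan S * augSpan U) :
    a ∈ ⁅U ⊓ ⁅S, S⁆, U ⊓ ⁅S, S⁆⁆ ⊔ ⁅⁅U, U⁆, U⁆ := by
  classical
  by_contra h
  have hM : ⁅U ⊓ ⁅S, S⁆, U ⊓ ⁅S, S⁆⁆ ⊔ ⁅⁅U, U⁆, U⁆ ≤ ⁅U, U⁆ :=
    sup_le (Subgroup.commutator_mono inf_le_left inf_le_left)
      (Subgroup.commutator_mono (Subgroup.commutator_le_self U) le_rfl)
  obtain ⟨ψ, hψ, hψ0, hψa⟩ := exists_character_ne_zero hM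
    (le_sup_of_le_right (Subgroup.commutator_mono le_rfl (Subgroup.commutator_le_self U))) haU h
  have hA : Module.Baer ℤ (AddCircle (1 : ℚ)) := Module.Baer.of_divisible _
  have hψ3 : ∀ x ∈ ⁅⁅U, U⁆, U⁆, ψ x = 0 := fun x hx ↦ hψ0 x (Subgroup.mem_sup_right hx)
  have b1 : ∀ y ∈ U, HomOn U fun x ↦ ψ ⁅x, y⁆ := fun y hy ↦ hψ.commutator_left hψ3 hy
  have b2 : ∀ x ∈ U, HomOn U fun y ↦ ψ ⁅x, y⁆ := by
    intro x hx y hy y' hy'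
    have e : ∀ y ∈ U, ψ ⁅x, y⁆ = -ψ ⁅y, x⁆ := fun y hy ↦ by
      rw [← commutatorElement_inv, hψ.inv (Subgroup.commutator_mem_commutator hy hx)]
    simp only [e _ (U.mul_mem hy hy'), e y hy, e y' hy']
    rw [show ψ ⁅y * y', x⁆ = ψ ⁅y, x⁆ + ψ ⁅y', x⁆ from b1 x hx y hy y' hy']
    abel
  obtain ⟨B, hB⟩ := exists_bilin_of_biadditive (fun x y ↦ ψ ⁅x, y⁆) b1 b2
  let j : Additive (Abelianization U) →ₗ[ℤ] Additive (Abelianization S) :=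
    (MonoidHom.toAdditive (Abelianization.map (Subgroup.inclusion hUS))).toIntLinearMap
  have hj : ∀ x : U, j (abMk U x) = abMk S (Subgroup.inclusion hUS x) := fun x ↦ rfl
  have : Group.FG U := (Group.fg_iff_subgroup_fg U).mpr hfg
  obtain ⟨t₀, ht₀⟩ := exists_bilin_descent j B
    (fun x ↦ by
      obtain ⟨x, rfl⟩ := abMk_surjective U x
      rw [hB, commutatorElement_self, hψ.one])
    (fun x y hx hy ↦ by
      obtain ⟨x, rfl⟩ := abMk_surjective U x
      obtain ⟨y, rfl⟩ := abMk_surjective U y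
      rw [hj, abMk_eq_zero] at hx hy
      rw [hB]
      exact hψ0 _ (Subgroup.mem_sup_left (Subgroup.commutator_mem_commutator ⟨x.2, hx⟩ ⟨y.2, hy⟩)))
  have hext : ∀ m : Additive (Abelianization U),
      ∃ k : Additive (Abelianization S) →ₗ[ℤ] AddCircle (1 : ℚ),
        ∀ x, k (j x) = t₀ (j.rangeRestrict x) m := by
    intro m
    obtain ⟨k, hk⟩ := hA.extension_property (LinearMap.range j).subtype
      (LinearMap.range j).injective_subtype (t₀.flip m)
    exact ⟨k, fun x ↦ LinearMap.congr_fun hk (j.rangeRestrict x)⟩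
  choose k hk using hext
  -- The extensions `k m` need not be additive in `m`; only those at a basis of `U` are kept and
  -- extended biadditively.
  obtain ⟨t, ht, t1, t2⟩ := exists_biadditive (F := U) (F' := S)
    (fun i s ↦ k (abMk U (IsFreeGroup.of i)) (abMk S s)) (fun i x y ↦ by rw [abMk_mul, map_add])
  have htU : ∀ (u : U) (x : U), t u (Subgroup.inclusion hUS x) =
      t₀ (j.rangeRestrict (abMk U x)) (abMk U u) := by
    intro u x
    induction u using free_induction with
    | h1 =>
      have h1 := t1 1 1 (Subgroup.inclusion hUS x)
      have h2 := abMk_mul U 1 1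
      rw [mul_one, left_eq_add] at h1 h2
      rw [h1, h2, map_zero]
    | hof i => rw [ht, ← hj, hk]
    | hmul u v hu hv => rw [t1, hu, hv, abMk_mul, map_add]
    | hinv u hu =>
      have h1 := t1 u u⁻¹ (Subgroup.inclusion hUS x)
      have h1' := t1 1 1 (Subgroup.inclusion hUS x)
      have h2 := abMk_mul U u u⁻¹
      have h2' := abMk_mul U 1 1
      rw [mul_one, left_eq_add] at h1' h2'
      rw [mul_inv_cancel, h1'] at h1
      rw [mul_inv_cancel, h2'] at h2
      rw [eq_neg_of_add_eq_zero_right h1.symm, eq_neg_of_add_eq_zero_right h2.symm, hu, map_neg]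
  let t' : G → G → AddCircle (1 : ℚ) := fun s u ↦
    if hs : s ∈ S then if hu : u ∈ U then t ⟨u, hu⟩ ⟨s, hs⟩ else 0 else 0
  have t1' : ∀ u ∈ U, HomOn S (t' · u) := by
    intro u hu x hx y hy
    simp only [t', hx, hy, S.mul_mem hx hy, hu, dif_pos]
    exact t2 ⟨u, hu⟩ ⟨x, hx⟩ ⟨y, hy⟩
  have t2' : ∀ s ∈ S, HomOn U (t' s) := by
    intro s hs x hx y hy
    simp only [t', hx, hy, U.mul_mem hx hy, hs, dif_pos]
    exact t1 ⟨x, hx⟩ ⟨y, hy⟩ ⟨s, hs⟩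
  obtain ⟨Φ, hΦ⟩ := exists_bilinear_functional hUS t' t1' t2'
  have hΦa : Φ (del a) = 0 := by
    refine augSpan_mul_eqOn (φ := Φ) (ψ := 0) (fun s hs y hy ↦ ?_) (by rwa [← mul_assoc])
    refine augSpan_augSpan_eqOn (φ := Φ ∘ₗ LinearMap.mulLeft ℤ (del s)) (ψ := 0)
      (fun s' hs' u hu ↦ ?_) hy
    have e : del s * (del s' * del u) = del (s * s') * del u - del s * del u - del s' * del u := by
      rw [del_mul]; noncomm_ring
    rw [LinearMap.comp_apply, LinearMap.mulLeft_apply, e, map_sub, map_sub,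
      hΦ _ (S.mul_mem hs hs') u hu, hΦ s hs u hu, hΦ s' hs' u hu, LinearMap.zero_apply,
      show t' (s * s') u = t' s u + t' s' u from t1' u hu s hs s' hs']
    abel
  have hUΦ : ∀ s ∈ U, ∀ u ∈ U, Φ (del s * del u) = t' s u := fun s hs ↦ hΦ s (hUS hs)
  have hφ : ψ a = Φ (del a) := by
    refine hψ.eq_of_commutator
      (bilinear_functional_homOn (fun u hu ↦ (t1' u hu).mono hUS) hUΦ) (fun x hx y hy ↦ ?_) haU
    rw [bilinear_functional_commutator (fun u hu ↦ t2' u (hUS hu)) hUΦ hx hy]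
    have h1 := htU ⟨y, hy⟩ ⟨x, hx⟩
    have h2 := htU ⟨x, hx⟩ ⟨y, hy⟩
    simp only [t', hx, hy, hUS hx, hUS hy, dif_pos]
    rw [show t ⟨y, hy⟩ ⟨x, hUS hx⟩ = _ from h1, show t ⟨x, hx⟩ ⟨y, hUS hy⟩ = _ from h2, ht₀, hB]
  exact hψa (hφ.trans hΦa)

/-- The group elements in `1 + Δ(S)² Δ(U)`, for subgroups `U ≤ S` of a free group. -/
theorem mem_of_del_mem [IsFreeGroup G] [U.Normal] (hUS : U ≤ S) {a : G}
    (ha : del a ∈ augSpan S * augSpan S * augSpan U) :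
    a ∈ ⁅U ⊓ ⁅S, S⁆, U ⊓ ⁅S, S⁆⁆ ⊔ ⁅⁅U, U⁆, U⁆ := by
  have haU : a ∈ U := by
    refine mem_of_del_mem_grpIdeal ?_
    rw [grpIdeal, (ConjStable.augSpan U).mul_top]
    exact (mul_le_mul' le_top le_rfl : augSpan S * augSpan S * augSpan U ≤ ⊤ * augSpan U) ha
  obtain ⟨U₁, hfg, hU₁, ha₁⟩ := exists_fg_of_mem_mul_augSpan ha
  -- Adjoining `a` keeps the subgroup finitely generated and makes it contain `a`.
  have h2 : ∃ U₀ : Subgroup G, U₀.FG ∧ U₀ ≤ U ∧ a ∈ U₀ ∧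
      del a ∈ augSpan S * augSpan S * augSpan U₀ := by
    refine ⟨U₁ ⊔ Subgroup.closure {a}, hfg.sup ⟨{a}, by simp⟩, sup_le hU₁ ?_, ?_, ?_⟩
    · rw [Subgroup.closure_le]; simpa using haU
    · exact Subgroup.mem_sup_right (Subgroup.subset_closure rfl)
    · exact (mul_le_mul' le_rfl (augSpan_mono le_sup_left) :
        augSpan S * augSpan S * augSpan U₁ ≤ _) ha₁
  obtain ⟨U₀, hfg, hU₀, ha₀, ha⟩ := h2
  have h3 : a ∈ ⁅U₀, U₀⁆ := by
    refine mem_commutator_of_del_mem (S := S) ha₀ ?_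
    exact (mul_le_mul' (augSpan_mul_augSpan_le le_rfl) le_rfl :
      augSpan S * augSpan S * augSpan U₀ ≤ augSpan S * augSpan U₀) ha
  refine sup_le_sup (Subgroup.commutator_mono ?_ ?_) ?_
    (mem_of_del_mem_fg (hU₀.trans hUS) hfg h3 ha)
  · exact inf_le_inf_right _ hU₀
  · exact inf_le_inf_right _ hU₀
  · exact Subgroup.commutator_mono (Subgroup.commutator_mono hU₀ hU₀) hU₀

end Structure

/-! ### Functionals from triadditive functions -/

section Trilinear

variable {G A : Type*} [Group G] [AddCommGroup A] {S U : Subgroup G}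

/-- `t` is additive in each of its arguments, the first two in `S` and the last in `U`. -/
structure IsTriadditive (S U : Subgroup G) (t : G → G → G → A) : Prop where
  left {x x' y u : G} (hx : x ∈ S) (hx' : x' ∈ S) (hy : y ∈ S) (hu : u ∈ U) :
    t (x * x') y u = t x y u + t x' y u
  mid {x y y' u : G} (hx : x ∈ S) (hy : y ∈ S) (hy' : y' ∈ S) (hu : u ∈ U) :
    t x (y * y') u = t x y u + t x y' u
  right {x y u u' : G} (hx : x ∈ S) (hy : y ∈ S) (hu : u ∈ U) (hu' : u' ∈ U) :
    t x y (u * u') = t x y u + t x y u'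

namespace IsTriadditive

variable {t : G → G → G → A}

theorem homOn_left (ht : IsTriadditive S U t) {y u : G} (hy : y ∈ S) (hu : u ∈ U) :
    HomOn S fun x ↦ t x y u := fun _ hx _ hx' ↦ ht.left hx hx' hy hu

theorem homOn_mid (ht : IsTriadditive S U t) {x u : G} (hx : x ∈ S) (hu : u ∈ U) :
    HomOn S fun y ↦ t x y u := fun _ hy _ hy' ↦ ht.mid hx hy hy' hu

theorem homOn_right (ht : IsTriadditive S U t) {x y : G} (hx : x ∈ S) (hy : y ∈ S) :
    HomOn U (t x y) := fun _ hu _ hu' ↦ ht.right hx hy hu hu'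

theorem exists_functional [IsFreeGroup S] [IsFreeGroup U] (ht : IsTriadditive S U t)
    (hUS : U ≤ S) : ∃ Φ : MonoidAlgebra ℤ G →ₗ[ℤ] A,
      ∀ x ∈ S, ∀ y ∈ S, ∀ u ∈ U, Φ (del x * del y * del u) = t x y u :=
  exists_trilinear_functional hUS t (fun _ hy _ hu ↦ ht.homOn_left hy hu)
    (fun _ hx _ hu ↦ ht.homOn_mid hx hu) (fun _ hx _ hy ↦ ht.homOn_right hx hy)

variable {Φ : MonoidAlgebra ℤ G →ₗ[ℤ] A}

section

variable (ht : IsTriadditive S U t) (hUS : U ≤ S)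
  (hΦ : ∀ x ∈ S, ∀ y ∈ S, ∀ u ∈ U, Φ (del x * del y * del u) = t x y u)
include ht hΦ

/-- Additivity in the middle and last arguments makes the inserted factor k and the trailing factor
h invisible. -/
theorem functional_mul_of {x y k b h : G} (hx : x ∈ S) (hy : y ∈ S) (hk : k ∈ S) (hb : b ∈ U)
    (hh : h ∈ U) : Φ (del x * del y * of ℤ G k * del b * of ℤ G h) = t x y b := by
  have e : del x * del y * of ℤ G k * del b * of ℤ G h = del x * del (y * k) * del (b * h)
      - del x * del (y * k) * del h - del x * del k * del (b * h) + del x * del k * del h := by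
    rw [mul_assoc _ (del b), del_mul_of, mul_assoc (del x), del_mul_of]; noncomm_ring
  rw [e, map_add, map_sub, map_sub, hΦ x hx _ (S.mul_mem hy hk) _ (U.mul_mem hb hh),
    hΦ x hx _ (S.mul_mem hy hk) h hh, hΦ x hx k hk _ (U.mul_mem hb hh), hΦ x hx k hk h hh,
    ht.mid hx hy hk (U.mul_mem hb hh), ht.mid hx hy hk hh, ht.right hx hy hb hh]
  abel

/-- Additivity in the first argument amounts to Φ killing (x − 1)(x' − 1)(y − 1)(u − 1). -/
theorem functional_eq_zero {z : MonoidAlgebra ℤ G}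
    (hz : z ∈ augSpan S * augSpan S * augSpan S * augSpan U) : Φ z = 0 := by
  have hz' : z ∈ augSpan S * (augSpan S * (augSpan S * augSpan U)) := by
    simpa only [mul_assoc] using hz
  refine augSpan_mul_eqOn (φ := Φ) (ψ := 0) (fun x hx y hy ↦ ?_) hz'
  refine augSpan_mul_eqOn (φ := Φ ∘ₗ LinearMap.mulLeft ℤ (del x)) (ψ := 0)
    (fun x' hx' y hy ↦ ?_) hy
  refine augSpan_augSpan_eqOn (φ := Φ ∘ₗ LinearMap.mulLeft ℤ (del x) ∘ₗ
    LinearMap.mulLeft ℤ (del x')) (ψ := 0) (fun y hy u hu ↦ ?_) hy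
  have e : del x * (del x' * (del y * del u)) = del (x * x') * del y * del u
      - del x * del y * del u - del x' * del y * del u := by
    rw [del_mul]; noncomm_ring
  change Φ (del x * (del x' * (del y * del u))) = 0
  rw [e, map_sub, map_sub, hΦ _ (S.mul_mem hx hx') y hy u hu, hΦ x hx y hy u hu,
    hΦ x' hx' y hy u hu, ht.left hx hx' hy hu]
  abel

theorem functional_conj {τ : G} (hS : ∀ x ∈ S, τ * x * τ⁻¹ ∈ S) (hU : ∀ x ∈ U, τ * x * τ⁻¹ ∈ U)
    (hτ : ∀ x ∈ S, ∀ y ∈ S, ∀ u ∈ U, t (τ * x * τ⁻¹) (τ * y * τ⁻¹) (τ * u * τ⁻¹) = t x y u)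
    {z : MonoidAlgebra ℤ G} (hz : z ∈ augSpan S * augSpan S * augSpan U) :
    Φ (of ℤ G τ * z * of ℤ G τ⁻¹) = Φ z := by
  rw [mul_assoc] at hz
  let c : MonoidAlgebra ℤ G →ₗ[ℤ] MonoidAlgebra ℤ G :=
    LinearMap.mulRight ℤ (of ℤ G τ⁻¹) ∘ₗ LinearMap.mulLeft ℤ (of ℤ G τ)
  change (Φ ∘ₗ c) z = Φ z
  refine augSpan_mul_eqOn (φ := Φ ∘ₗ c) (ψ := Φ) (fun x hx y hy ↦ ?_) hz
  refine augSpan_augSpan_eqOn (φ := Φ ∘ₗ c ∘ₗ LinearMap.mulLeft ℤ (del x))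
    (ψ := Φ ∘ₗ LinearMap.mulLeft ℤ (del x)) (fun y hy u hu ↦ ?_) hy
  change Φ (of ℤ G τ * (del x * (del y * del u)) * of ℤ G τ⁻¹) = Φ (del x * (del y * del u))
  rw [of_conj_mul, of_conj_mul, conj_del, conj_del, conj_del, ← mul_assoc, ← mul_assoc,
    hΦ _ (hS x hx) _ (hS y hy) _ (hU u hu), hΦ x hx y hy u hu, hτ x hx y hy u hu]

include hUS

omit hUS in
theorem homOn_functional_left {b : G} (hb : b ∈ U) :
    HomOn ⁅S, S⁆ fun w ↦ Φ (del w * del b) := by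
  intro w hw w' hw'
  have hS := Subgroup.commutator_le_self S
  simp only [del_mul, add_mul, map_add]
  rw [hΦ w (hS hw) w' (hS hw') b hb, (ht.homOn_left (hS hw') hb).eq_zero_of_mem_commutator hw,
    zero_add]

/-- The correction term t w b b' vanishes because w is a product of commutators of S. -/
theorem homOn_functional_right {w : G} (hw : w ∈ ⁅S, S⁆) :
    HomOn U fun b ↦ Φ (del w * del b) := by
  intro b hb b' hb'
  have hS := Subgroup.commutator_le_self S
  simp only [del_mul, mul_add, map_add]
  rw [← mul_assoc, hΦ w (hS hw) b (hUS hb) b' hb',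
    (ht.homOn_left (hUS hb) hb').eq_zero_of_mem_commutator hw, zero_add]

omit hUS in
theorem functional_commutator_mul {x y b : G} (hx : x ∈ S) (hy : y ∈ S) (hb : b ∈ U) :
    Φ (del ⁅x, y⁆ * del b) = t x y b - t y x b := by
  have hk := S.mul_mem (S.inv_mem hx) (S.inv_mem hy)
  have h1 := ht.functional_mul_of hΦ hx hy hk hb U.one_mem
  have h2 := ht.functional_mul_of hΦ hy hx hk hb U.one_mem
  rw [map_one, mul_one] at h1 h2
  rw [del_commutator, sub_mul, sub_mul, map_sub, h1, h2]

theorem functional_mul_mul_of {w b h : G} (hw : w ∈ ⁅S, S⁆) (hb : b ∈ U) (hh : h ∈ U) :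
    Φ (del w * del b * of ℤ G h) = Φ (del w * del b) := by
  rw [mul_assoc, del_mul_of, mul_sub, map_sub]
  have := ht.homOn_functional_right hUS hΦ hw b hb h hh
  simp only at this
  rw [this, add_sub_cancel_right]

theorem functional_commutator {w b : G} (hw : w ∈ U ⊓ ⁅S, S⁆) (hb : b ∈ U ⊓ ⁅S, S⁆) :
    Φ (del ⁅w, b⁆) = Φ (del w * del b) - Φ (del b * del w) := by
  have hh := U.mul_mem (U.inv_mem hw.1) (U.inv_mem hb.1)
  rw [del_commutator, sub_mul, map_sub, ht.functional_mul_mul_of hUS hΦ hw.2 hb.1 hh,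
    ht.functional_mul_mul_of hUS hΦ hb.2 hw.1 hh]

/-- The leading term of [[x,y],z] − 1 is the double ring commutator of x − 1, y − 1, z − 1; the
trailing group elements do not affect Φ. -/
theorem functional_triple {x y z : G} (hx : x ∈ U) (hy : y ∈ U) (hz : z ∈ U) :
    Φ (del ⁅⁅x, y⁆, z⁆) = t x y z - t y x z - t z x y + t z y x := by
  have hc := Subgroup.commutator_mem_commutator hx hy
  have hcS : ⁅x, y⁆ ∈ ⁅S, S⁆ := Subgroup.commutator_mono hUS hUS hc
  have hcU := Subgroup.commutator_le_self U hc
  have hh := U.mul_mem (U.inv_mem hcU) (U.inv_mem hz)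
  have e1 : Φ (del z * del ⁅x, y⁆ * of ℤ G (⁅x, y⁆⁻¹ * z⁻¹)) = t z x y - t z y x := by
    have hk := U.mul_mem (U.inv_mem hx) (U.inv_mem hy)
    have h3 := U.mul_mem hk hh
    have h1 := ht.functional_mul_of hΦ (hUS hz) (hUS hx) S.one_mem hy h3
    have h2 := ht.functional_mul_of hΦ (hUS hz) (hUS hy) S.one_mem hx h3
    rw [map_one, mul_one] at h1 h2
    rw [← h1, ← h2, ← map_sub, del_commutator, map_mul _ (x⁻¹ * y⁻¹)]
    congr 1; noncomm_ring
  rw [del_commutator, sub_mul, map_sub, ht.functional_mul_mul_of hUS hΦ hcS hz hh,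
    ht.functional_commutator_mul hΦ (hUS hx) (hUS hy) hz, e1]
  abel

theorem homOn_functional : HomOn ⁅U, U⁆ fun w ↦ Φ (del w) := by
  intro x hx y hy
  have hU := Subgroup.commutator_le_self U
  simp only [del_mul, map_add]
  rw [(ht.homOn_functional_right hUS hΦ
    (Subgroup.commutator_mono hUS hUS hx)).eq_zero_of_mem_commutator hy, zero_add]

end

end IsTriadditive

/-- A functional on `ℤ[S]` that comes from a triadditive function invariant under `T` vanishes on
`a - 1` if `a - 1` lies in `𝐮𝐬𝐬𝐭 + 𝐭𝐬𝐬𝐮`. -/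
theorem IsTriadditive.functional_kappaR_eq_zero {T : Subgroup G} [S.Normal] [T.Normal] {rep : G → G}
    (hrep : IsRep S T rep) {t : G → G → G → A} (ht : IsTriadditive S (S ⊓ T) t)
    {Φ : MonoidAlgebra ℤ G →ₗ[ℤ] A}
    (hΦ : ∀ x ∈ S, ∀ y ∈ S, ∀ u ∈ S ⊓ T, Φ (del x * del y * del u) = t x y u)
    (hT : ∀ τ ∈ T, ∀ x ∈ S, ∀ y ∈ S, ∀ u ∈ S ⊓ T,
      t (τ * x * τ⁻¹) (τ * y * τ⁻¹) (τ * u * τ⁻¹) = t x y u) {x : MonoidAlgebra ℤ G}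
    (hx : x ∈ grpIdeal (S ⊓ T) * grpIdeal S * grpIdeal S * grpIdeal T
      + grpIdeal T * grpIdeal S * grpIdeal S * grpIdeal (S ⊓ T)) : Φ (kappaR rep x) = 0 := by
  refine LinearMap.mem_ker.mp (hrep.kappaR_mem (fun z hz ↦ ht.functional_eq_zero hΦ hz)
    (fun τ hτ z hz ↦ ?_) hx)
  rw [LinearMap.mem_ker, map_sub, sub_eq_zero]
  exact ht.functional_conj hΦ (fun x hx ↦ Subgroup.Normal.conj_mem inferInstance x hx τ)
    (fun x hx ↦ Subgroup.Normal.conj_mem inferInstance x hx τ) (hT τ hτ) hz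

end Trilinear

/-! ### Comparing homomorphisms on triple commutators -/

section Generation

variable {G A : Type*} [Group G] [AddCommGroup A] {U : Subgroup G}

/-- A homomorphism on a subgroup `K` that contains `⁅⁅U, U⁆, U⁆` agrees there with a homomorphism
on `⁅U, U⁆` if both agree on the triple commutators of elements. -/
theorem HomOn.eq_on_triple_commutator {K : Subgroup G} {f φ : G → A} (hf : HomOn K f)
    (hK : ⁅⁅U, U⁆, U⁆ ≤ K) (hfc : ∀ x ∈ ⁅U, U⁆, ∀ k ∈ ⁅⁅U, U⁆, U⁆, f (x * k * x⁻¹) = f k)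
    (hφ : HomOn ⁅U, U⁆ φ)
    (h : ∀ x ∈ U, ∀ y ∈ U, ∀ z ∈ U, f ⁅⁅x, y⁆, z⁆ = φ ⁅⁅x, y⁆, z⁆) {a : G}
    (ha : a ∈ ⁅⁅U, U⁆, U⁆) : f a = φ a := by
  have hle : ⁅⁅U, U⁆, U⁆ ≤ ⁅U, U⁆ := Subgroup.commutator_mono (Subgroup.commutator_le_self U) le_rfl
  refine (hf.mono hK).eq_of_commutator (hφ.mono hle) (fun c hc z hz ↦ ?_) ha
  have e : ∀ x y : G, ⁅x * y, z⁆ = x * ⁅y, z⁆ * x⁻¹ * ⁅x, z⁆ := fun x y ↦ by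
    simp only [commutatorElement_def]; group
  have hm : ∀ x ∈ ⁅U, U⁆, ⁅x, z⁆ ∈ ⁅⁅U, U⁆, U⁆ :=
    fun x hx ↦ Subgroup.commutator_mem_commutator hx hz
  have hconj : ∀ x ∈ ⁅U, U⁆, ∀ k ∈ ⁅⁅U, U⁆, U⁆, x * k * x⁻¹ ∈ ⁅⁅U, U⁆, U⁆ := by
    intro x hx k hk
    have : x * k * x⁻¹ = ⁅x, k⁆ * k := by simp only [commutatorElement_def]; group
    rw [this]
    exact mul_mem (Subgroup.commutator_mono le_rfl
      (hle.trans (Subgroup.commutator_le_self U)) (Subgroup.commutator_mem_commutator hx hk)) hk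
  -- For fixed z both sides are additive in c ∈ [U,U], because conjugation by [U,U] does not change
  -- the values.
  refine HomOn.eq_of_commutator (H₁ := U) (H₂ := U) (f := fun c ↦ f ⁅c, z⁆)
    (f' := fun c ↦ φ ⁅c, z⁆) (fun x hx y hy ↦ ?_) (fun x hx y hy ↦ ?_)
    (fun x hx y hy ↦ h x hx y hy z hz) hc
  · simp only [e]
    rw [hf _ (hK (hconj x hx _ (hm y hy))) _ (hK (hm x hx)), hfc x hx _ (hm y hy), add_comm]
  · simp only [e]
    rw [hφ _ (hle (hconj x hx _ (hm y hy))) _ (hle (hm x hx)), hφ.conj hx (hle (hm y hy)),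
      add_comm]

end Generation

/-! ### Commutator calculus under a central character -/

section Calculus

variable {G A : Type*} [Group G] [AddCommGroup A] {S T : Subgroup G}

/-- The elements of `S ∩ T` in the commutator subgroup of `S`. -/
abbrev capTwo (S T : Subgroup G) : Subgroup G := S ⊓ T ⊓ ⁅S, S⁆

/-- The elements of `T` in the third term of the lower central series of `S`. -/
abbrev capThree (S T : Subgroup G) : Subgroup G := ⁅⁅S, S⁆, S⁆ ⊓ T

/-- A homomorphism on `⁅⁅S, S⁆, S⁆ ⊓ T` that vanishes on `⁅⁅⁅S, S⁆, S⁆, T⁆`. -/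
structure CentralChar (S T : Subgroup G) (χ : G → A) : Prop where
  hom : HomOn (capThree S T) χ
  zero {x : G} (hx : x ∈ ⁅⁅⁅S, S⁆, S⁆, T⁆) : χ x = 0

theorem commutator_mul_left (x y z : G) : ⁅x * y, z⁆ = x * ⁅y, z⁆ * x⁻¹ * ⁅x, z⁆ := by
  simp only [commutatorElement_def]; group

theorem commutator_mul_right (x y z : G) : ⁅x, y * z⁆ = ⁅x, y⁆ * (y * ⁅x, z⁆ * y⁻¹) := by
  simp only [commutatorElement_def]; group

theorem conj_commutator (x y z : G) : x * ⁅y, z⁆ * x⁻¹ = ⁅x * y * x⁻¹, x * z * x⁻¹⁆ := by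
  simp only [commutatorElement_def]; group

theorem commutator_mul_self_eq_conj (x y : G) : ⁅x, y⁆ * y = x * y * x⁻¹ := by
  simp only [commutatorElement_def]; group

/-- A form of the Hall–Witt identity. -/
theorem commutator_commutator_eq (n y z : G) :
    ⁅n, ⁅y, z⁆⁆ = ⁅n, y⁆ * ⁅y, ⁅n, z⁆⁆ * ⁅n, y⁆⁻¹ * (⁅⁅n, y⁆ * ⁅n, z⁆, ⁅y, z⁆⁆ *
      (⁅y, z⁆ * ⁅⁅n, y⁆, ⁅n, z⁆ * z⁆ * ⁅y, z⁆⁻¹)) := by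
  simp only [commutatorElement_def]; group

section Mem

variable [hS : S.Normal] [hT : T.Normal]

omit hT in
theorem capThree_le_left : capThree S T ≤ S :=
  inf_le_left.trans (Subgroup.commutator_le_right _ _)

theorem capThree_le : capThree S T ≤ S ⊓ T := le_inf capThree_le_left inf_le_right

theorem conj_mem_capThree {x k : G} (hk : k ∈ capThree S T) : x * k * x⁻¹ ∈ capThree S T :=
  Subgroup.Normal.conj_mem inferInstance k hk x

theorem commutator_mem_right {x k : G} (hk : k ∈ capThree S T) : ⁅x, k⁆ ∈ capThree S T :=
  mul_mem (conj_mem_capThree hk) (inv_mem hk)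

theorem commutator_mem_left {x k : G} (hk : k ∈ capThree S T) : ⁅k, x⁆ ∈ capThree S T := by
  rw [← commutatorElement_inv]; exact inv_mem (commutator_mem_right hk)

theorem commutator_mem_T_left {x y : G} (hx : x ∈ T) : ⁅x, y⁆ ∈ T := by
  rw [commutatorElement_def, mul_assoc, mul_assoc, ← mul_assoc y]
  exact T.mul_mem hx (hT.conj_mem _ (T.inv_mem hx) y)

theorem commutator_mem_T_right {x y : G} (hy : y ∈ T) : ⁅x, y⁆ ∈ T := by
  rw [← commutatorElement_inv]; exact T.inv_mem (commutator_mem_T_left hy)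

omit hS in
theorem commutator_mem_capThree {w s : G} (hw : w ∈ capTwo S T) (hs : s ∈ S) :
    ⁅w, s⁆ ∈ capThree S T :=
  ⟨Subgroup.commutator_mem_commutator hw.2 hs, commutator_mem_T_left hw.1.2⟩

theorem commutator_mem_capThree' {w s : G} (hw : w ∈ capTwo S T) (hs : s ∈ S) :
    ⁅s, w⁆ ∈ capThree S T := by
  rw [← commutatorElement_inv]; exact inv_mem (commutator_mem_capThree hw hs)

theorem commutator_mem_capTwo {s u : G} (hs : s ∈ S) (hu : u ∈ S ⊓ T) :
    ⁅s, u⁆ ∈ capTwo S T :=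
  ⟨⟨commutator_mem_T_left hs, commutator_mem_T_right hu.2⟩,
    Subgroup.commutator_mem_commutator hs hu.1⟩

theorem commutator_mem_capTwo' {s u : G} (hs : s ∈ S) (hu : u ∈ S ⊓ T) :
    ⁅u, s⁆ ∈ capTwo S T := by
  rw [← commutatorElement_inv]; exact inv_mem (commutator_mem_capTwo hs hu)

theorem commutator_le_capTwo : ⁅S ⊓ T, S ⊓ T⁆ ≤ capTwo S T :=
  Subgroup.commutator_le.mpr fun _ hx _ hy ↦ commutator_mem_capTwo hx.1 hy

theorem capThree_le_capTwo : capThree S T ≤ capTwo S T :=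
  le_inf capThree_le (inf_le_left.trans (Subgroup.commutator_mono
    (Subgroup.commutator_le_self S) le_rfl))

end Mem

namespace CentralChar

variable [hS : S.Normal] [hT : T.Normal] {χ : G → A} (h : CentralChar S T χ)
include h

omit hS hT in
theorem commutator_left {k τ : G} (hk : k ∈ capThree S T) (hτ : τ ∈ T) : χ ⁅k, τ⁆ = 0 :=
  h.zero (Subgroup.commutator_mem_commutator hk.1 hτ)

omit hS hT in
theorem symm {x y : G} (hxy : ⁅x, y⁆ ∈ capThree S T) : χ ⁅y, x⁆ = -χ ⁅x, y⁆ := by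
  rw [← commutatorElement_inv, h.hom.inv hxy]

theorem commutator_right {k τ : G} (hk : k ∈ capThree S T) (hτ : τ ∈ T) : χ ⁅τ, k⁆ = 0 := by
  rw [h.symm (commutator_mem_left hk), h.commutator_left hk hτ, neg_zero]

theorem conj_eq {x k : G} (hk : k ∈ capThree S T) : χ (x * k * x⁻¹) = χ ⁅x, k⁆ + χ k := by
  rw [← commutator_mul_self_eq_conj, h.hom _ (commutator_mem_right hk) _ hk]

theorem conj {τ k : G} (hτ : τ ∈ T) (hk : k ∈ capThree S T) : χ (τ * k * τ⁻¹) = χ k := by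
  rw [h.conj_eq hk, h.commutator_right hk hτ, zero_add]

/-- Conjugation by x outside T may change χ; the term χ[x, [y, z]] measures this. -/
theorem mul_left' {x y z : G} (hx : ⁅x, z⁆ ∈ capThree S T) (hy : ⁅y, z⁆ ∈ capThree S T) :
    χ ⁅x * y, z⁆ = χ ⁅x, z⁆ + χ ⁅y, z⁆ + χ ⁅x, ⁅y, z⁆⁆ := by
  rw [commutator_mul_left, h.hom _ (conj_mem_capThree hy) _ hx, h.conj_eq hy]; abel

theorem mul_right' {x y z : G} (hy : ⁅x, y⁆ ∈ capThree S T) (hz : ⁅x, z⁆ ∈ capThree S T) :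
    χ ⁅x, y * z⁆ = χ ⁅x, y⁆ + χ ⁅x, z⁆ + χ ⁅y, ⁅x, z⁆⁆ := by
  rw [commutator_mul_right, h.hom _ hy _ (conj_mem_capThree hz), h.conj_eq hz]; abel

theorem mul_left {x y z : G} (hxT : x ∈ T) (hx : ⁅x, z⁆ ∈ capThree S T)
    (hy : ⁅y, z⁆ ∈ capThree S T) : χ ⁅x * y, z⁆ = χ ⁅x, z⁆ + χ ⁅y, z⁆ := by
  rw [h.mul_left' hx hy, h.commutator_right hy hxT, add_zero]

theorem mul_right {x y z : G} (hyT : y ∈ T) (hy : ⁅x, y⁆ ∈ capThree S T)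
    (hz : ⁅x, z⁆ ∈ capThree S T) : χ ⁅x, y * z⁆ = χ ⁅x, y⁆ + χ ⁅x, z⁆ := by
  rw [h.mul_right' hy hz, h.commutator_right hz hyT, add_zero]

/-- `χ ⁅s, w⁆` is additive in `w ∈ S ∩ T ∩ ⁅S, S⁆`. -/
theorem homOn_right {s : G} (hs : s ∈ S) : HomOn (capTwo S T) fun w ↦ χ ⁅s, w⁆ :=
  fun _ hw _ hw' ↦ h.mul_right hw.1.2 (commutator_mem_capThree' hw hs)
    (commutator_mem_capThree' hw' hs)

theorem mul_right_capTwo {s w w' : G} (hs : s ∈ S) (hw : w ∈ capTwo S T)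
    (hw' : w' ∈ capTwo S T) : χ ⁅s, w * w'⁆ = χ ⁅s, w⁆ + χ ⁅s, w'⁆ :=
  h.homOn_right hs _ hw _ hw'

theorem homOn_left {s : G} (hs : s ∈ S) : HomOn (capTwo S T) fun w ↦ χ ⁅w, s⁆ :=
  fun _ hw _ hw' ↦ h.mul_left hw.1.2 (commutator_mem_capThree hw hs)
    (commutator_mem_capThree hw' hs)

theorem mul_left_capTwo {s w w' : G} (hs : s ∈ S) (hw : w ∈ capTwo S T)
    (hw' : w' ∈ capTwo S T) : χ ⁅w * w', s⁆ = χ ⁅w, s⁆ + χ ⁅w', s⁆ :=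
  h.homOn_left hs _ hw _ hw'

/-- `χ ⁅w, u⁆` is additive in `u ∈ S ∩ T` for `w ∈ S ∩ T ∩ ⁅S, S⁆`. -/
theorem homOn_right_cap {w : G} (hw : w ∈ capTwo S T) : HomOn (S ⊓ T) fun u ↦ χ ⁅w, u⁆ :=
  fun _ hu _ hu' ↦ h.mul_right hu.2 (commutator_mem_capThree hw hu.1)
    (commutator_mem_capThree hw hu'.1)

theorem homOn_left_cap {w : G} (hw : w ∈ capTwo S T) : HomOn (S ⊓ T) fun u ↦ χ ⁅u, w⁆ :=
  fun _ hu _ hu' ↦ h.mul_left hu.2 (commutator_mem_capThree' hw hu.1)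
    (commutator_mem_capThree' hw hu'.1)

/-- In the Hall–Witt form of [w, [y, z]] every factor is conjugate by an element of T to a
commutator of an element of γ₃(S) ∩ T with an element of T, so χ kills it. -/
theorem eq_zero_right {w c : G} (hw : w ∈ capTwo S T) (hc : c ∈ ⁅S ⊓ T, S ⊓ T⁆) :
    χ ⁅w, c⁆ = 0 := by
  refine ((h.homOn_right_cap hw).mono (Subgroup.commutator_le_self _)).eq_of_commutator
    HomOn.zero (fun y hy z hz ↦ ?_) hc
  have hyz := commutator_mem_capTwo hy.1 hz
  have ha := commutator_mem_capThree hw hy.1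
  have hb := commutator_mem_capThree hw hz.1
  have h1 : χ ⁅y, ⁅w, z⁆⁆ = 0 := h.commutator_right hb hy.2
  have h2 : χ ⁅⁅w, y⁆ * ⁅w, z⁆, ⁅y, z⁆⁆ = 0 := h.commutator_left (mul_mem ha hb) hyz.1.2
  have h3 : χ ⁅⁅w, y⁆, ⁅w, z⁆ * z⁆ = 0 := h.commutator_left ha (mul_mem hb.2 hz.2)
  have m1 : ⁅y, ⁅w, z⁆⁆ ∈ capThree S T := commutator_mem_right hb
  have m2 : ⁅⁅w, y⁆ * ⁅w, z⁆, ⁅y, z⁆⁆ ∈ capThree S T := commutator_mem_left (mul_mem ha hb)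
  have m3 : ⁅⁅w, y⁆, ⁅w, z⁆ * z⁆ ∈ capThree S T := commutator_mem_left ha
  rw [commutator_commutator_eq, h.hom _ (conj_mem_capThree m1) _
    (mul_mem m2 (conj_mem_capThree m3)), h.hom _ m2 _ (conj_mem_capThree m3), h.conj ha.2 m1,
    h.conj hyz.1.2 m3, h1, h2, h3, add_zero, add_zero]

theorem eq_zero_left {w c : G} (hw : w ∈ capTwo S T) (hc : c ∈ ⁅S ⊓ T, S ⊓ T⁆) :
    χ ⁅c, w⁆ = 0 := by
  rw [h.symm (commutator_mem_capThree hw (commutator_le_capTwo hc).1.1), h.eq_zero_right hw hc,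
    neg_zero]

/-- Hall–Witt with n only in S: the term quadratic in n survives, because [n, y] and [n, z] need not
lie in [S ∩ T, S ∩ T]. -/
theorem jacobi {n y z : G} (hn : n ∈ S) (hy : y ∈ S ⊓ T) (hz : z ∈ S ⊓ T) :
    χ ⁅n, ⁅y, z⁆⁆ = χ ⁅y, ⁅n, z⁆⁆ + χ ⁅⁅n, y⁆, ⁅n, z⁆⁆ + χ ⁅⁅n, y⁆, z⁆ := by
  have hyz := commutator_mem_capTwo hy.1 hz
  have ha := commutator_mem_capTwo hn hy
  have hb := commutator_mem_capTwo hn hz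
  have h2 : χ ⁅⁅n, y⁆ * ⁅n, z⁆, ⁅y, z⁆⁆ = 0 :=
    h.eq_zero_right (mul_mem ha hb) (Subgroup.commutator_mem_commutator hy hz)
  have h3 : χ ⁅⁅n, y⁆, ⁅n, z⁆ * z⁆ = χ ⁅⁅n, y⁆, ⁅n, z⁆⁆ + χ ⁅⁅n, y⁆, z⁆ :=
    h.homOn_right_cap ha _ hb.1 _ hz
  have m1 : ⁅y, ⁅n, z⁆⁆ ∈ capThree S T := commutator_mem_capThree' hb hy.1
  have m2 : ⁅⁅n, y⁆ * ⁅n, z⁆, ⁅y, z⁆⁆ ∈ capThree S T :=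
    commutator_mem_capThree (mul_mem ha hb) hyz.1.1
  have m3 : ⁅⁅n, y⁆, ⁅n, z⁆ * z⁆ ∈ capThree S T :=
    commutator_mem_capThree ha (mul_mem hb.1.1 hz.1)
  rw [commutator_commutator_eq, h.hom _ (conj_mem_capThree m1) _
    (mul_mem m2 (conj_mem_capThree m3)), h.hom _ m2 _ (conj_mem_capThree m3), h.conj ha.1.2 m1,
    h.conj hyz.1.2 m3, h2, h3]
  abel

theorem jacobi_cap {n y z : G} (hn : n ∈ S ⊓ T) (hy : y ∈ S ⊓ T) (hz : z ∈ S ⊓ T) :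
    χ ⁅n, ⁅y, z⁆⁆ = χ ⁅y, ⁅n, z⁆⁆ + χ ⁅⁅n, y⁆, z⁆ := by
  rw [h.jacobi hn.1 hy hz, h.eq_zero_right (commutator_mem_capTwo hn.1 hy)
    (Subgroup.commutator_mem_commutator hn hz), add_zero]

theorem jacobi_capTwo_left {n w z : G} (hn : n ∈ S) (hw : w ∈ capTwo S T) (hz : z ∈ S ⊓ T) :
    χ ⁅n, ⁅w, z⁆⁆ = χ ⁅w, ⁅n, z⁆⁆ := by
  rw [h.jacobi hn hw.1 hz, h.commutator_left (commutator_mem_capThree' hw hn)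
    (commutator_mem_capTwo hn hz).1.2, h.commutator_left (commutator_mem_capThree' hw hn) hz.2,
    add_zero, add_zero]

theorem jacobi_capTwo_right {n w z : G} (hn : n ∈ S) (hw : w ∈ capTwo S T) (hz : z ∈ S ⊓ T) :
    χ ⁅n, ⁅z, w⁆⁆ = χ ⁅⁅n, z⁆, w⁆ := by
  rw [h.jacobi hn hz hw.1, h.commutator_right (commutator_mem_capThree' hw hn) hz.2,
    h.commutator_right (commutator_mem_capThree' hw hn) (commutator_mem_capTwo hn hz).1.2,
    zero_add, zero_add]

/-- [γ₃(S), T] and γ₃(S) ∩ T are normal. The use is for x in S outside T, where the new character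
may differ from χ. -/
theorem comp_conj {x : G} : CentralChar S T fun k ↦ χ (x * k * x⁻¹) where
  hom y hy z hz := by
    have : x * (y * z) * x⁻¹ = x * y * x⁻¹ * (x * z * x⁻¹) := by group
    simp only [this]
    exact h.hom _ (conj_mem_capThree hy) _ (conj_mem_capThree hz)
  zero hy := h.zero (Subgroup.Normal.conj_mem inferInstance _ hy x)

/-- Comparing `jacobi` for χ and for its conjugate by x applies [x, ·] to each term. The quadratic
term dies, being a commutator of γ₃(S) ∩ T with T, and the two others simplify by the special Jacobi
identities. The outcome is the polarization of χ[[x, u], [x, v]]. -/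
theorem double {x y u v : G} (hx : x ∈ S) (hy : y ∈ S) (hu : u ∈ S ⊓ T) (hv : v ∈ S ⊓ T) :
    χ ⁅x, ⁅y, ⁅u, v⁆⁆⁆ = χ ⁅⁅x, u⁆, ⁅y, v⁆⁆ + χ ⁅⁅y, u⁆, ⁅x, v⁆⁆ := by
  have h1 := (h.comp_conj (x := x)).jacobi hy hu hv
  have h2 := h.jacobi hy hu hv
  have hyu := commutator_mem_capTwo hy hu
  have hyv := commutator_mem_capTwo hy hv
  have huv := commutator_mem_capTwo hu.1 hv
  rw [h.conj_eq (commutator_mem_capThree' huv hy), h.conj_eq (commutator_mem_capThree' hyv hu.1),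
    h.conj_eq (commutator_mem_capThree hyu hyv.1.1), h.conj_eq (commutator_mem_capThree hyu hv.1),
    h.jacobi_capTwo_right hx hyv hu, h.jacobi_capTwo_left hx hyu hyv.1,
    h.jacobi_capTwo_left hx hyu hv, h.commutator_right (commutator_mem_capThree' hyv hx)
      hyu.1.2] at h1
  rw [h2] at h1
  refine add_right_cancel (h1.trans ?_)
  abel

/-- The function `(x, y, u, v) ↦ χ ⁅⁅x, u⁆, ⁅y, v⁆⁆` is additive in `x ∈ S`. -/
theorem double_mul_left {x x' y u v : G} (hx : x ∈ S) (hx' : x' ∈ S) (hy : y ∈ S)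
    (hu : u ∈ S ⊓ T) (hv : v ∈ S ⊓ T) :
    χ ⁅⁅x * x', u⁆, ⁅y, v⁆⁆ = χ ⁅⁅x, u⁆, ⁅y, v⁆⁆ + χ ⁅⁅x', u⁆, ⁅y, v⁆⁆ := by
  have h1 := commutator_mem_capTwo hx hu
  have h2 := commutator_mem_capTwo hx' hu
  have h3 := commutator_mem_capTwo hy hv
  have hk := commutator_mem_capThree' h2 hx
  have e : ⁅x * x', u⁆ = ⁅x, ⁅x', u⁆⁆ * (⁅x', u⁆ * ⁅x, u⁆) := by
    rw [commutator_mul_left, ← commutator_mul_self_eq_conj, mul_assoc]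
  rw [e, h.mul_left_capTwo h3.1.1 (capThree_le_capTwo hk) (mul_mem h2 h1),
    h.mul_left_capTwo h3.1.1 h2 h1,
    h.commutator_left hk h3.1.2]
  abel

theorem double_mul_third {x y u u' v : G} (hx : x ∈ S) (hy : y ∈ S)
    (hu : u ∈ S ⊓ T) (hu' : u' ∈ S ⊓ T) (hv : v ∈ S ⊓ T) :
    χ ⁅⁅x, u * u'⁆, ⁅y, v⁆⁆ = χ ⁅⁅x, u⁆, ⁅y, v⁆⁆ + χ ⁅⁅x, u'⁆, ⁅y, v⁆⁆ := by
  have h1 := commutator_mem_capTwo hx hu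
  have h2 := commutator_mem_capTwo hx hu'
  have h3 := commutator_mem_capTwo hy hv
  have hk := commutator_mem_capThree' h2 hu.1
  have e : ⁅x, u * u'⁆ = ⁅x, u⁆ * (⁅u, ⁅x, u'⁆⁆ * ⁅x, u'⁆) := by
    rw [commutator_mul_right, ← commutator_mul_self_eq_conj]
  rw [e, h.mul_left_capTwo h3.1.1 h1 (mul_mem (capThree_le_capTwo hk) h2),
    h.mul_left_capTwo h3.1.1 (capThree_le_capTwo hk) h2,
    h.commutator_left hk h3.1.2]
  abel

theorem double_symm {x y u v : G} (hx : x ∈ S) (hy : y ∈ S)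
    (hu : u ∈ S ⊓ T) (hv : v ∈ S ⊓ T) : χ ⁅⁅y, v⁆, ⁅x, u⁆⁆ = -χ ⁅⁅x, u⁆, ⁅y, v⁆⁆ :=
  h.symm (commutator_mem_capThree (commutator_mem_capTwo hx hu) (commutator_mem_capTwo hy hv).1.1)

theorem double_mul_right {x y y' u v : G} (hx : x ∈ S) (hy : y ∈ S) (hy' : y' ∈ S)
    (hu : u ∈ S ⊓ T) (hv : v ∈ S ⊓ T) :
    χ ⁅⁅x, u⁆, ⁅y * y', v⁆⁆ = χ ⁅⁅x, u⁆, ⁅y, v⁆⁆ + χ ⁅⁅x, u⁆, ⁅y', v⁆⁆ := by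
  rw [h.double_symm (S.mul_mem hy hy') hx hv hu, h.double_mul_left hy hy' hx hv hu,
    h.double_symm hx hy hu hv, h.double_symm hx hy' hu hv]
  abel

theorem double_mul_fourth {x y u v v' : G} (hx : x ∈ S) (hy : y ∈ S)
    (hu : u ∈ S ⊓ T) (hv : v ∈ S ⊓ T) (hv' : v' ∈ S ⊓ T) :
    χ ⁅⁅x, u⁆, ⁅y, v * v'⁆⁆ = χ ⁅⁅x, u⁆, ⁅y, v⁆⁆ + χ ⁅⁅x, u⁆, ⁅y, v'⁆⁆ := by
  rw [h.double_symm hy hx (mul_mem hv hv') hu, h.double_mul_third hy hx hv hv' hu,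
    h.double_symm hx hy hu hv, h.double_symm hx hy hu hv']
  abel

/-- `χ ⁅⁅x, y⁆, z⁆` is additive in each argument in `S ∩ T`. -/
theorem triple_mul_left {x x' y z : G} (hx : x ∈ S ⊓ T) (hx' : x' ∈ S ⊓ T) (hy : y ∈ S)
    (hz : z ∈ S ⊓ T) : χ ⁅⁅x * x', y⁆, z⁆ = χ ⁅⁅x, y⁆, z⁆ + χ ⁅⁅x', y⁆, z⁆ := by
  have h1 := commutator_mem_capTwo' hy hx
  have h2 := commutator_mem_capTwo' hy hx'
  have hk := commutator_mem_capThree' h2 hx.1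
  rw [commutator_mul_left, ← commutator_mul_self_eq_conj, mul_assoc,
    h.mul_left_capTwo hz.1 (capThree_le_capTwo hk) (mul_mem h2 h1),
    h.mul_left_capTwo hz.1 h2 h1, h.commutator_left hk hz.2]
  abel

theorem triple_mul_mid {x y y' z : G} (hx : x ∈ S ⊓ T) (hy : y ∈ S) (hy' : y' ∈ S)
    (hz : z ∈ S ⊓ T) : χ ⁅⁅x, y * y'⁆, z⁆ = χ ⁅⁅x, y⁆, z⁆ + χ ⁅⁅x, y'⁆, z⁆ := by
  have h1 := commutator_mem_capTwo' hy hx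
  have h2 := commutator_mem_capTwo' hy' hx
  have hk := commutator_mem_capThree' h2 hy
  rw [commutator_mul_right, ← commutator_mul_self_eq_conj,
    h.mul_left_capTwo hz.1 h1 (mul_mem (capThree_le_capTwo hk) h2),
    h.mul_left_capTwo hz.1 (capThree_le_capTwo hk) h2, h.commutator_left hk hz.2]
  abel

theorem triple_mul_right {x y z z' : G} (hx : x ∈ S ⊓ T) (hy : y ∈ S) (hz : z ∈ S ⊓ T)
    (hz' : z' ∈ S ⊓ T) : χ ⁅⁅x, y⁆, z * z'⁆ = χ ⁅⁅x, y⁆, z⁆ + χ ⁅⁅x, y⁆, z'⁆ :=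
  h.homOn_right_cap (commutator_mem_capTwo' hy hx) _ hz _ hz'

theorem triple_swap {x y z : G} (hx : x ∈ S ⊓ T) (hy : y ∈ S) (hz : z ∈ S ⊓ T) :
    χ ⁅⁅y, x⁆, z⁆ = -χ ⁅⁅x, y⁆, z⁆ := by
  rw [← commutatorElement_inv x y]
  exact (h.homOn_left hz.1).inv (commutator_mem_capTwo' hy hx)

theorem triple_eq_neg {x y z : G} (hx : x ∈ S ⊓ T) (hy : y ∈ S) (hz : z ∈ S ⊓ T) :
    χ ⁅z, ⁅x, y⁆⁆ = -χ ⁅⁅x, y⁆, z⁆ :=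
  h.symm (commutator_mem_capThree (commutator_mem_capTwo' hy hx) hz.1)

theorem triple_jacobi {x y z : G} (hx : x ∈ S ⊓ T) (hy : y ∈ S ⊓ T) (hz : z ∈ S ⊓ T) :
    χ ⁅⁅x, y⁆, z⁆ + χ ⁅⁅y, z⁆, x⁆ + χ ⁅⁅z, x⁆, y⁆ = 0 := by
  have h1 := h.jacobi_cap hx hy hz
  rw [h.triple_eq_neg hy hz.1 hx, h.triple_eq_neg hx hz.1 hy] at h1
  rw [h.triple_swap hx hz.1 hy]
  generalize χ ⁅⁅x, y⁆, z⁆ = a at *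
  generalize χ ⁅⁅y, z⁆, x⁆ = b at *
  generalize χ ⁅⁅x, z⁆, y⁆ = c at *
  grind only

end CentralChar

end Calculus

/-! ### Functionals from crossed pairs -/

section Crossed

variable {G A : Type*} [Group G] [AddCommGroup A] {S T : Subgroup G}

/-- Coordinates with respect to a transversal of the right cosets of a subgroup. -/
theorem exists_coset_coordinate (U : Subgroup G) :
    ∃ κ : G → G, (∀ g, κ g ∈ U) ∧ ∀ u ∈ U, ∀ g, κ (u * g) = u * κ g := by
  classical
  let r : G → G := fun g ↦ (Quotient.out (Quotient.mk (QuotientGroup.rightRel U) g))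
  have hr : ∀ g, g * (r g)⁻¹ ∈ U := fun g ↦ by
    have := Quotient.exact (Quotient.out_eq (Quotient.mk (QuotientGroup.rightRel U) g))
    exact QuotientGroup.rightRel_apply.mp this
  have hu : ∀ u ∈ U, ∀ g, r (u * g) = r g := fun u hu g ↦ by
    have : Quotient.mk (QuotientGroup.rightRel U) (u * g) =
        Quotient.mk (QuotientGroup.rightRel U) g := by
      refine Quotient.sound (QuotientGroup.rightRel_apply.mpr ?_)
      simpa using U.inv_mem hu
    simp only [r, this]
  exact ⟨fun g ↦ g * (r g)⁻¹, hr, fun u h g ↦ by simp only [hu u h, mul_assoc]⟩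

/-- A functional with prescribed values on `Δ(U) Δ(S)` and on the elements `w - 1` with
`w ∈ U ∩ ⁅S, S⁆`. -/
theorem exists_functional_of_pair (hA : Module.Baer ℤ A) {U : Subgroup G} [IsFreeGroup S]
    (hUS : U ≤ S) (B : G → G → A) (C : G → A) (h1 : ∀ s ∈ S, HomOn U (B · s))
    (h2 : ∀ b ∈ U, HomOn S (B b))
    (h0 : ∀ w ∈ U ⊓ ⁅S, S⁆, ∀ w' ∈ U ⊓ ⁅S, S⁆, B w w' = 0) (hC : HomOn (U ⊓ ⁅S, S⁆) C)
    (hBC : ∀ u ∈ U, ∀ u' ∈ U, C ⁅u, u'⁆ = B u u' - B u' u) :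
    ∃ Θ : MonoidAlgebra ℤ G →ₗ[ℤ] A, (∀ b ∈ U, ∀ s ∈ S, Θ (del b * del s) = B b s) ∧
      ∀ w ∈ U ⊓ ⁅S, S⁆, Θ (del w) = C w := by
  obtain ⟨κ, hκ, hκU⟩ := exists_coset_coordinate U
  have hc : ∀ s ∈ S, ∀ b ∈ U, ∀ g, gext (fun g ↦ B (κ g) s) (del b * of ℤ G g) = B b s := by
    intro s hs b hb g
    have := h1 s hs b hb _ (hκ g)
    simp only at this
    rw [del_mul_of, map_sub, gext_del, gext_del, hκU b hb, this]
    abel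
  have hX : ∀ {φ ψ : MonoidAlgebra ℤ G →ₗ[ℤ] A}, (∀ b ∈ U, ∀ g, φ (del b * of ℤ G g) =
      ψ (del b * of ℤ G g)) → ∀ z ∈ grpIdeal U, φ z = ψ z := by
    intro φ ψ h z hz
    refine augSpan_mul_eqOn (fun b hb y _ ↦ ?_) hz
    exact LinearMap.congr_fun (hom_ext_of (φ := φ ∘ₗ LinearMap.mulLeft ℤ (del b))
      (ψ := ψ ∘ₗ LinearMap.mulLeft ℤ (del b)) (h b hb)) y
  obtain ⟨Φ, hΦ⟩ := exists_functional_of_cocycle S (grpIdeal U)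
    (fun z hz s _ ↦ mul_mem_grpIdeal_right U hz _) (fun s ↦ gext fun g ↦ B (κ g) s) (by
      intro s' hs' s hs z hz
      refine hX (φ := gext fun g ↦ B (κ g) (s' * s))
        (ψ := (gext fun g ↦ B (κ g) s) ∘ₗ LinearMap.mulRight ℤ (of ℤ G s') +
          gext fun g ↦ B (κ g) s') (fun b hb g ↦ ?_) z hz
      rw [LinearMap.add_apply, LinearMap.comp_apply, LinearMap.mulRight_apply, mul_assoc,
        ← map_mul, hc _ (S.mul_mem hs' hs) b hb, hc s hs b hb, hc s' hs' b hb,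
        h2 b hb s' hs' s hs, add_comm])
  have hΦB : ∀ b ∈ U, ∀ s ∈ S, Φ (del b * del s) = B b s := by
    intro b hb s hs
    have hb' : del b * of ℤ G 1 ∈ grpIdeal U := Submodule.mul_mem_mul (del_mem_augSpan hb) trivial
    have := hΦ s hs _ hb'
    rwa [hc s hs b hb, map_one, mul_one] at this
  -- Φ already has the values `B`. The discrepancy with `C` is additive by `h0` and vanishes on
  -- [U,U] by `hBC`, so it extends to `U`.
  have hf : HomOn (U ⊓ ⁅S, S⁆) fun w ↦ C w - Φ (del w) := by
    intro w hw w' hw'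
    simp only [hC w hw w' hw', del_mul, map_add, hΦB w hw.1 w' (hUS hw'.1), h0 w hw w' hw']
    abel
  have hle : ⁅U, U⁆ ≤ U ⊓ ⁅S, S⁆ :=
    le_inf (Subgroup.commutator_le_self U) (Subgroup.commutator_mono hUS hUS)
  obtain ⟨f, hf', hfw⟩ := hf.exists_extension hA (inf_le_left : U ⊓ ⁅S, S⁆ ≤ U)
    (fun w _ hw ↦ (hf.mono hle).eq_of_commutator HomOn.zero (fun u hu u' hu' ↦ by
      rw [bilinear_functional_commutator (t := B) (fun b hb ↦ (h2 b hb).mono hUS)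
        (fun b hb s hs ↦ hΦB b hb s (hUS hs)) hu hu', hBC u hu u' hu', sub_self]) hw)
  have hfκ : ∀ b ∈ U, ∀ g, f (κ (b * g)) = f b + f (κ g) := fun b hb g ↦ by
    rw [hκU b hb, hf' b hb _ (hκ g)]
  -- Since f ∘ κ is additive for left translation by `U`, the correction kills Δ(U)Δ(S) and leaves
  -- the values `B` intact.
  refine ⟨Φ + gext fun g ↦ f (κ g), fun b hb s hs ↦ ?_, fun w hw ↦ ?_⟩
  · have e : del b * del s = del (b * s) - del b - del s := by rw [del_mul]; abel
    have hb1 := hfκ b hb 1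
    rw [mul_one] at hb1
    rw [LinearMap.add_apply, hΦB b hb s hs, e, map_sub, map_sub, gext_del, gext_del, gext_del,
      hfκ b hb, hb1]
    abel
  · have := hfκ w hw.1 1
    rw [mul_one] at this
    rw [LinearMap.add_apply, gext_del, this, hfw w hw]
    abel

/-- Pairs of families of functions indexed by `τ ∈ T`, on `(S ⊓ T) × S` and on `capTwo S T`, that
define a functional on `ℤ[G]`. -/
structure CrossedPair (S T : Subgroup G) (B : G → G → G → A) (C : G → G → A) : Prop where
  left {τ s : G} (hτ : τ ∈ T) (hs : s ∈ S) : HomOn (S ⊓ T) (B τ · s)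
  right {τ b : G} (hτ : τ ∈ T) (hb : b ∈ S ⊓ T) : HomOn S (B τ b)
  zero {τ w w' : G} (hτ : τ ∈ T) (hw : w ∈ capTwo S T) (hw' : w' ∈ capTwo S T) : B τ w w' = 0
  hom {τ : G} (hτ : τ ∈ T) : HomOn (capTwo S T) (C τ)
  commutator {τ u u' : G} (hτ : τ ∈ T) (hu : u ∈ S ⊓ T) (hu' : u' ∈ S ⊓ T) :
    C τ ⁅u, u'⁆ = B τ u u' - B τ u' u
  crossed_left {σ τ b s : G} (hσ : σ ∈ T) (hτ : τ ∈ T) (hb : b ∈ S ⊓ T) (hs : s ∈ S) :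
    B (σ * τ) b s = B τ (σ⁻¹ * b * σ) (σ⁻¹ * s * σ) + B σ b s
  crossed_right {σ τ w : G} (hσ : σ ∈ T) (hτ : τ ∈ T) (hw : w ∈ capTwo S T) :
    C (σ * τ) w = C τ (σ⁻¹ * w * σ) + C σ w

namespace CrossedPair

variable {B : G → G → G → A} {C : G → G → A} (h : CrossedPair S T B C)
include h

/-- For each τ take Θ_τ with values B_τ and C_τ and precede it by the projection f ↦ rep(f)⁻¹f to
ℤ[S]. On I + Y, where Y = Δ(T)ℤ[F]Δ(S)², these functionals vanish on Y and form a cocycle over T on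
account of the two crossed identities. The resulting Φ kills YΔ(T), the ideal tsst. -/
theorem exists_functional (hA : Module.Baer ℤ A) [hS : S.Normal] [hT : T.Normal]
    [IsFreeGroup S] [IsFreeGroup T] {rep : G → G} (hrep : IsRep S T rep) :
    ∃ Φ : MonoidAlgebra ℤ G →ₗ[ℤ] A,
      (∀ z ∈ grpIdeal T * grpIdeal S * grpIdeal S * grpIdeal T, Φ z = 0) ∧
      (∀ b ∈ S ⊓ T, ∀ s ∈ S, ∀ τ ∈ T, Φ (del b * del s * del τ) = B τ b s) ∧
      ∀ w ∈ capTwo S T, ∀ τ ∈ T, Φ (del w * del τ) = C τ w := by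
  have hΘ : ∀ τ, ∃ Θ : MonoidAlgebra ℤ G →ₗ[ℤ] A, τ ∈ T →
      (∀ b ∈ S ⊓ T, ∀ s ∈ S, Θ (del b * del s) = B τ b s) ∧
      ∀ w ∈ S ⊓ T ⊓ ⁅S, S⁆, Θ (del w) = C τ w := by
    intro τ
    by_cases hτ : τ ∈ T
    · obtain ⟨Θ, h1⟩ := exists_functional_of_pair hA inf_le_left (B τ) (C τ)
        (fun s hs ↦ h.left hτ hs) (fun b hb ↦ h.right hτ hb) (fun w hw w' hw' ↦ h.zero hτ hw hw')
        (h.hom hτ) (fun u hu u' hu' ↦ h.commutator hτ hu hu')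
      exact ⟨Θ, fun _ ↦ h1⟩
    · exact ⟨0, fun hτ' ↦ absurd hτ' hτ⟩
  choose Θ hΘ using hΘ
  let κ : MonoidAlgebra ℤ G →ₗ[ℤ] MonoidAlgebra ℤ G := gext fun f ↦ of ℤ G ((rep f)⁻¹ * f)
  have hκ : ∀ f, ∀ z ∈ augSpan S, κ (of ℤ G f * z) = of ℤ G ((rep f)⁻¹ * f) * z := by
    intro f z hz
    refine augSpan_eqOn (φ := κ ∘ₗ LinearMap.mulLeft ℤ (of ℤ G f))
      (ψ := LinearMap.mulLeft ℤ (of ℤ G ((rep f)⁻¹ * f))) (fun s hs ↦ ?_) hz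
    rw [LinearMap.comp_apply, LinearMap.mulLeft_apply, LinearMap.mulLeft_apply, of_mul_del,
      of_mul_del, map_sub, del, del, map_sub, map_sub, gext_of, gext_of, hrep.right f hs, del, del,
      mul_assoc]
    abel
  have hκ1 : ∀ z ∈ augSpan S, κ z = z := by
    intro z hz
    have := hκ 1 z hz
    rwa [hrep.one S.one_mem, inv_one, mul_one, map_one, one_mul] at this
  have hSS : augSpan S * augSpan S ≤ augSpan S := augSpan_mul_augSpan_le le_rfl
  set Y : Submodule ℤ (MonoidAlgebra ℤ G) := augSpan T * (⊤ * (augSpan S * augSpan S)) with hY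
  set I : Submodule ℤ (MonoidAlgebra ℤ G) :=
    augSpan (S ⊓ T) * augSpan S ⊔ augSpan (capTwo S T) with hI
  have hIS : I ≤ augSpan S * augSpan S := by
    refine sup_le (mul_le_mul' (augSpan_mono inf_le_left) le_rfl) ?_
    rw [augSpan, Submodule.span_le]
    rintro _ ⟨w, hw, rfl⟩
    exact del_commutator_mem hw.2
  have hconjI : ConjStable I := by
    intro f z hz
    obtain ⟨x, hx, y, hy, rfl⟩ := Submodule.mem_sup.mp hz
    rw [mul_add, add_mul]
    exact add_mem (Submodule.mem_sup_left (((ConjStable.augSpan _).mul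
      (ConjStable.augSpan _)) f x hx)) (Submodule.mem_sup_right ((ConjStable.augSpan _) f y hy))
  have hYr : ∀ f, ∀ z ∈ Y, z * of ℤ G f ∈ Y := by
    rw [← mul_top_le_iff, hY, mul_assoc, mul_assoc,
      ((ConjStable.augSpan S).mul (ConjStable.augSpan S)).mul_top, ← mul_assoc ⊤ ⊤, top_mul_top_eq]
  have hYI : ∀ τ ∈ T, ∀ z ∈ augSpan S * augSpan S, del τ * z ∈ Y := by
    intro τ hτ z hz
    refine Submodule.mul_mem_mul (del_mem_augSpan hτ) ?_
    simpa using Submodule.mul_mem_mul (show (1 : MonoidAlgebra ℤ G) ∈ ⊤ from trivial) hz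
  have hmul : ∀ τ, ∀ z, z * of ℤ G τ =
      del τ * (of ℤ G τ⁻¹ * z * of ℤ G τ⁻¹⁻¹) + of ℤ G τ⁻¹ * z * of ℤ G τ⁻¹⁻¹ := by
    intro τ z
    rw [mul_of_eq_mul_conj, of_eq_del_add_one τ, add_mul, one_mul]
  have hΘ0 : ∀ τ ∈ T, ∀ u ∈ S ⊓ T, ∀ z ∈ augSpan S * augSpan S, Θ τ (del u * z) = 0 := by
    intro τ hτ u hu z hz
    refine augSpan_augSpan_eqOn (φ := Θ τ ∘ₗ LinearMap.mulLeft ℤ (del u)) (ψ := 0)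
      (fun s hs s' hs' ↦ ?_) hz
    have e : del u * (del s * del s') = del u * del (s * s') - del u * del s - del u * del s' := by
      rw [del_mul]; noncomm_ring
    rw [LinearMap.comp_apply, LinearMap.mulLeft_apply, e, map_sub, map_sub,
      (hΘ τ hτ).1 u hu _ (S.mul_mem hs hs'), (hΘ τ hτ).1 u hu _ hs, (hΘ τ hτ).1 u hu _ hs',
      h.right hτ hu s hs s' hs', LinearMap.zero_apply]
    abel
  -- The transition elements rep(τ₀f)⁻¹τ₀rep(f) lie in S ∩ T, so κ replaces the leading Δ(T) by Δ(S
  -- ∩ T), and Θ_τ kills Δ(S ∩ T)Δ(S)².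
  have hcY : ∀ τ ∈ T, ∀ z ∈ Y, Θ τ (κ z) = 0 := by
    intro τ hτ z hz
    refine augSpan_mul_eqOn (φ := Θ τ ∘ₗ κ) (ψ := 0) (fun τ₀ hτ₀ y hy ↦ ?_) hz
    suffices H : ⊤ * (augSpan S * augSpan S) ≤
        LinearMap.ker (Θ τ ∘ₗ κ ∘ₗ LinearMap.mulLeft ℤ (del τ₀)) from H hy
    refine top_mul_le_iff.mpr fun f z hz ↦ ?_
    have hzS := hSS hz
    have e : (rep (τ₀ * f))⁻¹ * (τ₀ * f) =
        (rep (τ₀ * f))⁻¹ * τ₀ * rep f * ((rep f)⁻¹ * f) := by group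
    have hu : (rep (τ₀ * f))⁻¹ * τ₀ * rep f ∈ S ⊓ T := by
      refine ⟨?_, T.mul_mem (T.mul_mem (T.inv_mem (hrep.mem _)) hτ₀) (hrep.mem _)⟩
      have := S.mul_mem (hrep.inv_mul_mem (τ₀ * f)) (S.inv_mem (hrep.inv_mul_mem f))
      rw [e] at this
      simpa using this
    rw [LinearMap.mem_ker, LinearMap.comp_apply, LinearMap.comp_apply, LinearMap.mulLeft_apply,
      ← mul_assoc, del_mul_of, sub_mul]
    have e2 : κ (del (τ₀ * f) * z - del f * z) =
        del ((rep (τ₀ * f))⁻¹ * τ₀ * rep f) * (of ℤ G ((rep f)⁻¹ * f) * z) := by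
      rw [del, del, sub_mul, sub_mul, one_mul, sub_sub_sub_cancel_right, map_sub, hκ _ _ hzS,
        hκ _ _ hzS, e, map_mul _ (_ * rep f), del, sub_mul, one_mul, mul_assoc]
    rw [e2]
    exact hΘ0 τ hτ _ hu _ (of_mul_mem_augSpan_mul (hrep.inv_mul_mem f) hz)
  obtain ⟨Φ, hΦ⟩ := exists_functional_of_cocycle T (I ⊔ Y) (by
    intro z hz τ hτ
    obtain ⟨x, hx, y, hy, rfl⟩ := Submodule.mem_sup.mp hz
    have hx' := hconjI τ⁻¹ x hx
    rw [add_mul, hmul τ x]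
    exact add_mem (add_mem (Submodule.mem_sup_right (hYI τ hτ _ (hIS hx')))
      (Submodule.mem_sup_left hx')) (Submodule.mem_sup_right (hYr τ y hy)))
    (fun τ ↦ Θ τ ∘ₗ κ) (by
    intro σ hσ τ hτ z hz
    obtain ⟨x, hx, y, hy, rfl⟩ := Submodule.mem_sup.mp hz
    have hστ := T.mul_mem hσ hτ
    have hx' := hconjI σ⁻¹ x hx
    simp only [LinearMap.comp_apply]
    rw [add_mul]
    simp only [map_add]
    rw [hcY _ hστ y hy, hcY _ hσ y hy, hcY _ hτ _ (hYr σ y hy), hmul σ x, map_add, map_add,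
      hcY _ hτ _ (hYI σ hσ _ (hIS hx')), hκ1 _ (hSS (hIS hx)), hκ1 _ (hSS (hIS hx')), zero_add,
      add_zero, add_zero, add_zero]
    clear hx' hy hz
    have hconj : ∀ g, of ℤ G σ⁻¹ * del g * of ℤ G σ⁻¹⁻¹ = del (σ⁻¹ * g * σ) := fun g ↦ by
      rw [conj_del, inv_inv]
    suffices H : I ≤ LinearMap.ker (Θ (σ * τ) - (Θ τ ∘ₗ LinearMap.mulRight ℤ (of ℤ G σ⁻¹⁻¹) ∘ₗ
        LinearMap.mulLeft ℤ (of ℤ G σ⁻¹) + Θ σ)) from sub_eq_zero.mp (H hx)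
    refine sup_le ?_ ?_
    · intro z hz
      rw [LinearMap.mem_ker, LinearMap.sub_apply, sub_eq_zero]
      refine augSpan_augSpan_eqOn (fun b hb s hs ↦ ?_) hz
      have hb' : σ⁻¹ * b * σ ∈ S ⊓ T := by
        simpa using Subgroup.Normal.conj_mem (inferInstanceAs (S ⊓ T).Normal) b hb σ⁻¹
      have hs' : σ⁻¹ * s * σ ∈ S := by simpa using hS.conj_mem s hs σ⁻¹
      rw [(hΘ _ hστ).1 b hb s hs, LinearMap.add_apply, (hΘ _ hσ).1 b hb s hs,
        LinearMap.comp_apply, LinearMap.comp_apply, LinearMap.mulLeft_apply,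
        LinearMap.mulRight_apply, of_conj_mul, hconj, hconj, (hΘ _ hτ).1 _ hb' _ hs',
        h.crossed_left hσ hτ hb hs]
    · intro z hz
      rw [LinearMap.mem_ker, LinearMap.sub_apply, sub_eq_zero]
      refine augSpan_eqOn (fun w hw ↦ ?_) hz
      have hw' : σ⁻¹ * w * σ ∈ capTwo S T := by
        simpa using Subgroup.Normal.conj_mem (inferInstanceAs (capTwo S T).Normal) w hw σ⁻¹
      rw [(hΘ _ hστ).2 w hw, LinearMap.add_apply, (hΘ _ hσ).2 w hw,
        LinearMap.comp_apply, LinearMap.comp_apply, LinearMap.mulLeft_apply,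
        LinearMap.mulRight_apply, hconj, (hΘ _ hτ).2 _ hw', h.crossed_right hσ hτ hw])
  refine ⟨Φ, fun z hz ↦ ?_, fun b hb s hs τ hτ ↦ ?_, fun w hw τ hτ ↦ ?_⟩
  · rw [grpIdeal_prod_eq] at hz
    suffices H : Y * augSpan T ≤ LinearMap.ker Φ from H hz
    rw [Submodule.mul_le]
    intro y hy x hx
    exact augSpan_eqOn (φ := Φ ∘ₗ LinearMap.mulLeft ℤ y) (ψ := 0) (fun τ hτ ↦
      (hΦ τ hτ y (Submodule.mem_sup_right hy)).trans (hcY τ hτ y hy)) hx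
  · have hm : del b * del s ∈ I := Submodule.mem_sup_left
      (Submodule.mul_mem_mul (del_mem_augSpan hb) (del_mem_augSpan hs))
    rw [hΦ τ hτ _ (Submodule.mem_sup_left hm), LinearMap.comp_apply, hκ1 _ (hSS (hIS hm)),
      (hΘ τ hτ).1 b hb s hs]
  · have hm : del w ∈ I := Submodule.mem_sup_right (del_mem_augSpan hw)
    rw [hΦ τ hτ _ (Submodule.mem_sup_left hm), LinearMap.comp_apply, hκ1 _ (hSS (hIS hm)),
      (hΘ τ hτ).2 w hw]

variable {Φ : MonoidAlgebra ℤ G →ₗ[ℤ] A}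

theorem functional_commutator (hΦ : ∀ w ∈ capTwo S T, ∀ τ ∈ T, Φ (del w * del τ) = C τ w)
    {w w' : G} (hw : w ∈ capTwo S T) (hw' : w' ∈ capTwo S T) :
    Φ (del ⁅w, w'⁆) = C w' w - C w w' := by
  have key : ∀ {w w' k : G}, w ∈ capTwo S T → w' ∈ capTwo S T → k ∈ capTwo S T →
      Φ (del w * del w' * of ℤ G k) = C w' w := by
    intro w w' k hw hw' hk
    rw [mul_assoc, del_mul_of, mul_sub, map_sub, hΦ w hw _ (T.mul_mem hw'.1.2 hk.1.2),
      hΦ w hw _ hk.1.2, h.crossed_right hw'.1.2 hk.1.2 hw, (h.hom hk.1.2).conj' hw' hw]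
    abel
  have hk := mul_mem (inv_mem hw) (inv_mem hw')
  rw [del_commutator, sub_mul, map_sub, key hw hw' hk, key hw' hw hk]

theorem functional_triple (hΦ' : ∀ b ∈ S ⊓ T, ∀ s ∈ S, ∀ τ ∈ T, Φ (del b * del s * del τ) = B τ b s)
    (hΦ : ∀ w ∈ capTwo S T, ∀ τ ∈ T, Φ (del w * del τ) = C τ w) [S.Normal] [T.Normal]
    {x y z : G} (hx : x ∈ S ⊓ T) (hy : y ∈ S ⊓ T) (hz : z ∈ S ⊓ T) :
    Φ (del ⁅⁅x, y⁆, z⁆) = C z ⁅x, y⁆ - B y z x + B x z y := by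
  have hU : ∀ {a b : G}, a ∈ S ⊓ T → b ∈ S ⊓ T → a⁻¹ * b * a ∈ S ⊓ T := fun ha hb ↦
    mul_mem (mul_mem (inv_mem ha) hb) ha
  have hB : ∀ {τ b s a : G}, τ ∈ T → b ∈ S ⊓ T → s ∈ S ⊓ T → a ∈ S ⊓ T →
      B τ (a⁻¹ * b * a) (a⁻¹ * s * a) = B τ b s := by
    intro τ b s a hτ hb hs ha
    rw [(h.right hτ (hU ha hb)).conj' ha.1 hs.1]
    exact (h.left hτ hs.1).conj' ha hb
  have key : ∀ {z x y k : G}, z ∈ S ⊓ T → x ∈ S ⊓ T → y ∈ S ⊓ T → k ∈ S ⊓ T →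
      Φ (del z * (del x * del y) * of ℤ G k) = B y z x := by
    intro z x y k hz hx hy hk
    rw [← mul_assoc, mul_assoc, del_mul_of, mul_sub, map_sub, hΦ' z hz x hx.1 _
      (T.mul_mem hy.2 hk.2), hΦ' z hz x hx.1 _ hk.2, h.crossed_left hy.2 hk.2 hz hx.1,
      hB hk.2 hz hx hy]
    abel
  have hc := commutator_mem_capTwo hx.1 hy
  have hk : ⁅x, y⁆⁻¹ * z⁻¹ ∈ S ⊓ T := mul_mem (inv_mem hc.1) (inv_mem hz)
  have hk' := mul_mem (mul_mem (inv_mem hx) (inv_mem hy)) hk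
  have e1 : Φ (del ⁅x, y⁆ * del z * of ℤ G (⁅x, y⁆⁻¹ * z⁻¹)) = C z ⁅x, y⁆ := by
    have e : z⁻¹ * ⁅x, y⁆ * z = ⁅z⁻¹ * x * z, z⁻¹ * y * z⁆ := by
      simpa using conj_commutator z⁻¹ x y
    rw [mul_assoc, del_mul_of, mul_sub, map_sub, hΦ _ hc _ (T.mul_mem hz.2 hk.2), hΦ _ hc _ hk.2,
      h.crossed_right hz.2 hk.2 hc, e, h.commutator hk.2 (hU hz hx) (hU hz hy), hB hk.2 hx hy hz,
      hB hk.2 hy hx hz, h.commutator hk.2 hx hy]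
    abel
  have e2 : Φ (del z * del ⁅x, y⁆ * of ℤ G (⁅x, y⁆⁻¹ * z⁻¹)) = B y z x - B x z y := by
    rw [del_commutator x y, ← mul_assoc, mul_assoc (del z * _), ← map_mul, mul_sub, sub_mul,
      map_sub, key hz hx hy hk', key hz hy hx hk']
  rw [del_commutator ⁅x, y⁆ z, sub_mul, map_sub, e1, e2]
  abel

theorem homOn_functional (hΦ : ∀ w ∈ capTwo S T, ∀ τ ∈ T, Φ (del w * del τ) = C τ w)
    [S.Normal] [T.Normal] (h0 : ∀ a ∈ ⁅S ⊓ T, S ⊓ T⁆, ∀ b ∈ ⁅S ⊓ T, S ⊓ T⁆, C b a = 0) :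
    HomOn ⁅S ⊓ T, S ⊓ T⁆ fun x ↦ Φ (del x) := by
  intro a ha b hb
  simp only [del_mul, map_add]
  rw [hΦ a (commutator_le_capTwo ha) b (commutator_le_capTwo hb).1.2, h0 a ha b hb, zero_add]

end CrossedPair

end Crossed

/-! ### Lifting F to T modulo S, and the crossed pairs of a character -/

section Lift

variable {F A : Type*} [Group F] [AddCommGroup A] {S T : Subgroup F}

/-- An endomorphism with values in `T` that is the identity modulo `S`. -/
structure IsLift (S T : Subgroup F) (q : F →* F) : Prop where
  mem (f : F) : q f ∈ T
  mul_inv_mem (f : F) : f * (q f)⁻¹ ∈ S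

/-- The difference between an element and its image. -/
def defect (q : F →* F) (f : F) : F := f * (q f)⁻¹

/-- Freeness allows q to be chosen on the basis as a component in T; normality of S propagates the
congruence. -/
theorem exists_isLift [IsFreeGroup F] [hS : S.Normal] (hST : S ⊔ T = ⊤) :
    ∃ q : F →* F, IsLift S T q := by
  have h : ∀ i : IsFreeGroup.Generators F, ∃ τ ∈ T, IsFreeGroup.of i * τ⁻¹ ∈ S := by
    intro i
    have hi : IsFreeGroup.of i ∈ S ⊔ T := hST ▸ Subgroup.mem_top _
    obtain ⟨s, hs, τ, hτ, e⟩ := Subgroup.mem_sup_of_normal_left.mp hi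
    exact ⟨τ, hτ, by rw [← e, mul_inv_cancel_right]; exact hs⟩
  choose τ hτ hτS using h
  let q : F →* F := IsFreeGroup.lift τ
  have hq : ∀ i, q (IsFreeGroup.of i) = τ i := fun i ↦ IsFreeGroup.lift_of _ _
  refine ⟨q, fun f ↦ ?_, fun f ↦ ?_⟩
  · induction f using free_induction with
    | h1 => rw [map_one]; exact T.one_mem
    | hof i => rw [hq]; exact hτ i
    | hmul x y hx hy => rw [map_mul]; exact T.mul_mem hx hy
    | hinv x hx => rw [map_inv]; exact T.inv_mem hx
  · induction f using free_induction with
    | h1 => simp [S.one_mem]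
    | hof i => rw [hq]; exact hτS i
    | hmul x y hx hy =>
      have e : x * y * (q (x * y))⁻¹ = x * (y * (q y)⁻¹) * x⁻¹ * (x * (q x)⁻¹) := by
        rw [map_mul]; group
      rw [e]
      exact S.mul_mem (hS.conj_mem _ hy x) hx
    | hinv x hx =>
      have e : x⁻¹ * (q x⁻¹)⁻¹ = x⁻¹ * (x * (q x)⁻¹)⁻¹ * x⁻¹⁻¹ := by rw [map_inv]; group
      rw [e]
      exact hS.conj_mem _ (S.inv_mem hx) _

theorem defect_one (q : F →* F) : defect q 1 = 1 := by simp [defect]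

theorem defect_mul (q : F →* F) (f g : F) :
    defect q (f * g) = defect q f * (q f * defect q g * (q f)⁻¹) := by
  simp only [defect, map_mul]; group

theorem conj_defect (q : F →* F) (f g : F) :
    f * g * f⁻¹ = defect q f * (q f * g * (q f)⁻¹) * (defect q f)⁻¹ := by
  simp only [defect]; group

namespace IsLift

variable {q : F →* F} (hq : IsLift S T q)
include hq

theorem defect_mem (f : F) : defect q f ∈ S := hq.mul_inv_mem f

theorem defect_mem_cap {τ : F} (hτ : τ ∈ T) : defect q τ ∈ S ⊓ T :=
  ⟨hq.defect_mem τ, T.mul_mem hτ (T.inv_mem (hq.mem τ))⟩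

theorem mem_cap {s : F} (hs : s ∈ S) : q s ∈ S ⊓ T := by
  refine ⟨?_, hq.mem s⟩
  have := S.mul_mem (S.inv_mem (hq.mul_inv_mem s)) hs
  simpa using this

theorem mem_commutator {c : F} (hc : c ∈ ⁅S, S⁆) : q c ∈ ⁅S ⊓ T, S ⊓ T⁆ := by
  suffices h : ⁅S, S⁆ ≤ ⁅S ⊓ T, S ⊓ T⁆.comap q from h hc
  refine Subgroup.commutator_le.mpr fun x hx y hy ↦ ?_
  rw [Subgroup.mem_comap, map_commutatorElement]
  exact Subgroup.commutator_mem_commutator (hq.mem_cap hx) (hq.mem_cap hy)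

theorem defect_mem_commutator {c : F} (hc : c ∈ ⁅S ⊓ T, S ⊓ T⁆) :
    defect q c ∈ ⁅S ⊓ T, S ⊓ T⁆ :=
  mul_mem hc (inv_mem (hq.mem_commutator (Subgroup.commutator_mono inf_le_left inf_le_left hc)))

variable [hS : S.Normal] [hT : T.Normal]

omit hS hT in
theorem hom_defect {g : F → A} (hg : HomOn (S ⊓ T) g) {τ : F} (hτ : τ ∈ S ⊓ T) :
    g (defect q τ) = g τ - g (q τ) := by
  have hqτ := hq.mem_cap hτ.1
  rw [defect, hg _ hτ _ (inv_mem hqτ), hg.inv hqτ, sub_eq_add_neg]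

/-- The defect is crossed for conjugation by q σ. A homomorphism on S ∩ T does not distinguish this
from conjugation by σ, as the two differ by `defect q σ` ∈ S ∩ T. -/
theorem hom_defect_mul {g : F → A} (hg : HomOn (S ⊓ T) g) {σ τ : F} (hσ : σ ∈ T) (hτ : τ ∈ T) :
    g (defect q (σ * τ)) = g (σ * defect q τ * σ⁻¹) + g (defect q σ) := by
  have h1 := hq.defect_mem_cap hσ
  have h2 : q σ * defect q τ * (q σ)⁻¹ ∈ S ⊓ T :=
    Subgroup.Normal.conj_mem inferInstance _ (hq.defect_mem_cap hτ) _
  rw [defect_mul, conj_defect q σ, hg.conj h1 h2, hg _ h1 _ h2, add_comm]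

theorem hom_conj {g : F → A} (hg : HomOn (S ⊓ T) g) {τ u : F} (hτ : τ ∈ T) (hu : u ∈ S ⊓ T) :
    g (τ * u * τ⁻¹) = g (q τ * u * (q τ)⁻¹) := by
  have h2 : q τ * u * (q τ)⁻¹ ∈ S ⊓ T := Subgroup.Normal.conj_mem inferInstance _ hu _
  rw [conj_defect q τ, hg.conj (hq.defect_mem_cap hτ) h2]

end IsLift

namespace CentralChar

variable [hS : S.Normal] [hT : T.Normal] {χ : F → A} (h : CentralChar S T χ)
include h

theorem conj_pair {τ w s : F} (hτ : τ ∈ T) (hws : ⁅w, s⁆ ∈ capThree S T) :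
    χ ⁅τ * w * τ⁻¹, τ * s * τ⁻¹⁆ = χ ⁅w, s⁆ := by
  rw [← conj_commutator, h.conj hτ hws]

theorem conj_pair_left {τ w s : F} (hτ : τ ∈ T) (hws : ⁅τ⁻¹ * w * τ, s⁆ ∈ capThree S T) :
    χ ⁅w, τ * s * τ⁻¹⁆ = χ ⁅τ⁻¹ * w * τ, s⁆ := by
  rw [← h.conj_pair hτ hws]
  congr 2; group

theorem conj_pair_right {τ w s : F} (hτ : τ ∈ T) (hws : ⁅w, τ⁻¹ * s * τ⁆ ∈ capThree S T) :
    χ ⁅τ * w * τ⁻¹, s⁆ = χ ⁅w, τ⁻¹ * s * τ⁆ := by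
  rw [← h.conj_pair hτ hws]
  congr 2; group

theorem conj_triple {τ x y z : F} (hτ : τ ∈ T) (hx : x ∈ S ⊓ T) (hy : y ∈ S) (hz : z ∈ S) :
    χ ⁅⁅τ * x * τ⁻¹, τ * y * τ⁻¹⁆, τ * z * τ⁻¹⁆ = χ ⁅⁅x, y⁆, z⁆ := by
  rw [← conj_commutator, h.conj_pair hτ (commutator_mem_capThree (commutator_mem_capTwo' hy hx) hz)]

theorem homOn_triple_left {y z : F} (hy : y ∈ S) (hz : z ∈ S ⊓ T) :
    HomOn (S ⊓ T) fun x ↦ χ ⁅⁅x, y⁆, z⁆ := fun _ hx _ hx' ↦ h.triple_mul_left hx hx' hy hz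

theorem homOn_triple_mid {x z : F} (hx : x ∈ S ⊓ T) (hz : z ∈ S ⊓ T) :
    HomOn S fun y ↦ χ ⁅⁅x, y⁆, z⁆ := fun _ hy _ hy' ↦ h.triple_mul_mid hx hy hy' hz

theorem homOn_triple_right {x y : F} (hx : x ∈ S ⊓ T) (hy : y ∈ S) :
    HomOn (S ⊓ T) fun z ↦ χ ⁅⁅x, y⁆, z⁆ := fun _ hz _ hz' ↦ h.triple_mul_right hx hy hz hz'

/-- The function `u, v ↦ χ ⁅⁅x, u⁆, ⁅x, v⁆⁆` is the restriction of a homomorphism. -/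
theorem exists_hom_double (hA : Module.Baer ℤ A) [IsFreeGroup F] {x : F} (hx : x ∈ S) :
    ∃ φ : F → A, HomOn (capTwo S T) φ ∧
      ∀ u ∈ S ⊓ T, ∀ v ∈ S ⊓ T, φ ⁅u, v⁆ = χ ⁅⁅x, u⁆, ⁅x, v⁆⁆ := by
  obtain ⟨φ, hφ, hφD⟩ := exists_hom_commutator (U := S ⊓ T) (fun u v ↦ χ ⁅⁅x, u⁆, ⁅x, v⁆⁆)
    (fun v hv u hu u' hu' ↦ h.double_mul_third hx hx hu hu' hv)
    (fun u hu v hv v' hv' ↦ h.double_mul_fourth hx hx hu hv hv') (fun u hu ↦ by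
      rw [commutatorElement_self, h.hom.one])
  -- Extension needs vanishing on commutators of `capTwo S T`; there [x, w] is in γ₃(S) ∩ T, and χ
  -- kills its commutator with T.
  obtain ⟨φ', h1, h2⟩ := hφ.exists_extension hA (commutator_le_capTwo (S := S) (T := T))
    (fun c hc hc' ↦ (hφ.mono (Subgroup.commutator_mono inf_le_left inf_le_left)).eq_of_commutator
      HomOn.zero (fun w hw w' hw' ↦ by
        rw [hφD w hw.1 w' hw'.1]
        exact h.commutator_left (commutator_mem_capThree' hw hx) (commutator_mem_capTwo hx hw'.1).1.2)
      hc')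
  exact ⟨φ', h1, fun u hu v hv ↦
    (h2 _ (Subgroup.commutator_mem_commutator hu hv)).trans (hφD u hu v hv)⟩

variable {q : F →* F} (hq : IsLift S T q)
include hq

/-- q maps [S,S] into [S ∩ T, S ∩ T], which pairs to zero with w by `eq_zero_right`. -/
theorem pair_defect_right {w w' : F} (hw : w ∈ capTwo S T) (hw' : w' ∈ capTwo S T) :
    χ ⁅w, defect q w'⁆ = χ ⁅w, w'⁆ := by
  have := hq.hom_defect (h.homOn_right_cap hw) hw'.1
  rw [this, h.eq_zero_right hw (hq.mem_commutator hw'.2), sub_zero]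

theorem pair_defect_left {w w' : F} (hw : w ∈ capTwo S T) (hw' : w' ∈ capTwo S T) :
    χ ⁅defect q w', w⁆ = χ ⁅w', w⁆ := by
  have := hq.hom_defect (h.homOn_left_cap hw) hw'.1
  rw [this, h.eq_zero_left hw (hq.mem_commutator hw'.2), sub_zero]

theorem pair_defect_eq_zero {a b : F} (ha : a ∈ ⁅S ⊓ T, S ⊓ T⁆) (hb : b ∈ ⁅S ⊓ T, S ⊓ T⁆) :
    χ ⁅a, defect q b⁆ = 0 :=
  h.eq_zero_left (commutator_le_capTwo (hq.defect_mem_commutator hb)) ha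

/-- The first crossed pair attached to a central character. -/
theorem crossedPair : CrossedPair S T (fun τ b s ↦ χ ⁅⁅defect q τ, s⁆, b⁆)
    (fun τ w ↦ χ ⁅w, defect q τ⁆) where
  left hτ hs := h.homOn_triple_right (hq.defect_mem_cap hτ) hs
  right hτ hb := h.homOn_triple_mid (hq.defect_mem_cap hτ) hb
  zero hτ hw hw' := h.commutator_left (commutator_mem_capThree' hw' (hq.defect_mem _)) hw.1.2
  hom hτ := h.homOn_left (hq.defect_mem _)
  commutator {τ u u'} hτ hu hu' := by
    have hn := hq.defect_mem_cap hτ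
    have h1 := h.triple_jacobi hu hu' hn
    rw [h.triple_swap hn hu'.1 hu] at h1
    rw [eq_sub_iff_add_eq, ← sub_eq_zero, ← h1]
    abel
  crossed_left {σ τ b s} hσ hτ hb hs := by
    have hb' : σ⁻¹ * b * σ ∈ S ⊓ T := by
      simpa using Subgroup.Normal.conj_mem (inferInstanceAs (S ⊓ T).Normal) b hb σ⁻¹
    have hs' : σ⁻¹ * s * σ ∈ S := by simpa using hS.conj_mem s hs σ⁻¹
    have h1 := hq.hom_defect_mul (h.homOn_triple_left hs hb) hσ hτ
    rw [h1, ← h.conj_triple hσ (hq.defect_mem_cap hτ) hs' hb'.1]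
    congr 4 <;> group
  crossed_right {σ τ w} hσ hτ hw := by
    have hw' : σ⁻¹ * w * σ ∈ capTwo S T := by
      simpa using Subgroup.Normal.conj_mem (inferInstanceAs (capTwo S T).Normal) w hw σ⁻¹
    have h1 := hq.hom_defect_mul (h.homOn_right_cap hw) hσ hτ
    rw [h1, h.conj_pair_left hσ (commutator_mem_capThree hw' (hq.defect_mem _))]

/-- The second crossed pair attached to a central character. -/
theorem crossedPair' : CrossedPair S T (fun τ b s ↦ χ ⁅⁅b, s⁆, defect q τ⁆)
    (fun τ w ↦ χ ⁅w, defect q τ⁆ + χ ⁅w, defect q τ⁆) where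
  left hτ hs := h.homOn_triple_left hs (hq.defect_mem_cap hτ)
  right hτ hb := h.homOn_triple_mid hb (hq.defect_mem_cap hτ)
  zero hτ hw hw' := h.commutator_left (commutator_mem_capThree hw hw'.1.1) (hq.defect_mem_cap hτ).2
  hom hτ := (h.homOn_left (hq.defect_mem _)).add (h.homOn_left (hq.defect_mem _))
  commutator {τ u u'} hτ hu hu' := by
    rw [h.triple_swap hu hu'.1 (hq.defect_mem_cap hτ), sub_neg_eq_add]
  crossed_left {σ τ b s} hσ hτ hb hs := by
    have hb' : σ⁻¹ * b * σ ∈ S ⊓ T := by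
      simpa using Subgroup.Normal.conj_mem (inferInstanceAs (S ⊓ T).Normal) b hb σ⁻¹
    have hs' : σ⁻¹ * s * σ ∈ S := by simpa using hS.conj_mem s hs σ⁻¹
    have h1 := hq.hom_defect_mul (h.homOn_triple_right hb hs) hσ hτ
    rw [h1, ← h.conj_triple hσ hb' hs' (hq.defect_mem τ)]
    congr 4 <;> group
  crossed_right {σ τ w} hσ hτ hw := by
    rw [(h.crossedPair hq).crossed_right hσ hτ hw]
    abel

/-- A triadditive function attached to a central character. -/
theorem isTriadditive : IsTriadditive S (S ⊓ T) fun x y u ↦ χ ⁅⁅q x, y⁆, u⁆ where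
  left hx hx' hy hu := by
    rw [map_mul]; exact h.triple_mul_left (hq.mem_cap hx) (hq.mem_cap hx') hy hu
  mid hx hy hy' hu := h.triple_mul_mid (hq.mem_cap hx) hy hy' hu
  right hx hy hu hu' := h.triple_mul_right (hq.mem_cap hx) hy hu hu'

theorem triadditive_conj {τ x y u : F} (hτ : τ ∈ T) (hx : x ∈ S) (hy : y ∈ S) (hu : u ∈ S ⊓ T) :
    χ ⁅⁅q (τ * x * τ⁻¹), τ * y * τ⁻¹⁆, τ * u * τ⁻¹⁆ = χ ⁅⁅q x, y⁆, u⁆ := by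
  have h1 := hq.hom_conj (h.homOn_triple_left (hS.conj_mem y hy τ)
    (Subgroup.Normal.conj_mem inferInstance u hu τ)) hτ (hq.mem_cap hx)
  rw [map_mul, map_mul, map_inv, ← h1, h.conj_triple hτ (hq.mem_cap hx) hy hu.1]

/-- The failure of f ↦ χ[d f, [u, v]] to be crossed is, by `double`, the polarization of the
quadratic term, so subtracting that term restores crossedness. -/
theorem crossed_double {f g u v : F} (hu : u ∈ S ⊓ T) (hv : v ∈ S ⊓ T) :
    χ ⁅defect q (f * g), ⁅u, v⁆⁆ - χ ⁅⁅defect q (f * g), u⁆, ⁅defect q (f * g), v⁆⁆ =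
      χ ⁅defect q f, ⁅u, v⁆⁆ - χ ⁅⁅defect q f, u⁆, ⁅defect q f, v⁆⁆ +
      (χ ⁅defect q g, ⁅(q f)⁻¹ * u * q f, (q f)⁻¹ * v * q f⁆⁆ -
        χ ⁅⁅defect q g, (q f)⁻¹ * u * q f⁆, ⁅defect q g, (q f)⁻¹ * v * q f⁆⁆) := by
  have hτ := hq.mem f
  set τ := q f
  have hcap : ∀ {u}, u ∈ S ⊓ T → τ⁻¹ * u * τ ∈ S ⊓ T := fun {u} hu ↦ by
    simpa using Subgroup.Normal.conj_mem (inferInstanceAs (S ⊓ T).Normal) u hu τ⁻¹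
  have hx := hq.defect_mem f
  have hg := hq.defect_mem g
  have hy : τ * defect q g * τ⁻¹ ∈ S := hS.conj_mem _ hg τ
  have e : ∀ u, u = τ * (τ⁻¹ * u * τ) * τ⁻¹ := fun u ↦ by group
  have hc := commutator_mem_capTwo hu.1 hv
  have hc' := commutator_mem_capTwo (hcap hu).1 (hcap hv)
  have e1 : χ ⁅defect q g, ⁅τ⁻¹ * u * τ, τ⁻¹ * v * τ⁆⁆ = χ ⁅τ * defect q g * τ⁻¹, ⁅u, v⁆⁆ := by
    rw [← h.conj_pair hτ (commutator_mem_capThree' hc' hg), conj_commutator, ← e, ← e]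
  have e2 : χ ⁅⁅defect q g, τ⁻¹ * u * τ⁆, ⁅defect q g, τ⁻¹ * v * τ⁆⁆ =
      χ ⁅⁅τ * defect q g * τ⁻¹, u⁆, ⁅τ * defect q g * τ⁻¹, v⁆⁆ := by
    rw [← h.conj_pair hτ (commutator_mem_capThree (commutator_mem_capTwo hg (hcap hu))
      (commutator_mem_capTwo hg (hcap hv)).1.1), conj_commutator, conj_commutator, ← e, ← e]
  rw [e1, e2, defect_mul, h.mul_left' (commutator_mem_capThree' hc hx)
    (commutator_mem_capThree' hc hy), h.double hx hy hu hv,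
    h.double_mul_left hx hy (S.mul_mem hx hy) hu hv, h.double_mul_right hx hx hy hu hv,
    h.double_mul_right hy hx hy hu hv]
  abel

/-- A crossed homomorphism that agrees with `f, w ↦ χ ⁅defect q f, w⁆` up to a correction. -/
theorem exists_crossed (hA : Module.Baer ℤ A) [IsFreeGroup F] :
    ∃ c : F → F → A, (∀ f, HomOn (capTwo S T) (c f)) ∧
      (∀ f g w, c (f * g) w = c f w + c g ((q f)⁻¹ * w * q f)) ∧
      ∀ f, ∀ u ∈ S ⊓ T, ∀ v ∈ S ⊓ T, c f ⁅u, v⁆ =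
        χ ⁅defect q f, ⁅u, v⁆⁆ - χ ⁅⁅defect q f, u⁆, ⁅defect q f, v⁆⁆ := by
  have hφ := fun i : IsFreeGroup.Generators F ↦
    h.exists_hom_double hA (hq.defect_mem (IsFreeGroup.of i))
  choose φ hφ hφD using hφ
  let act : F →* AddMonoid.End (F → A) :=
    { toFun := fun f ↦
        { toFun := fun c w ↦ c ((q f)⁻¹ * w * q f)
          map_zero' := rfl
          map_add' := fun _ _ ↦ rfl }
      map_one' := AddMonoidHom.ext fun c ↦ funext fun w ↦ by
        change c _ = c _
        rw [map_one, inv_one, one_mul, mul_one]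
      map_mul' := fun f g ↦ AddMonoidHom.ext fun c ↦ funext fun w ↦ by
        change c _ = c _
        rw [map_mul]
        congr 1; group }
  -- On a basis the quadratic term comes from a homomorphism φ i in w; `crossed_double` carries the
  -- formula to all f.
  obtain ⟨c, hc1, hc2⟩ := exists_crossedHom act
    (fun i w ↦ χ ⁅defect q (IsFreeGroup.of i), w⁆ - φ i w)
  let M₀ : AddSubgroup (F → A) :=
    { carrier := {c | HomOn (capTwo S T) c}
      zero_mem' := HomOn.zero
      add_mem' := fun h h' ↦ h.add h'
      neg_mem' := fun h ↦ h.neg }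
  have hcM : ∀ f, c f ∈ M₀ := by
    refine crossedHom_mem hc2 M₀ (fun f m hm w hw w' hw' ↦ ?_) fun i ↦ ?_
    · have hcap : ∀ {u}, u ∈ capTwo S T → (q f)⁻¹ * u * q f ∈ capTwo S T := fun {u} hu ↦ by
        simpa using Subgroup.Normal.conj_mem (inferInstanceAs (capTwo S T).Normal) u hu (q f)⁻¹
      have := hm _ (hcap hw) _ (hcap hw')
      change m _ = m _ + m _
      rw [← this]
      congr 1; group
    · rw [hc1]
      exact (h.homOn_right (hq.defect_mem _)).sub (hφ i)
  have hc3 : ∀ f g w, c (f * g) w = c f w + c g ((q f)⁻¹ * w * q f) :=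
    fun f g w ↦ congrFun (hc2 f g) w
  refine ⟨c, hcM, hc3, fun f ↦ ?_⟩
  have hcap : ∀ g : F, ∀ {u}, u ∈ S ⊓ T → g⁻¹ * u * g ∈ S ⊓ T := fun g {u} hu ↦ by
    simpa using Subgroup.Normal.conj_mem (inferInstanceAs (S ⊓ T).Normal) u hu g⁻¹
  have e : ∀ g u v : F, g⁻¹ * ⁅u, v⁆ * g = ⁅g⁻¹ * u * g, g⁻¹ * v * g⁆ := fun g u v ↦ by
    simpa using conj_commutator g⁻¹ u v
  have hone : ∀ u v : F, c 1 ⁅u, v⁆ =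
      χ ⁅defect q 1, ⁅u, v⁆⁆ - χ ⁅⁅defect q 1, u⁆, ⁅defect q 1, v⁆⁆ := by
    intro u v
    rw [crossedHom_one hc2, defect_one]
    simp [h.hom.one]
  induction f using free_induction with
  | h1 => exact fun u _ v _ ↦ hone u v
  | hof i =>
    intro u hu v hv
    rw [hc1]
    simp only
    rw [hφD i u hu v hv]
  | hmul x y hx hy =>
    intro u hu v hv
    rw [hc3, h.crossed_double hq hu hv, hx u hu v hv, e, hy _ (hcap _ hu) _ (hcap _ hv)]
  | hinv x hx =>
    intro u hu v hv
    have h1 := hc3 x⁻¹ x ⁅u, v⁆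
    have h2 := h.crossed_double hq (f := x⁻¹) (g := x) hu hv
    rw [inv_mul_cancel] at h1 h2
    rw [e, hx _ (hcap _ hu) _ (hcap _ hv), hone, h2] at h1
    exact (add_right_cancel h1).symm

end CentralChar

end Lift

/-! ### The combination of functionals equal to 6χ -/

section SixSmul

variable {F A : Type*} [Group F] [AddCommGroup A] {S T : Subgroup F}

/-- The projection fixes a − 1 and maps the ideal into the conjugation-stable group Δ(S)²Δ(S ∩ T),
to which `mem_of_del_mem` applies. -/
theorem mem_of_del_mem_four [IsFreeGroup F] [hS : S.Normal] [hT : T.Normal] (hST : S ⊔ T = ⊤) {a : F}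
    (ha : del a ∈ grpIdeal (S ⊓ T) * grpIdeal S * grpIdeal S * grpIdeal T
      + grpIdeal T * grpIdeal S * grpIdeal S * grpIdeal (S ⊓ T)) :
    a ∈ S ⊓ T ∧ a ∈ ⁅capTwo S T, capTwo S T⁆ ⊔ ⁅⁅S ⊓ T, S ⊓ T⁆, S ⊓ T⁆ := by
  have haU : a ∈ S ⊓ T := by
    refine mem_of_del_mem_grpIdeal ?_
    rw [grpIdeal_prod_eq, grpIdeal_prod_eq] at ha
    refine (sup_le ?_ ?_ : _ + _ ≤ grpIdeal (S ⊓ T)) ha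
    · rw [mul_assoc]; exact mul_le_mul' le_rfl le_top
    · rw [grpIdeal, (ConjStable.augSpan (S ⊓ T)).mul_top]; exact mul_le_mul' le_top le_rfl
  refine ⟨haU, ?_⟩
  obtain ⟨rep, hrep⟩ := exists_isRep hST
  have hstab : ConjStable (augSpan S * augSpan S * augSpan (S ⊓ T)) :=
    ((ConjStable.augSpan S).mul (ConjStable.augSpan S)).mul (ConjStable.augSpan (S ⊓ T))
  have h := hrep.kappaR_mem (W := augSpan S * augSpan S * augSpan (S ⊓ T))
    (mul_le_mul' (mul_le_mul' (augSpan_mul_augSpan_le le_rfl) le_rfl) le_rfl)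
    (fun τ _ z hz ↦ sub_mem (hstab τ z hz) hz) ha
  rw [hrep.kappaR_del haU.1] at h
  exact mem_of_del_mem inf_le_left h

variable [hS : S.Normal] [hT : T.Normal] {χ : F → A} (h : CentralChar S T χ) {q : F →* F}
  (hq : IsLift S T q) {Φ : MonoidAlgebra ℤ F →ₗ[ℤ] A}

namespace CentralChar

include h hq

section Crossed

variable {c : F → F → A} (hc1 : ∀ f, HomOn (capTwo S T) (c f))
  (hc2 : ∀ f g w, c (f * g) w = c f w + c g ((q f)⁻¹ * w * q f))
  (hc3 : ∀ f, ∀ u ∈ S ⊓ T, ∀ v ∈ S ⊓ T, c f ⁅u, v⁆ =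
    χ ⁅defect q f, ⁅u, v⁆⁆ - χ ⁅⁅defect q f, u⁆, ⁅defect q f, v⁆⁆)
include hc1 hc2 hc3

/-- The crossed pair attached to a crossed homomorphism. -/
theorem crossedPair_crossed :
    CrossedPair S T (fun _ _ _ ↦ 0) fun τ w ↦ χ ⁅defect q τ, w⁆ - c τ w := by
  have hom : ∀ τ, HomOn (capTwo S T) fun w ↦ χ ⁅defect q τ, w⁆ - c τ w := fun τ ↦
    (h.homOn_right (hq.defect_mem τ)).sub (hc1 τ)
  -- For τ ∈ T the defect lies in S ∩ T, so the quadratic term pairs [S ∩ T, S ∩ T] with `capTwo S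
  -- T` and is zero. This permits B = 0.
  have comm : ∀ {τ u u'}, τ ∈ T → u ∈ S ⊓ T → u' ∈ S ⊓ T →
      χ ⁅defect q τ, ⁅u, u'⁆⁆ - c τ ⁅u, u'⁆ = 0 := by
    intro τ u u' hτ hu hu'
    have hn := hq.defect_mem_cap hτ
    rw [hc3 τ u hu u' hu', h.eq_zero_left (commutator_mem_capTwo hn.1 hu')
      (Subgroup.commutator_mem_commutator hn hu), sub_zero, sub_self]
  refine ⟨fun _ _ ↦ HomOn.zero, fun _ _ ↦ HomOn.zero, fun _ _ _ ↦ rfl, fun _ ↦ hom _,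
    fun hτ hu hu' ↦ by rw [comm hτ hu hu', sub_zero], fun _ _ _ _ ↦ by rw [add_zero], ?_⟩
  intro σ τ w hσ hτ hw
  have hcap : ∀ g : F, g⁻¹ * w * g ∈ capTwo S T := fun g ↦ by
    simpa using Subgroup.Normal.conj_mem (inferInstanceAs (capTwo S T).Normal) w hw g⁻¹
  have hn := hq.defect_mem_cap hτ
  have h1 := hq.hom_defect_mul (h.homOn_left_cap hw) hσ hτ
  have hu : (q σ)⁻¹ * (defect q σ)⁻¹ * q σ ∈ S ⊓ T := by
    simpa using Subgroup.Normal.conj_mem (inferInstanceAs (S ⊓ T).Normal) _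
      (inv_mem (hq.defect_mem_cap hσ)) (q σ)⁻¹
  -- Conjugates of w by σ⁻¹ and (q σ)⁻¹ differ by a commutator of elements of S ∩ T, where the
  -- function vanishes by `comm`.
  have e : σ⁻¹ * w * σ = ⁅(q σ)⁻¹ * (defect q σ)⁻¹ * q σ, (q σ)⁻¹ * w * q σ⁆ *
      ((q σ)⁻¹ * w * q σ) := by
    rw [commutator_mul_self_eq_conj, defect]; group
  have h2 := hom τ _ (commutator_mem_capTwo hu.1 (hcap (q σ)).1) _ (hcap (q σ))
  beta_reduce at h2
  rw [← e, comm hτ hu (hcap (q σ)).1, zero_add] at h2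
  have h4 := h.mul_right_capTwo hn.1 (capThree_le_capTwo
    (commutator_mem_capThree' (hcap (q σ)) hu.1)) (hcap (q σ))
  rw [← e, h.commutator_right (commutator_mem_capThree' (hcap (q σ)) hu.1) hn.2, zero_add] at h4
  rw [h1, h.conj_pair_right hσ (commutator_mem_capThree' (hcap σ) hn.1), hc2, h2, h4]
  abel

theorem crossed_mul {s s' w : F} (hs : s ∈ S) (hs' : s' ∈ S) (hw : w ∈ capTwo S T) :
    c (s * s') w = c s w + c s' w + χ ⁅⁅q s, s'⁆, w⁆ := by
  have hu := inv_mem (hq.mem_cap hs)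
  have hn := hq.defect_mem s'
  have hq' := hq.mem_cap hs'
  have e : (q s)⁻¹ * w * q s = ⁅(q s)⁻¹, w⁆ * w := by rw [commutator_mul_self_eq_conj, inv_inv]
  have h1 := hc1 s' _ (commutator_mem_capTwo hu.1 hw.1) _ hw
  have h2 : χ ⁅⁅q s, defect q s'⁆, w⁆ = χ ⁅⁅q s, s'⁆, w⁆ := by
    rw [defect, h.triple_mul_mid (hq.mem_cap hs) hs' (inv_mem hq').1 hw.1,
      h.eq_zero_left hw (Subgroup.commutator_mem_commutator (hq.mem_cap hs) (inv_mem hq')), add_zero]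
  rw [hc2, e, h1, hc3 s' _ hu w hw.1, h.jacobi_capTwo_right hn hw hu,
    h.commutator_right (commutator_mem_capThree' hw hn) (commutator_mem_capTwo hn hu).1.2,
    h.triple_swap hu hn hw.1, (h.homOn_triple_left hn hw.1).inv (hq.mem_cap hs), h2]
  abel

/-- By `crossed_mul`, c s w and Φ((s − 1)(w − 1)) have the same deviation from additivity in s;
their difference is a homomorphism on S and vanishes on [S,S]. -/
theorem crossed_eq (hΦ : ∀ x ∈ S, ∀ y ∈ S, ∀ u ∈ S ⊓ T,
    Φ (del x * del y * del u) = χ ⁅⁅q x, y⁆, u⁆) {g w : F} (hg : g ∈ ⁅S, S⁆)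
    (hw : w ∈ capTwo S T) : c g w = Φ (del g * del w) := by
  have hom : HomOn S fun s ↦ c s w - Φ (del s * del w) := by
    intro s hs s' hs'
    simp only [del_mul, add_mul, map_add]
    rw [h.crossed_mul hq hc1 hc2 hc3 hs hs' hw, hΦ s hs s' hs' w hw.1]
    abel
  exact sub_eq_zero.mp (hom.eq_zero_of_mem_commutator hg)

end Crossed

section Values

variable {w w' x y z : F}

theorem crossedPair_pair (hΦ : ∀ w ∈ capTwo S T, ∀ τ ∈ T, Φ (del w * del τ) = χ ⁅w, defect q τ⁆)
    (hw : w ∈ capTwo S T) (hw' : w' ∈ capTwo S T) :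
    Φ (del ⁅w, w'⁆) = χ ⁅w, w'⁆ + χ ⁅w, w'⁆ := by
  rw [(h.crossedPair hq).functional_commutator hΦ hw hw', h.pair_defect_right hq hw hw',
    h.pair_defect_right hq hw' hw, h.symm (commutator_mem_capThree hw hw'.1.1), sub_neg_eq_add]

theorem crossedPair_pair' (hΦ : ∀ w ∈ capTwo S T, ∀ τ ∈ T,
      Φ (del w * del τ) = χ ⁅w, defect q τ⁆ + χ ⁅w, defect q τ⁆)
    (hw : w ∈ capTwo S T) (hw' : w' ∈ capTwo S T) :
    Φ (del ⁅w, w'⁆) = χ ⁅w, w'⁆ + χ ⁅w, w'⁆ + (χ ⁅w, w'⁆ + χ ⁅w, w'⁆) := by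
  rw [(h.crossedPair' hq).functional_commutator hΦ hw hw', h.pair_defect_right hq hw hw',
    h.pair_defect_right hq hw' hw, h.symm (commutator_mem_capThree hw hw'.1.1)]
  abel

theorem crossedPair_triple
    (hΦ' : ∀ b ∈ S ⊓ T, ∀ s ∈ S, ∀ τ ∈ T, Φ (del b * del s * del τ) = χ ⁅⁅defect q τ, s⁆, b⁆)
    (hΦ : ∀ w ∈ capTwo S T, ∀ τ ∈ T, Φ (del w * del τ) = χ ⁅w, defect q τ⁆)
    (hx : x ∈ S ⊓ T) (hy : y ∈ S ⊓ T) (hz : z ∈ S ⊓ T) :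
    Φ (del ⁅⁅x, y⁆, z⁆) = χ ⁅⁅x, y⁆, z⁆ - χ ⁅⁅x, y⁆, q z⁆ - (χ ⁅⁅y, x⁆, z⁆ - χ ⁅⁅q y, x⁆, z⁆) +
      (χ ⁅⁅x, y⁆, z⁆ - χ ⁅⁅q x, y⁆, z⁆) := by
  rw [(h.crossedPair hq).functional_triple hΦ' hΦ hx hy hz,
    hq.hom_defect (h.homOn_triple_right hx hy.1) hz, hq.hom_defect (h.homOn_triple_left hx.1 hz) hy,
    hq.hom_defect (h.homOn_triple_left hy.1 hz) hx]

theorem crossedPair_triple'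
    (hΦ' : ∀ b ∈ S ⊓ T, ∀ s ∈ S, ∀ τ ∈ T, Φ (del b * del s * del τ) = χ ⁅⁅b, s⁆, defect q τ⁆)
    (hΦ : ∀ w ∈ capTwo S T, ∀ τ ∈ T,
      Φ (del w * del τ) = χ ⁅w, defect q τ⁆ + χ ⁅w, defect q τ⁆)
    (hx : x ∈ S ⊓ T) (hy : y ∈ S ⊓ T) (hz : z ∈ S ⊓ T) :
    Φ (del ⁅⁅x, y⁆, z⁆) = χ ⁅⁅x, y⁆, z⁆ - χ ⁅⁅x, y⁆, q z⁆ + (χ ⁅⁅x, y⁆, z⁆ - χ ⁅⁅x, y⁆, q z⁆) -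
      (χ ⁅⁅z, x⁆, y⁆ - χ ⁅⁅z, x⁆, q y⁆) + (χ ⁅⁅z, y⁆, x⁆ - χ ⁅⁅z, y⁆, q x⁆) := by
  rw [(h.crossedPair' hq).functional_triple hΦ' hΦ hx hy hz,
    hq.hom_defect (h.homOn_triple_right hx hy.1) hz, hq.hom_defect (h.homOn_triple_right hz hx.1) hy,
    hq.hom_defect (h.homOn_triple_right hz hy.1) hx]

end Values

theorem isTriadditive_op : IsTriadditive S (S ⊓ T) fun x y u ↦ χ ⁅⁅q y, x⁆, u⁆ where
  left hx hx' hy hu := (h.isTriadditive hq).mid hy hx hx' hu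
  mid hx hy hy' hu := (h.isTriadditive hq).left hy hy' hx hu
  right hx hy hu hu' := (h.isTriadditive hq).right hy hx hu hu'

/-- The six-fold multiple of a central character, as a combination of functionals. -/
theorem six_smul_eq_zero [IsFreeGroup F] (hA : Module.Baer ℤ A) (hST : S ⊔ T = ⊤) {a : F}
    (ha : del a ∈ grpIdeal (S ⊓ T) * grpIdeal S * grpIdeal S * grpIdeal T
      + grpIdeal T * grpIdeal S * grpIdeal S * grpIdeal (S ⊓ T)) : (6 : ℤ) • χ a = 0 := by
  obtain ⟨rep, hrep⟩ := exists_isRep hST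
  obtain ⟨haU, haW⟩ := mem_of_del_mem_four hST ha
  have haT : del a ∈ grpIdeal T * grpIdeal S * grpIdeal S * grpIdeal T := by
    refine (sup_le ?_ ?_ : _ + _ ≤ grpIdeal T * grpIdeal S * grpIdeal S * grpIdeal T) ha
    · exact mul_le_mul' (mul_le_mul' (mul_le_mul' (grpIdeal_mono inf_le_right) le_rfl) le_rfl) le_rfl
    · exact mul_le_mul' le_rfl (grpIdeal_mono inf_le_right)
  obtain ⟨c, hc1, hc2, hc3⟩ := h.exists_crossed hq hA
  have pE := h.crossedPair hq
  have pE' := h.crossedPair' hq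
  have pX := h.crossedPair_crossed hq hc1 hc2 hc3
  have t1 := h.isTriadditive hq
  have t2 := h.isTriadditive_op hq
  obtain ⟨E, hEa, hEB, hEC⟩ := pE.exists_functional hA hrep
  obtain ⟨E', hEa', hEB', hEC'⟩ := pE'.exists_functional hA hrep
  obtain ⟨X, hXa, hXB, hXC⟩ := pX.exists_functional hA hrep
  obtain ⟨Φ₁, hΦ₁⟩ := t1.exists_functional inf_le_left
  obtain ⟨Φ₂, hΦ₂⟩ := t2.exists_functional inf_le_left
  have e1 := t1.functional_kappaR_eq_zero hrep hΦ₁ (fun τ hτ x hx y hy u hu ↦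
    h.triadditive_conj hq hτ hx hy hu) ha
  have e2 := t2.functional_kappaR_eq_zero hrep hΦ₂ (fun τ hτ x hx y hy u hu ↦
    h.triadditive_conj hq hτ hy hx hu) ha
  rw [hrep.kappaR_del haU.1] at e1 e2
  have eE := hEa _ haT
  have eE' := hEa' _ haT
  have eX := hXa _ haT
  -- On [w, w'] the functionals E, E', X give 2χ, 4χ and −2χ plus a Φ₁ term; −2X cancels the
  -- contribution of Φ₁ − Φ₂, leaving 6 + 4 − 4 = 6. On [[x, y], z] the functional X gives 0, while
  -- E and E' each give 3χ up to terms in q; thus 3E − E' gives 6χ, and Φ₁ − Φ₂ removes the terms in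
  -- q by Jacobi.
  let ψ : F → A := fun x ↦ (3 : ℤ) • E (del x) + Φ₁ (del x) - (2 : ℤ) • X (del x) - E' (del x)
    - Φ₂ (del x)
  have hψa : ψ a = 0 := by simp only [ψ, e1, e2, eE, eE', eX]; simp
  have hψ : HomOn ⁅S ⊓ T, S ⊓ T⁆ ψ := by
    refine ((((HomOn.zsmul ?_ 3).add ?_).sub (HomOn.zsmul ?_ 2)).sub ?_).sub ?_
    · exact pE.homOn_functional hEC fun a ha b hb ↦ h.pair_defect_eq_zero hq ha hb
    · exact t1.homOn_functional inf_le_left hΦ₁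
    · refine pX.homOn_functional hXC fun a ha b hb ↦ ?_
      exact ((pX.hom (commutator_le_capTwo hb).1.2).mono commutator_le_capTwo).eq_of_commutator
        HomOn.zero (fun u hu u' hu' ↦ (pX.commutator (commutator_le_capTwo hb).1.2 hu hu').trans
          (sub_zero 0)) ha
    · exact pE'.homOn_functional hEC' fun a ha b hb ↦ by
        rw [h.pair_defect_eq_zero hq ha hb, add_zero]
    · exact t2.homOn_functional inf_le_left hΦ₂
  -- The two triadditive functions differ by exchanging the first two arguments, which changes the
  -- sign on commutators.
  have hΦ₁₂ : ∀ w ∈ ⁅S, S⁆, ∀ b ∈ S ⊓ T, Φ₂ (del w * del b) = -Φ₁ (del w * del b) := by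
    intro w hw b hb
    refine (t2.homOn_functional_left hΦ₂ hb).eq_of_commutator
      (t1.homOn_functional_left hΦ₁ hb).neg
      (fun x hx y hy ↦ ?_) hw
    rw [t2.functional_commutator_mul hΦ₂ hx hy hb,
      t1.functional_commutator_mul hΦ₁ hx hy hb, neg_sub]
  have hpair : ∀ w ∈ capTwo S T, ∀ w' ∈ capTwo S T, (6 : ℤ) • χ ⁅w, w'⁆ = ψ ⁅w, w'⁆ := by
    intro w hw w' hw'
    have v1 := t1.functional_commutator inf_le_left hΦ₁ hw hw'
    have v2 := t2.functional_commutator inf_le_left hΦ₂ hw hw'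
    have vX := pX.functional_commutator hXC hw hw'
    rw [h.pair_defect_left hq hw hw', h.pair_defect_left hq hw' hw,
      h.crossed_eq hq hc1 hc2 hc3 hΦ₁ hw'.2 hw, h.crossed_eq hq hc1 hc2 hc3 hΦ₁ hw.2 hw',
      h.symm (commutator_mem_capThree hw hw'.1.1)] at vX
    rw [hΦ₁₂ w hw.2 w' hw'.1, hΦ₁₂ w' hw'.2 w hw.1] at v2
    simp only [ψ]
    rw [v1, v2, vX, h.crossedPair_pair hq hEC hw hw', h.crossedPair_pair' hq hEC' hw hw']
    module
  have htriple : ∀ x ∈ S ⊓ T, ∀ y ∈ S ⊓ T, ∀ z ∈ S ⊓ T,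
      (6 : ℤ) • χ ⁅⁅x, y⁆, z⁆ = ψ ⁅⁅x, y⁆, z⁆ := by
    intro x hx y hy z hz
    have v1 := t1.functional_triple inf_le_left hΦ₁ hx hy hz
    have v2 := t2.functional_triple inf_le_left hΦ₂ hx hy hz
    have vX := pX.functional_triple hXB hXC hx hy hz
    have vX' := pX.commutator hz.2 hx hy
    rw [vX', sub_zero, sub_zero, add_zero] at vX
    have hx' := hq.mem_cap hx.1
    have hy' := hq.mem_cap hy.1
    have hz' := hq.mem_cap hz.1
    have j0 := h.triple_jacobi hx hy hz
    have j1 := h.triple_jacobi hx' hy hz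
    have j2 := h.triple_jacobi hx hy' hz
    have j3 := h.triple_jacobi hx hy hz'
    rw [h.triple_swap hx hz.1 hy] at j0
    rw [h.triple_swap hx' hz.1 hy] at j1
    rw [h.triple_swap hy' hx.1 hz, h.triple_swap hx hz.1 hy'] at j2
    rw [h.triple_swap hz' hy.1 hx] at j3
    simp only [ψ]
    rw [v1, v2, vX, h.crossedPair_triple hq hEB hEC hx hy hz,
      h.crossedPair_triple' hq hEB' hEC' hx hy hz, h.triple_swap hx hz.1 hy,
      h.triple_swap hy hz.1 hx, h.triple_swap hx hz.1 hy', h.triple_swap hy hz.1 hx',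
      h.triple_swap hx hy.1 hz]
    generalize χ ⁅⁅x, y⁆, z⁆ = a0 at *
    generalize χ ⁅⁅y, z⁆, x⁆ = a1 at *
    generalize χ ⁅⁅x, z⁆, y⁆ = a2 at *
    generalize χ ⁅⁅q x, y⁆, z⁆ = b0 at *
    generalize χ ⁅⁅y, z⁆, q x⁆ = b1 at *
    generalize χ ⁅⁅q x, z⁆, y⁆ = b2 at *
    generalize χ ⁅⁅q y, x⁆, z⁆ = c0 at *
    generalize χ ⁅⁅q y, z⁆, x⁆ = c1 at *
    generalize χ ⁅⁅x, z⁆, q y⁆ = c2 at *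
    generalize χ ⁅⁅x, y⁆, q z⁆ = d0 at *
    generalize χ ⁅⁅q z, y⁆, x⁆ = d1 at *
    generalize χ ⁅⁅q z, x⁆, y⁆ = d2 at *
    grind only
  have hle : ⁅capTwo S T, capTwo S T⁆ ⊔ ⁅⁅S ⊓ T, S ⊓ T⁆, S ⊓ T⁆ ≤ ⁅S ⊓ T, S ⊓ T⁆ :=
    sup_le (Subgroup.commutator_mono inf_le_left inf_le_left)
      (Subgroup.commutator_mono (Subgroup.commutator_le_self _) le_rfl)
  have hK : ⁅⁅S ⊓ T, S ⊓ T⁆, S ⊓ T⁆ ≤ capThree S T :=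
    Subgroup.commutator_le.mpr fun c hc z hz ↦
      commutator_mem_capThree (commutator_le_capTwo hc) hz.1
  have hK' : ⁅capTwo S T, capTwo S T⁆ ≤ capThree S T :=
    Subgroup.commutator_le.mpr fun w hw w' hw' ↦ commutator_mem_capThree hw hw'.1.1
  have hχ := h.hom.zsmul 6
  rw [← hψa]
  refine (hχ.mono (sup_le hK' hK)).eq_of_sup (hψ.mono hle) (fun x hx ↦ ?_) (fun x hx ↦ ?_) haW
  · exact (hχ.mono hK').eq_of_commutator (hψ.mono (le_sup_left.trans hle)) hpair hx
  · exact hχ.eq_on_triple_commutator hK (fun x hx k hk ↦ by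
      rw [h.conj (commutator_le_capTwo hx).1.2 (hK hk)]) hψ htriple hx

end CentralChar

end SixSmul

/-! ### Reductions and the two parts of the theorem -/

section Final

variable {F : Type*} [Group F] {S T : Subgroup F}

/-- `capThree S T` is abelian modulo [γ₃(S), T], so ℚ/ℤ-valued characters detect whether aⁿ is
trivial there. -/
theorem pow_mem_of_forall_centralChar [hS : S.Normal] [hT : T.Normal] {a : F} {n : ℕ}
    (ha : a ∈ capThree S T)
    (h : ∀ χ : F → AddCircle (1 : ℚ), CentralChar S T χ → (n : ℤ) • χ a = 0) :
    a ^ n ∈ ⁅⁅⁅S, S⁆, S⁆, T⁆ := by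
  by_contra hn
  obtain ⟨χ, h1, h2, h3⟩ := exists_character_ne_zero (L := capThree S T)
    (le_inf (Subgroup.commutator_le_left _ _) (Subgroup.commutator_le_right _ _))
    (Subgroup.commutator_mono inf_le_left inf_le_right) (pow_mem ha n) hn
  refine h3 ?_
  rw [h1.pow ha, ← natCast_zsmul]
  exact h χ ⟨h1, h2 _⟩

theorem capThree_of_mem [hS : S.Normal] [hT : T.Normal] {a : F}
    (ha : a ∈ ⁅capTwo S T, capTwo S T⁆ ⊔ ⁅⁅S ⊓ T, S ⊓ T⁆, S ⊓ T⁆) : a ∈ capThree S T :=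
  (sup_le (Subgroup.commutator_le.mpr fun _ hw _ hw' ↦ commutator_mem_capThree hw hw'.1.1)
    (Subgroup.commutator_le.mpr fun _ hc _ hz ↦
      commutator_mem_capThree (commutator_le_capTwo hc) hz.1) :
    ⁅capTwo S T, capTwo S T⁆ ⊔ ⁅⁅S ⊓ T, S ⊓ T⁆, S ⊓ T⁆ ≤ capThree S T) ha

theorem baer_addCircle : Module.Baer ℤ (AddCircle (1 : ℚ)) := Module.Baer.of_divisible _

theorem pow_six_mem_of_sup_eq_top [IsFreeGroup F] [hS : S.Normal] [hT : T.Normal]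
    (hST : S ⊔ T = ⊤) {a : F}
    (ha : del a ∈ grpIdeal (S ⊓ T) * grpIdeal S * grpIdeal S * grpIdeal T
      + grpIdeal T * grpIdeal S * grpIdeal S * grpIdeal (S ⊓ T)) :
    a ^ 6 ∈ ⁅⁅⁅S, S⁆, S⁆, T⁆ := by
  obtain ⟨q, hq⟩ := exists_isLift hST
  exact pow_mem_of_forall_centralChar (capThree_of_mem (mem_of_del_mem_four hST ha).2)
    fun χ h ↦ h.six_smul_eq_zero hq baer_addCircle hST ha

theorem mul_top_mul_grpIdeal (W : Submodule ℤ (MonoidAlgebra ℤ F)) (B : Subgroup F) [B.Normal] :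
    W * ⊤ * grpIdeal B = W * augSpan B * ⊤ := by
  rw [grpIdeal, (ConjStable.augSpan B).mul_top, mul_assoc, ← mul_assoc ⊤ ⊤, top_mul_top_eq,
    ← (ConjStable.augSpan B).mul_top, mul_assoc]

/-- With ℤ[F] only at the right end, the product is compatible with projections that are linear on
the left. -/
theorem grpIdeal_prod_eq_mul_top (A B C D : Subgroup F) [B.Normal] [C.Normal] [D.Normal] :
    grpIdeal A * grpIdeal B * grpIdeal C * grpIdeal D =
      augSpan A * (augSpan B * (augSpan C * (augSpan D * ⊤))) := by
  rw [grpIdeal, mul_top_mul_grpIdeal, mul_top_mul_grpIdeal, mul_top_mul_grpIdeal]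
  simp only [mul_assoc]

/-- A projection of `ℤ[F]` onto the group ring of a subgroup, linear over the latter. -/
theorem exists_projection (H : Subgroup F) :
    ∃ π : MonoidAlgebra ℤ F →ₗ[ℤ] MonoidAlgebra ℤ H,
      (∀ h : H, ∀ z, π (del (h : F) * z) = del h * π z) ∧ ∀ h : H, π (del (h : F)) = del h := by
  obtain ⟨κ, hκ, hκH⟩ := exists_coset_coordinate H
  let π : MonoidAlgebra ℤ F →ₗ[ℤ] MonoidAlgebra ℤ H :=
    gext fun f ↦ of ℤ H (⟨κ f, hκ f⟩ * ⟨κ 1, hκ 1⟩⁻¹)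
  have h1 : ∀ (h : H) f, π (of ℤ F (h * f)) = of ℤ H h * π (of ℤ F f) := by
    intro h f
    have e : (⟨κ (h * f), hκ _⟩ : H) = h * ⟨κ f, hκ f⟩ := Subtype.ext (hκH h h.2 f)
    rw [gext_of, gext_of, e, ← map_mul, mul_assoc]
  have h2 : π 1 = 1 := by
    rw [gext_one, mul_inv_cancel, map_one]
  have h3 : ∀ h : H, π (del (h : F)) = del h := by
    intro h
    have := h1 h 1
    rw [mul_one, map_one, h2, mul_one] at this
    rw [del, map_sub, this, h2, del]
  refine ⟨π, fun h z ↦ ?_, h3⟩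
  refine LinearMap.congr_fun (hom_ext_of (φ := π ∘ₗ LinearMap.mulLeft ℤ (del (h : F)))
    (ψ := LinearMap.mulLeft ℤ (del h) ∘ₗ π) fun f ↦ ?_) z
  rw [LinearMap.comp_apply, LinearMap.comp_apply, LinearMap.mulLeft_apply, LinearMap.mulLeft_apply,
    del, del, sub_mul, sub_mul, one_mul, one_mul, map_sub, ← map_mul, h1]

theorem grpIdeal_prod_le_comap {H : Subgroup F} {π : MonoidAlgebra ℤ F →ₗ[ℤ] MonoidAlgebra ℤ H}
    (hπ : ∀ h : H, ∀ z, π (del (h : F) * z) = del h * π z) {A B C D : Subgroup F}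
    [B.Normal] [C.Normal] [D.Normal] (hA : A ≤ H) (hB : B ≤ H) (hC : C ≤ H) (hD : D ≤ H) :
    grpIdeal A * grpIdeal B * grpIdeal C * grpIdeal D ≤
      (grpIdeal (A.subgroupOf H) * grpIdeal (B.subgroupOf H) * grpIdeal (C.subgroupOf H) *
        grpIdeal (D.subgroupOf H)).comap π := by
  have key : ∀ {A : Subgroup F} {Y : Submodule ℤ (MonoidAlgebra ℤ F)}
      {Y' : Submodule ℤ (MonoidAlgebra ℤ H)}, A ≤ H → Y ≤ Submodule.comap π Y' →
      augSpan A * Y ≤ (augSpan (A.subgroupOf H) * Y').comap π := by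
    intro A Y Y' hA hY
    rw [Submodule.mul_le]
    intro m hm y hy
    induction hm using Submodule.span_induction with
    | mem x hx =>
      obtain ⟨s, hs, rfl⟩ := hx
      change π (del ((⟨s, hA hs⟩ : H) : F) * y) ∈ augSpan (A.subgroupOf H) * Y'
      rw [hπ]
      exact Submodule.mul_mem_mul (del_mem_augSpan (Subgroup.mem_subgroupOf.mpr hs)) (hY hy)
    | zero => simp
    | add u v _ _ hu hv => rw [add_mul]; exact add_mem hu hv
    | smul n u _ hu => rw [smul_mul_assoc]; exact Submodule.smul_mem _ n hu
  rw [grpIdeal_prod_eq_mul_top, grpIdeal_prod_eq_mul_top]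
  exact key hA (key hB (key hC (key hD le_top)))

/-- Two reductions: R is enlarged to S ∩ T, and F is replaced by H = ST, which contains a, through a
left ℤ[H]-linear projection. -/
theorem pow_six_mem [IsFreeGroup F] {R : Subgroup F} [hR : R.Normal] [hS : S.Normal]
    [hT : T.Normal] (hRS : R ≤ S) (hRT : R ≤ T) {a : F}
    (ha : del a ∈ grpIdeal R * grpIdeal S * grpIdeal S * grpIdeal T
      + grpIdeal T * grpIdeal S * grpIdeal S * grpIdeal R) :
    a ^ 6 ∈ ⁅⁅⁅S, S⁆, S⁆, T⁆ := by
  have hSH : S ≤ S ⊔ T := le_sup_left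
  have hTH : T ≤ S ⊔ T := le_sup_right
  have haH : a ∈ S ⊔ T := by
    refine mem_of_del_mem_grpIdeal ((sup_le ?_ ?_ : _ + _ ≤ grpIdeal (S ⊔ T)) ha)
    · rw [grpIdeal_prod_eq_mul_top]; exact mul_le_mul' (augSpan_mono (hRS.trans hSH)) le_top
    · rw [grpIdeal_prod_eq_mul_top]; exact mul_le_mul' (augSpan_mono hTH) le_top
  generalize hH : S ⊔ T = H at *
  obtain ⟨π, hπ, hπ1⟩ := exists_projection H
  have hle : R.subgroupOf H ≤ S.subgroupOf H ⊓ T.subgroupOf H := fun x hx ↦ ⟨hRS hx, hRT hx⟩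
  have haπ : del (⟨a, haH⟩ : H) ∈ grpIdeal (S.subgroupOf H ⊓ T.subgroupOf H) *
      grpIdeal (S.subgroupOf H) * grpIdeal (S.subgroupOf H) * grpIdeal (T.subgroupOf H) +
      grpIdeal (T.subgroupOf H) * grpIdeal (S.subgroupOf H) * grpIdeal (S.subgroupOf H) *
      grpIdeal (S.subgroupOf H ⊓ T.subgroupOf H) := by
    rw [← hπ1, ← Submodule.mem_comap]
    refine (sup_le ?_ ?_ : _ + _ ≤ Submodule.comap π _) ha
    · refine (grpIdeal_prod_le_comap hπ (hRS.trans hSH) hSH hSH hTH).trans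
        (Submodule.comap_mono (le_trans ?_ le_sup_left))
      exact mul_le_mul' (mul_le_mul' (mul_le_mul' (grpIdeal_mono hle) le_rfl) le_rfl) le_rfl
    · refine (grpIdeal_prod_le_comap hπ hTH hSH hSH (hRS.trans hSH)).trans
        (Submodule.comap_mono (le_trans ?_ le_sup_right))
      exact mul_le_mul' le_rfl (grpIdeal_mono hle)
  have h6 := pow_six_mem_of_sup_eq_top
    (by rw [← Subgroup.subgroupOf_sup hSH hTH, hH, Subgroup.subgroupOf_self]) haπ
  have h7 := Subgroup.mem_map_of_mem H.subtype h6
  simpa only [Subgroup.map_commutator, Subgroup.map_subgroupOf_eq_of_le hSH,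
    Subgroup.map_subgroupOf_eq_of_le hTH, map_pow, Subgroup.coe_subtype] using h7

/-- R ≤ S gives rsst ⊆ ssst and tssr ⊆ tsss, and a² − 1 = (a − 1)(a + 1) stays in these right
ideals. -/
theorem sq_mem_dimSubgroup {R : Subgroup F} (hRS : R ≤ S) {a : F}
    (ha : del a ∈ grpIdeal R * grpIdeal S * grpIdeal S * grpIdeal T
      + grpIdeal T * grpIdeal S * grpIdeal S * grpIdeal R) :
    del (a ^ 2) ∈ grpIdeal R * grpIdeal S * grpIdeal S * grpIdeal S
      + grpIdeal S * grpIdeal S * grpIdeal S * grpIdeal R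
      + grpIdeal T * grpIdeal S * grpIdeal S * grpIdeal S
      + grpIdeal S * grpIdeal S * grpIdeal S * grpIdeal T
      + augSpan ⁅S, S⁆ * grpIdeal S := by
  have e : del (a ^ 2) = del a * (of ℤ F a + 1) := by
    rw [del, del, map_pow]; noncomm_ring
  have h := Submodule.mul_mem_mul ha (show of ℤ F a + 1 ∈ ⊤ from trivial)
  have hT : ∀ B : Subgroup F, grpIdeal B * ⊤ = grpIdeal B := fun B ↦ by
    rw [grpIdeal, mul_assoc, top_mul_top_eq]
  have hR := grpIdeal_mono hRS
  rw [add_mul, mul_assoc _ _ ⊤, mul_assoc _ _ ⊤, hT, hT, ← e] at h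
  refine (sup_le ?_ ?_ : _ + _ ≤ (_ : Submodule ℤ (MonoidAlgebra ℤ F))) h
  · refine le_trans ?_ (le_sup_right.trans le_sup_left)
    exact mul_le_mul' (mul_le_mul' (mul_le_mul' hR le_rfl) le_rfl) le_rfl
  · refine le_trans ?_ ((le_sup_right.trans le_sup_left).trans le_sup_left)
    exact mul_le_mul' le_rfl hR

theorem IsRep.kappaR_mem_of_commutator {rep : F → F} (hrep : IsRep S ⊤ rep)
    {z : MonoidAlgebra ℤ F} (hz : z ∈ augSpan ⁅S, S⁆ * grpIdeal S) :
    kappaR rep z ∈ augSpan ⁅S, S⁆ * augSpan S := by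
  rw [grpIdeal, ← mul_assoc] at hz
  suffices h : augSpan ⁅S, S⁆ * augSpan S * ⊤ ≤ (augSpan ⁅S, S⁆ * augSpan S).comap (kappaR rep)
    from h hz
  refine mul_top_le_iff.mpr fun f z hz ↦ ?_
  have hzS : z ∈ augSpan S := augSpan_mul_augSpan_le le_rfl
    ((mul_le_mul' (augSpan_mono (Subgroup.commutator_le_self S)) le_rfl : _ ≤ augSpan S * _) hz)
  rw [Submodule.mem_comap, hrep.kappaR_mul_of hzS]
  exact mul_augSpan_mul_of_mem le_rfl hz (hrep.mul_inv_mem f)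

namespace CentralChar

variable {A : Type*} [AddCommGroup A] [hS : S.Normal] [hT : T.Normal] {χ : F → A}
  (h : CentralChar S T χ)
include h

/-- The symmetrization of a triple commutator is triadditive. -/
theorem isTriadditive_symm (hST : S ≤ T) :
    IsTriadditive S (S ⊓ T) fun x y u ↦ χ ⁅⁅x, u⁆, y⁆ + χ ⁅⁅y, u⁆, x⁆ := by
  have hU : ∀ {x}, x ∈ S → x ∈ S ⊓ T := fun hx ↦ ⟨hx, hST hx⟩
  refine ⟨fun hx hx' hy hu ↦ ?_, fun hx hy hy' hu ↦ ?_, fun hx hy hu hu' ↦ ?_⟩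
  · rw [h.triple_mul_left (hU hx) (hU hx') hu.1 (hU hy),
      h.triple_mul_right (hU hy) hu.1 (hU hx) (hU hx')]
    abel
  · rw [h.triple_mul_left (hU hy) (hU hy') hu.1 (hU hx),
      h.triple_mul_right (hU hx) hu.1 (hU hy) (hU hy')]
    abel
  · rw [h.triple_mul_mid (hU hx) hu.1 hu'.1 (hU hy), h.triple_mul_mid (hU hy) hu.1 hu'.1 (hU hx)]
    abel

end CentralChar

/-- With T = F, the symmetrized function t(x, y, u) = χ[[x, u], y] + χ[[y, u], x] is invariant under
F, so its functional handles the first two ideals. Its value on [[x, y], z] − 1 is −2χ[[x,y],z] +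
χ[[y,z],x] + χ[[z,x],y], which is −3χ[[x,y],z] by Jacobi. -/
theorem pow_three_mem [IsFreeGroup F] {R : Subgroup F} [hR : R.Normal] {a : F}
    (ha : del a ∈ grpIdeal R * grpIdeal R * grpIdeal R * grpIdeal ⊤
          + grpIdeal ⊤ * grpIdeal R * grpIdeal R * grpIdeal R
          + augSpan ⁅R, R⁆ * grpIdeal R) :
    a ^ 3 ∈ ⁅⁅⁅R, R⁆, R⁆, (⊤ : Subgroup F)⁆ := by
  have hRT : R ⊓ ⊤ = R := inf_top_eq R
  obtain ⟨rep, hrep⟩ := exists_isRep (sup_top_eq R)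
  obtain ⟨x, hx, y, hy, e⟩ := Submodule.mem_sup.mp ha
  have hx' : x ∈ grpIdeal (R ⊓ ⊤) * grpIdeal R * grpIdeal R * grpIdeal ⊤
      + grpIdeal ⊤ * grpIdeal R * grpIdeal R * grpIdeal (R ⊓ ⊤) := by rw [hRT]; exact hx
  have hy' := hrep.kappaR_mem_of_commutator hy
  have haR : a ∈ R := by
    refine mem_of_del_mem_grpIdeal ?_
    rw [← e]
    refine add_mem ((sup_le ?_ ?_ : _ + _ ≤ grpIdeal R) hx) ?_
    · rw [grpIdeal_prod_eq_mul_top]; exact mul_le_mul' le_rfl le_top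
    · rw [grpIdeal_prod_eq, grpIdeal, (ConjStable.augSpan R).mul_top]
      exact mul_le_mul' le_top le_rfl
    · exact (mul_le_mul' (augSpan_mono (Subgroup.commutator_le_self R)) le_top :
        _ ≤ augSpan R * ⊤) hy
  have hκa : del a = kappaR rep x + kappaR rep y := by
    rw [← map_add, e, hrep.kappaR_del haR]
  have ha3 : a ∈ ⁅⁅R, R⁆, R⁆ := by
    have hstab : ConjStable (augSpan R * augSpan R * augSpan (R ⊓ ⊤)) :=
      ((ConjStable.augSpan R).mul (ConjStable.augSpan R)).mul (ConjStable.augSpan (R ⊓ ⊤))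
    have h1 := hrep.kappaR_mem (W := augSpan R * augSpan R * augSpan (R ⊓ ⊤))
      (mul_le_mul' (mul_le_mul' (augSpan_mul_augSpan_le le_rfl) le_rfl) le_rfl)
      (fun τ _ z hz ↦ sub_mem (hstab τ z hz) hz) hx'
    have hcc : augSpan ⁅R, R⁆ ≤ augSpan R * augSpan R := by
      rw [augSpan, Submodule.span_le]
      rintro _ ⟨c, hc, rfl⟩
      exact del_commutator_mem hc
    have h2 : del a ∈ augSpan R * augSpan R * augSpan R := by
      rw [hκa]
      rw [hRT] at h1
      exact add_mem h1 ((mul_le_mul' hcc le_rfl : _ ≤ augSpan R * augSpan R * augSpan R) hy')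
    have h3 := mem_of_del_mem le_rfl h2
    rw [inf_eq_right.mpr (Subgroup.commutator_le_self R)] at h3
    exact (sup_le (Subgroup.commutator_mono le_rfl (Subgroup.commutator_le_self R)) le_rfl :
      _ ≤ ⁅⁅R, R⁆, R⁆) h3
  refine pow_mem_of_forall_centralChar ⟨ha3, trivial⟩ fun χ h ↦ ?_
  have hU : ∀ {x}, x ∈ R → x ∈ R ⊓ ⊤ := fun hx ↦ ⟨hx, trivial⟩
  have ht := h.isTriadditive_symm le_top
  obtain ⟨Φ, hΦ⟩ := ht.exists_functional inf_le_left
  have h1 := ht.functional_kappaR_eq_zero hrep hΦ (fun τ hτ x hx y hy u hu ↦ by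
    rw [h.conj_triple hτ (hU hx) hu.1 hy, h.conj_triple hτ (hU hy) hu.1 hx]) hx'
  -- Symmetry in the first two arguments makes Φ vanish on ([x, y] − 1)(r − 1), hence on the third
  -- ideal after projection.
  have h2 : Φ (kappaR rep y) = 0 := by
    refine augSpan_augSpan_eqOn (ψ := 0) (fun c hc r hr ↦ ?_) hy'
    refine (ht.homOn_functional_left hΦ (hU hr)).eq_of_commutator HomOn.zero
      (fun x hx y hy ↦ ?_) hc
    rw [ht.functional_commutator_mul hΦ hx hy (hU hr)]
    abel
  have h3 : Φ (del a) = 0 := by rw [hκa, map_add, h1, h2, add_zero]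
  have h4 : (-3 : ℤ) • χ a = Φ (del a) := by
    refine (h.hom.zsmul (-3)).eq_on_triple_commutator (U := R ⊓ ⊤) ?_ (fun x hx k hk ↦ ?_)
      (ht.homOn_functional inf_le_left hΦ) (fun x hx y hy z hz ↦ ?_) (by rw [hRT]; exact ha3)
    · rw [hRT]; exact le_inf le_rfl le_top
    · rw [hRT] at hk
      rw [h.conj trivial ⟨hk, trivial⟩]
    · rw [ht.functional_triple inf_le_left hΦ hx hy hz]
      have j := h.triple_jacobi hx hy hz
      rw [h.triple_swap hx hz.1 hy] at j
      rw [h.triple_swap hx hz.1 hy, h.triple_swap hx hy.1 hz, h.triple_swap hy hz.1 hx]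
      generalize χ ⁅⁅x, y⁆, z⁆ = a0 at *
      generalize χ ⁅⁅y, z⁆, x⁆ = a1 at *
      generalize χ ⁅⁅x, z⁆, y⁆ = a2 at *
      grind only
  rw [h3, neg_smul, neg_eq_zero] at h4
  exact h4

end Final

theorem mainTheorem7 {F : Type*} [Group F] [IsFreeGroup F] :
    (∀ R S T : Subgroup F, R.Normal → S.Normal → T.Normal → R ≤ S → R ≤ T →
      ∀ a ∈ dimSubgroup F
        (grpIdeal R * grpIdeal S * grpIdeal S * grpIdeal T
          + grpIdeal T * grpIdeal S * grpIdeal S * grpIdeal R),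
        a ^ 2 ∈ dimSubgroup F
          (grpIdeal R * grpIdeal S * grpIdeal S * grpIdeal S
            + grpIdeal S * grpIdeal S * grpIdeal S * grpIdeal R
            + grpIdeal T * grpIdeal S * grpIdeal S * grpIdeal S
            + grpIdeal S * grpIdeal S * grpIdeal S * grpIdeal T
            + augSpan ⁅S, S⁆ * grpIdeal S) ∧
        a ^ 6 ∈ ⁅⁅⁅S, S⁆, S⁆, R ⊔ T⁆) ∧
    (∀ R : Subgroup F, R.Normal →
      ∀ a ∈ dimSubgroup F
        (grpIdeal R * grpIdeal R * grpIdeal R * grpIdeal ⊤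
          + grpIdeal ⊤ * grpIdeal R * grpIdeal R * grpIdeal R
          + augSpan ⁅R, R⁆ * grpIdeal R),
        a ^ 3 ∈ ⁅⁅⁅R, R⁆, R⁆, (⊤ : Subgroup F)⁆) := by
  refine ⟨fun R S T hR hS hT hRS hRT a ha ↦ ⟨sq_mem_dimSubgroup hRS ha, ?_⟩,
    fun R hR a ha ↦ pow_three_mem ha⟩
  rw [sup_eq_right.mpr hRT]
  exact pow_six_mem hRS hRT ha
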